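/- **Homotopy commutativity of the sheet algebra.** *The cobordism category.* Let $\mathrm{Cob}^m_n$ be the category whose objects are formally shifted planar diagrams $q^k a$ ($k\in\mathbb Z$), where $a$ is a crossingless diagram with $m$ endpoints at the top and $n$ at the bottom, and whose morphisms $q^k a\to q^l b$ are $\mathbb Z[\alpha]$-linear combinations of dotted cobordisms from $a$ to $b$, modulo isotopy and the local relations: a sphere with $0,1,2,3$ dots equals $0,1,0,\alpha$ respectively; a tube equals the sum of the two surfaces obtained by cutting it, capping both ends with disks and placing a dot on one of the two disks; a handle equals twice a dot. It is graded: a cobordism $S\colon q^ka\to q^lb$ has degree $l-k-\chi(S)+\tfrac{m+n}{2}$ plus $2$ for each dot, and $\alpha$ has degree $4$. Let $\mathrm{BN}^m_n$ be its closure under finite direct sums, $\otimes$ the vertical stacking of diagrams, $1_n$ the diagram of $n$ vertical strands, and $\mathrm{BN}_n=\mathrm{BN}^n_n$. For $0\le i\le n-2$ let $a_i$ be the diagram with $n-2$ endpoints at the top and $n$ at the bottom in which an arc joins the bottom endpoints $i,i+1$ (numbered from $0$) and the others are joined to the top, and let $b_i$ be its reflection in a horizontal line. Chain complexes over $\mathrm{BN}^m_n$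 have differentials of homological degree $+1$ and quantum degree $0$, and contractions are required to have quantum degree $0$. *Universal projectors.* A chain complex $P$ over $\mathrm{BN}_n$ is a universal projector if 1. $P^k=0$ for $k>0$, $P^0\cong 1_n$ by an isomorphism of degree $0$, and for $k\neq 0$ no shift $q^s 1_n$ is a direct summand of $P^k$ (by maps of degree $0$); 2. for every $0\le i\le n-2$ the complexes $a_i\otimes P$ and $P\otimes b_i$ are contractible. *The sheet algebra.* $\mathrm{End}^\bullet(P)$ is the complex of abelian groups whose $k$-th group is spanned by the families of maps $P^i\to P^{i+k}$ ($i\in\mathbb Z$) that are homogeneous for the quantum degree, with differential $D(f)=d\circ f-(-1)^{|f|}f\circ d$, where $|f|$ is the homological degree. It is a differential graded algebra under composition. **Statement.** For every $n\ge 0$ and every universal projector $P=P_n$ over $\mathrm{BN}_n$, the sheet algebra $\mathrm{End}^\bullet(P_n)$ is homotopy (graded) commutative: the chain maps $$f\otimes g\mapsto f\circ g\qquad\text{and}\qquad f\otimes g\mapsto(-1)^{|f||g|}\,g\circ f$$ from $\mathrm{End}^\bullet(P_n)\otimes_{\mathbb Z}\mathrm{End}^\bullet(P_n)$ to $\mathrm{End}^\bullet(P_n)$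 are chain homotopic, by a homotopy that preserves the quantum degree. -/

import Mathlib

open CategoryTheory

noncomputable section

namespace BarNatan

open scoped Classical in
/-- Sum of the weight `w` along the fibres of `q`. -/
def push {A K M : Type} [AddCommMonoid M] (q : A → K) (w : A → M) (k : K) : M :=
  ∑ᶠ a, if q a = k then w a else 0

section push

variable {A K L M : Type}

lemma push_add [AddCommMonoid M] [Finite A] (q : A → K) (u v : A → M) :
    push q (u + v) = push q u + push q v := by
  classical
  have := Fintype.ofFinite A
  ext k
  simp only [push, finsum_eq_sum_of_fintype, Pi.add_apply, ← Finset.sum_add_distrib]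
  exact Finset.sum_congr rfl fun a _ => by split_ifs <;> simp

lemma push_sub [AddCommGroup M] [Finite A] (q : A → K) (u v : A → M) :
    push q (u - v) = push q u - push q v := by
  classical
  have := Fintype.ofFinite A
  ext k
  simp only [push, finsum_eq_sum_of_fintype, Pi.sub_apply, ← Finset.sum_sub_distrib]
  exact Finset.sum_congr rfl fun a _ => by split_ifs <;> simp

lemma push_push [AddCommMonoid M] [Finite A] [Finite K] (q : A → K) (r : K → L) (w : A → M) :
    push r (push q w) = push (fun a => r (q a)) w := by
  classical
  have := Fintype.ofFinite A
  have := Fintype.ofFinite K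
  ext l
  simp only [push, finsum_eq_sum_of_fintype, Finset.sum_ite, Finset.sum_const_zero, add_zero]
  simp only [Finset.sum_filter]
  rw [← Finset.sum_filter, Finset.sum_comm]
  refine Finset.sum_congr rfl fun a _ => ?_
  rw [Finset.sum_ite_eq]
  simp

lemma push_equiv [AddCommMonoid M] (e : A ≃ K) (w : A → M) (a : A) : push e w (e a) = w a := by
  classical
  unfold push
  rw [finsum_eq_single _ a]
  · simp
  · intro b hb
    simp [hb]

lemma push_id [AddCommMonoid M] (w : A → M) : push (fun a => a) w = w :=
  funext fun a => push_equiv (Equiv.refl A) w a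

lemma push_zero [AddCommMonoid M] (q : A → K) : push q (0 : A → M) = 0 := by
  ext k; simp [push]

lemma finsum_push [AddCommMonoid M] [Finite A] [Finite K] (q : A → K) (w : A → M) :
    ∑ᶠ k, push q w k = ∑ᶠ a, w a := by
  have h := congrFun (push_push q (fun _ : K => ()) w) ()
  simpa [push] using h

end push

/-- The union of `A` and `B` in which `f i` and `g i` are identified for all `i`. -/
def Glue {I A B : Type} (f : I → A) (g : I → B) : Type :=
  Quot fun x y : A ⊕ B => ∃ i, x = Sum.inl (f i) ∧ y = Sum.inr (g i)

namespace Glue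

variable {I A B C : Type} {f : I → A} {g : I → B}

instance [Finite A] [Finite B] : Finite (Glue f g) := inferInstanceAs (Finite (Quot _))

def inl (x : A) : Glue f g := Quot.mk _ (Sum.inl x)

def inr (y : B) : Glue f g := Quot.mk _ (Sum.inr y)

lemma sound (i : I) : (inl (f i) : Glue f g) = inr (g i) := Quot.sound ⟨i, rfl, rfl⟩

def desc (u : A → C) (v : B → C) (h : ∀ i, u (f i) = v (g i)) : Glue f g → C :=
  Quot.lift (Sum.elim u v) (by rintro _ _ ⟨i, rfl, rfl⟩; exact h i)

@[simp] lemma desc_inl (u : A → C) (v : B → C) (h : ∀ i, u (f i) = v (g i)) (x : A) :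
    desc u v h (inl x) = u x := rfl

@[simp] lemma desc_inr (u : A → C) (v : B → C) (h : ∀ i, u (f i) = v (g i)) (y : B) :
    desc u v h (inr y) = v y := rfl

lemma ind {p : Glue f g → Prop} (hl : ∀ x, p (inl x)) (hr : ∀ y, p (inr y)) (z : Glue f g) :
    p z := by
  obtain ⟨x | y⟩ := z
  exacts [hl x, hr y]

end Glue

/-- A compact 1-manifold with `m` numbered endpoints at the top and `n` at the bottom, up to
homeomorphism: its finite set of components, the component on which each endpoint lies, and the
Euler characteristic of each component (`1` for an arc, `0` for a circle). -/
structure OneManifold (m n : ℕ) where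
  Comp : Type
  finite : Finite Comp
  top : Fin m → Comp
  bot : Fin n → Comp
  χ : Comp → ℤ

attribute [instance] OneManifold.finite

namespace OneManifold

/-- A homeomorphism that fixes the endpoints, up to isotopy of the components. -/
structure Homeo {m n : ℕ} (X Y : OneManifold m n) where
  e : X.Comp ≃ Y.Comp
  top : ∀ j, e (X.top j) = Y.top j
  bot : ∀ j, e (X.bot j) = Y.bot j
  χ : ∀ c, Y.χ (e c) = X.χ c

def Homeo.refl {m n : ℕ} (X : OneManifold m n) : X.Homeo X :=
  ⟨Equiv.refl _, fun _ => rfl, fun _ => rfl, fun _ => rfl⟩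

/-- `n` vertical strands. -/
abbrev strands (n : ℕ) : OneManifold n n where
  Comp := Fin n
  finite := inferInstance
  top j := j
  bot j := j
  χ _ := 1

/-- Components `0, …, n - 2` from left to right: component `i` joins the points `i` and `i + 1` at
the bottom, the others are strands from bottom to top. -/
abbrev cap (n i : ℕ) (h : i + 2 ≤ n) : OneManifold (n - 2) n where
  Comp := Fin (n - 1)
  finite := inferInstance
  top j := ⟨if (j : ℕ) < i then j else j + 1, by split_ifs <;> omega⟩
  bot j := ⟨if (j : ℕ) ≤ i then j else j - 1, by split_ifs <;> omega⟩
  χ _ := 1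

/-- The reflection of `cap`. -/
abbrev cup (n i : ℕ) (h : i + 2 ≤ n) : OneManifold n (n - 2) where
  Comp := (cap n i h).Comp
  finite := (cap n i h).finite
  top := (cap n i h).bot
  bot := (cap n i h).top
  χ := (cap n i h).χ

/-- `X` on top of `Y`. Gluing at a point lowers the Euler characteristic by one. -/
abbrev stack {m k n : ℕ} (X : OneManifold m k) (Y : OneManifold k n) : OneManifold m n where
  Comp := Glue X.bot Y.top
  finite := inferInstance
  top j := Glue.inl (X.top j)
  bot j := Glue.inr (Y.bot j)
  χ := push Glue.inl X.χ + push Glue.inr Y.χ - push (fun j => Glue.inl (X.bot j)) 1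

end OneManifold

/-- A compact orientable dotted surface cobounding `X`, `Y` and the vertical segments
`{endpoint} × [0,1]`, up to homeomorphism rel boundary: its finite set of components, the components
on which those of `X` and `Y` lie, and the Euler characteristic and the number of dots of each
component. -/
structure Surface {m n : ℕ} (X Y : OneManifold m n) where
  Comp : Type
  finite : Finite Comp
  src : X.Comp → Comp
  tgt : Y.Comp → Comp
  top : ∀ j, src (X.top j) = tgt (Y.top j)
  bot : ∀ j, src (X.bot j) = tgt (Y.bot j)
  χ : Comp → ℤ
  dots : Comp → ℕ

attribute [instance] Surface.finite

namespace Surface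

variable {m k n : ℕ}

/-- `S` and `T` are homeomorphic relative to their boundary. -/
def Homeo {X Y : OneManifold m n} (S T : Surface X Y) : Prop :=
  ∃ e : S.Comp ≃ T.Comp, (∀ x, e (S.src x) = T.src x) ∧ (∀ y, e (S.tgt y) = T.tgt y) ∧
    (∀ c, T.χ (e c) = S.χ c) ∧ (∀ c, T.dots (e c) = S.dots c)

/-- `X × [0,1]`, where the end is identified with `Y` by a homeomorphism. -/
abbrev cylinder {X Y : OneManifold m n} (e : X.Homeo Y) : Surface X Y where
  Comp := Y.Comp
  finite := inferInstance
  src := e.e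
  tgt y := y
  top := e.top
  bot := e.bot
  χ := Y.χ
  dots := 0

/-- The components of the closed 1-manifold `X ∪ {endpoints} × [0,1] ∪ Y`. -/
abbrev Boundary (X Y : OneManifold m n) : Type :=
  Glue (Sum.elim X.top X.bot) (Sum.elim Y.top Y.bot)

/-- Disjoint disks, one for each circle in the boundary, with dots. -/
abbrev disks {X Y : OneManifold m n} (d : Boundary X Y → ℕ) : Surface X Y where
  Comp := Boundary X Y
  finite := inferInstance
  src := Glue.inl
  tgt := Glue.inr
  top j := Glue.sound (Sum.inl j)
  bot j := Glue.sound (Sum.inr j)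
  χ := 1
  dots := d

/-- `T` glued to `S` along `Y`. -/
abbrev comp {X Y Z : OneManifold m n} (S : Surface X Y) (T : Surface Y Z) : Surface X Z where
  Comp := Glue S.tgt T.src
  finite := inferInstance
  src x := Glue.inl (S.src x)
  tgt z := Glue.inr (T.tgt z)
  top j := by rw [S.top, Glue.sound, T.top]
  bot j := by rw [S.bot, Glue.sound, T.bot]
  χ := push Glue.inl S.χ + push Glue.inr T.χ - push (fun y => Glue.inl (S.tgt y)) Y.χ
  dots := push Glue.inl S.dots + push Glue.inr T.dots

/-- `S` glued on top of `T` along the `k` vertical segments between them. -/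
abbrev stack {X X' : OneManifold m k} {Y Y' : OneManifold k n} (S : Surface X X') (T : Surface Y Y') :
    Surface (X.stack Y) (X'.stack Y') where
  Comp := Glue (fun j => S.src (X.bot j)) (fun j => T.src (Y.top j))
  finite := inferInstance
  src := Glue.desc (fun x => Glue.inl (S.src x)) (fun y => Glue.inr (T.src y)) Glue.sound
  tgt := Glue.desc (fun x => Glue.inl (S.tgt x)) (fun y => Glue.inr (T.tgt y)) fun j => by
    rw [← S.bot, ← T.top]; exact Glue.sound j
  top j := congrArg Glue.inl (S.top j)
  bot j := congrArg Glue.inr (T.bot j)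
  χ := push Glue.inl S.χ + push Glue.inr T.χ - push (fun j => Glue.inl (S.src (X.bot j))) 1
  dots := push Glue.inl S.dots + push Glue.inr T.dots

open scoped Classical in
/-- One more dot on the component `c`. -/
abbrev addDot {X Y : OneManifold m n} (S : Surface X Y) (c : S.Comp) : Surface X Y :=
  { S with dots := S.dots + Pi.single c 1 }

/-- The disjoint union with a sphere that carries `i` dots. -/
abbrev addSphere {X Y : OneManifold m n} (S : Surface X Y) (i : ℕ) : Surface X Y where
  Comp := Option S.Comp
  finite := inferInstance
  src x := some (S.src x)
  tgt y := some (S.tgt y)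
  top j := congrArg some (S.top j)
  bot j := congrArg some (S.bot j)
  χ c := c.elim 2 S.χ
  dots c := c.elim i S.dots

/-- The components `c` and `c'` are joined by a tube: two disks are removed and an annulus is glued
in. For `c = c'` this adds a handle to `c`. -/
abbrev addTube {X Y : OneManifold m n} (S : Surface X Y) (c c' : S.Comp) : Surface X Y where
  Comp := Quot fun x y => x = c ∧ y = c'
  finite := inferInstance
  src x := Quot.mk _ (S.src x)
  tgt y := Quot.mk _ (S.tgt y)
  top j := congrArg _ (S.top j)
  bot j := congrArg _ (S.bot j)
  χ := push (Quot.mk _) S.χ - push (fun _ : Unit => Quot.mk _ c) 2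
  dots := push (Quot.mk _) S.dots

lemma homeo_of_push {X Y : OneManifold m n} {S T : Surface X Y} (e : S.Comp ≃ T.Comp)
    (hs : ∀ x, e (S.src x) = T.src x) (ht : ∀ y, e (S.tgt y) = T.tgt y)
    (hχ : push e S.χ = T.χ) (hd : push e S.dots = T.dots) : S.Homeo T :=
  ⟨e, hs, ht, fun c => by rw [← hχ, push_equiv], fun c => by rw [← hd, push_equiv]⟩

/-- Mutually inverse maps between the components. -/
lemma homeo_of_maps {X Y : OneManifold m n} {S T : Surface X Y}
    (f : S.Comp → T.Comp) (g : T.Comp → S.Comp) (hgf : ∀ c, g (f c) = c) (hfg : ∀ c, f (g c) = c)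
    (hs : ∀ x, f (S.src x) = T.src x) (ht : ∀ y, f (S.tgt y) = T.tgt y)
    (hχ : push f S.χ = T.χ) (hd : push f S.dots = T.dots) : S.Homeo T :=
  homeo_of_push ⟨f, g, hgf, hfg⟩ hs ht hχ hd

lemma comp_assoc {X Y Z W : OneManifold m n} (S : Surface X Y) (T : Surface Y Z)
    (U : Surface Z W) : ((S.comp T).comp U).Homeo (S.comp (T.comp U)) := by
  refine homeo_of_maps
    (Glue.desc (Glue.desc Glue.inl (fun t => Glue.inr (Glue.inl t)) Glue.sound)
      (fun u => Glue.inr (Glue.inr u)) fun z => congrArg Glue.inr (Glue.sound z))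
    (Glue.desc (fun s => Glue.inl (Glue.inl s))
      (Glue.desc (fun t => Glue.inl (Glue.inr t)) Glue.inr Glue.sound)
        fun y => congrArg Glue.inl (Glue.sound y)) ?_ ?_ (fun _ => rfl) (fun _ => rfl) ?_ ?_
  · exact Glue.ind (Glue.ind (fun _ => rfl) fun _ => rfl) fun _ => rfl
  · exact Glue.ind (fun _ => rfl) (Glue.ind (fun _ => rfl) fun _ => rfl)
  · simp only [comp, push_add, push_sub, push_push]
    change push Glue.inl S.χ + push (fun t => Glue.inr (Glue.inl t)) T.χ -
        push (fun y => Glue.inl (S.tgt y)) Y.χ + push (fun u => Glue.inr (Glue.inr u)) U.χ -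
        push (fun z => Glue.inr (Glue.inl (T.tgt z))) Z.χ = _
    abel
  · simp only [comp, push_add, push_push]
    exact add_assoc _ _ _

lemma id_comp {X Y : OneManifold m n} (S : Surface X Y) :
    ((cylinder (OneManifold.Homeo.refl X)).comp S).Homeo S := by
  refine homeo_of_maps (Glue.desc S.src id fun _ => rfl) Glue.inr ?_ (fun _ => rfl)
    (fun _ => rfl) (fun _ => rfl) ?_ ?_
  · exact Glue.ind (fun x => (Glue.sound x).symm) (fun _ => rfl)
  · simp only [comp, push_add, push_sub, push_push]
    change push S.src X.χ + push (fun c => c) S.χ - push S.src X.χ = S.χ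
    rw [push_id, add_sub_cancel_left]
  · simp only [comp, push_add, push_push]
    change push S.src 0 + push (fun c => c) S.dots = S.dots
    rw [push_id, push_zero, zero_add]

lemma comp_id {X Y : OneManifold m n} (S : Surface X Y) :
    (S.comp (cylinder (OneManifold.Homeo.refl Y))).Homeo S := by
  refine homeo_of_maps (Glue.desc id S.tgt fun _ => rfl) Glue.inl ?_ (fun _ => rfl)
    (fun _ => rfl) (fun _ => rfl) ?_ ?_
  · exact Glue.ind (fun _ => rfl) (fun x => Glue.sound x)
  · simp only [comp, push_add, push_sub, push_push]
    change push (fun c => c) S.χ + push S.tgt Y.χ - push S.tgt Y.χ = S.χ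
    rw [push_id, add_sub_cancel_right]
  · simp only [comp, push_add, push_push]
    change push (fun c => c) S.dots + push S.tgt 0 = S.dots
    rw [push_id, push_zero, add_zero]

lemma stack_cylinder (X : OneManifold m k) (Y : OneManifold k n) :
    ((cylinder (OneManifold.Homeo.refl X)).stack (cylinder (OneManifold.Homeo.refl Y))).Homeo
      (cylinder (OneManifold.Homeo.refl (X.stack Y))) := by
  refine ⟨Equiv.refl _, ?_, ?_, fun _ => rfl, ?_⟩
  · exact Glue.ind (fun _ => rfl) (fun _ => rfl)
  · exact Glue.ind (fun _ => rfl) (fun _ => rfl)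
  · intro c
    change 0 = (push _ 0 + push _ 0 : _ → ℕ) c
    simp only [push_zero, add_zero, Pi.zero_apply]

lemma stack_comp_stack {X X' X'' : OneManifold m k} {Y Y' Y'' : OneManifold k n}
    (S : Surface X X') (S' : Surface X' X'') (T : Surface Y Y') (T' : Surface Y' Y'') :
    ((S.comp S').stack (T.comp T')).Homeo ((S.stack T).comp (S'.stack T')) := by
  have hS : ∀ x, (Glue.inl (Glue.inl (S.tgt x)) : ((S.stack T).comp (S'.stack T')).Comp) =
      Glue.inr (Glue.inl (S'.src x)) := fun x =>
    Glue.sound (f := (S.stack T).tgt) (g := (S'.stack T').src) (Glue.inl x)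
  have hT : ∀ x, (Glue.inl (Glue.inr (T.tgt x)) : ((S.stack T).comp (S'.stack T')).Comp) =
      Glue.inr (Glue.inr (T'.src x)) := fun x =>
    Glue.sound (f := (S.stack T).tgt) (g := (S'.stack T').src) (Glue.inr x)
  have hl : ∀ j, (Glue.inl (S.src (X.bot j)) : (S.stack T).Comp) = Glue.inr (T.src (Y.top j)) :=
    Glue.sound
  have hk : ∀ j, (Glue.inl (Glue.inl (S.src (X.bot j))) : ((S.comp S').stack (T.comp T')).Comp) =
      Glue.inr (Glue.inl (T.src (Y.top j))) := Glue.sound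
  have hS' : ∀ x, (Glue.inl (S.tgt x) : (S.comp S').Comp) = Glue.inr (S'.src x) := Glue.sound
  have hT' : ∀ x, (Glue.inl (T.tgt x) : (T.comp T').Comp) = Glue.inr (T'.src x) := Glue.sound
  refine homeo_of_maps
    (Glue.desc (Glue.desc (fun s => Glue.inl (Glue.inl s)) (fun s => Glue.inr (Glue.inl s)) hS)
      (Glue.desc (fun t => Glue.inl (Glue.inr t)) (fun t => Glue.inr (Glue.inr t)) hT)
      fun j => congrArg Glue.inl (hl j))
    (Glue.desc
      (Glue.desc (fun s => Glue.inl (Glue.inl s)) (fun t => Glue.inr (Glue.inl t)) hk)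
      (Glue.desc (fun s => Glue.inl (Glue.inr s)) (fun t => Glue.inr (Glue.inr t)) fun j => ?_)
      (Glue.ind (fun x => congrArg Glue.inl (hS' x)) fun y => congrArg Glue.inr (hT' y)))
    ?_ ?_ ?_ ?_ ?_ ?_
  · rw [← hS', ← hT', ← S.bot, ← T.top]; exact hk j
  · exact Glue.ind (Glue.ind (fun _ => rfl) fun _ => rfl) (Glue.ind (fun _ => rfl) fun _ => rfl)
  · exact Glue.ind (Glue.ind (fun _ => rfl) fun _ => rfl) (Glue.ind (fun _ => rfl) fun _ => rfl)
  · exact Glue.ind (fun _ => rfl) (fun _ => rfl)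
  · exact Glue.ind (fun _ => rfl) (fun _ => rfl)
  · have h1 : ∀ j : Fin k, (Glue.inr (Glue.inl (S'.src (X'.bot j))) :
        ((S.stack T).comp (S'.stack T')).Comp) = Glue.inl (Glue.inl (S.src (X.bot j))) := fun j => by
      rw [← hS, ← S.bot]
    have h2 : ∀ j : Fin k, (Glue.inl (Glue.inl (S.tgt (X'.bot j))) :
        ((S.stack T).comp (S'.stack T')).Comp) = Glue.inl (Glue.inl (S.src (X.bot j))) := fun j => by
      rw [← S.bot]
    simp only [comp, stack, OneManifold.stack, push_add, push_sub, push_push, Glue.desc_inl,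
      Glue.desc_inr, h1, h2]
    change push (fun a => Glue.inl (Glue.inl a)) S.χ + push (fun a => Glue.inr (Glue.inl a)) S'.χ -
      push (fun a => Glue.inl (Glue.inl (S.tgt a))) X'.χ +
      (push (fun a => Glue.inl (Glue.inr a)) T.χ + push (fun a => Glue.inr (Glue.inr a)) T'.χ -
      push (fun a => Glue.inl (Glue.inr (T.tgt a))) Y'.χ) -
      push (fun j => Glue.inl (Glue.inl (S.src (X.bot j)))) 1 = _
    abel
  · simp only [comp, stack, push_add, push_push]
    exact add_add_add_comm _ _ _ _

end Surface

/-- Planar diagrams without crossings, with `m` points at the top and `n` at the bottom, cut by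
horizontal lines into vertical strands and pieces with one local extremum. -/
inductive Diagram : ℕ → ℕ → Type
  /-- `n` vertical strands. -/
  | one (n : ℕ) : Diagram n n
  /-- An arc that joins the points `i` and `i + 1` at the bottom, and `n - 2` strands. -/
  | cap (n i : ℕ) (h : i + 2 ≤ n) : Diagram (n - 2) n
  /-- An arc that joins the points `i` and `i + 1` at the top, and `n - 2` strands. -/
  | cup (n i : ℕ) (h : i + 2 ≤ n) : Diagram n (n - 2)
  /-- The first diagram on top of the second. -/
  | stack {m k n : ℕ} (a : Diagram m k) (b : Diagram k n) : Diagram m n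

namespace Diagram

/-- The 1-manifold that a diagram draws. -/
@[reducible] def space {m n : ℕ} : Diagram m n → OneManifold m n
  | one n => OneManifold.strands n
  | cap n i h => OneManifold.cap n i h
  | cup n i h => OneManifold.cup n i h
  | stack a b => a.space.stack b.space

lemma two_mul_sum_χ {m n : ℕ} (a : Diagram m n) : 2 * ∑ᶠ c, a.space.χ c = (m + n : ℤ) := by
  induction a with
  | one n => simp [finsum_eq_sum_of_fintype]; ring
  | cap n i h =>
    simp [finsum_eq_sum_of_fintype]
    omega
  | cup n i h =>
    simp [finsum_eq_sum_of_fintype]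
    omega
  | @stack m k n a b iha ihb =>
    have : ∑ᶠ c, (a.stack b).space.χ c =
        ∑ᶠ c, a.space.χ c + ∑ᶠ c, b.space.χ c - k := by
      simp only [Pi.add_apply, Pi.sub_apply]
      rw [finsum_sub_distrib (Set.toFinite _) (Set.toFinite _),
        finsum_add_distrib (Set.toFinite _) (Set.toFinite _), finsum_push, finsum_push, finsum_push]
      simp [finsum_eq_sum_of_fintype]
    rw [this]
    linarith

lemma sum_χ {m n : ℕ} (a : Diagram m n) : ∑ᶠ c, a.space.χ c = (m + n : ℤ) / 2 := by
  have := a.two_mul_sum_χ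
  omega

end Diagram

/-- Dotted cobordisms between diagrams in `D² × [0,1]`, built from elementary pieces. Every
elementary cobordism (planar isotopy, birth, death, saddle, dot) is a local instance of `disks`. -/
inductive Cobordism : {m n : ℕ} → Diagram m n → Diagram m n → Type
  /-- The cylinder over a homeomorphism. -/
  | cylinder {m n : ℕ} {a b : Diagram m n} (e : a.space.Homeo b.space) : Cobordism a b
  /-- Disjoint disks, one for each circle in the boundary, with dots. -/
  | disks {m n : ℕ} (a b : Diagram m n) (d : Surface.Boundary a.space b.space → ℕ) : Cobordism a b
  /-- The second cobordism after the first. -/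
  | comp {m n : ℕ} {a b c : Diagram m n} (V : Cobordism a b) (W : Cobordism b c) : Cobordism a c
  /-- The first cobordism above the second in the plane. -/
  | stack {m k n : ℕ} {a a' : Diagram m k} {b b' : Diagram k n} (V : Cobordism a a')
      (W : Cobordism b b') : Cobordism (a.stack b) (a'.stack b')

namespace Cobordism

/-- The identity cobordism `a × [0,1]`. -/
def refl {m n : ℕ} (a : Diagram m n) : Cobordism a a := cylinder (OneManifold.Homeo.refl a.space)

/-- The underlying dotted surface. -/
@[reducible] def surface {m n : ℕ} {a b : Diagram m n} : Cobordism a b → Surface a.space b.space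
  | cylinder e => Surface.cylinder e
  | disks _ _ d => Surface.disks d
  | comp V W => V.surface.comp W.surface
  | stack V W => V.surface.stack W.surface

/-- The quantum degree: minus the Euler characteristic, plus half the number of endpoints, plus
two for each dot. -/
def deg {m n : ℕ} {a b : Diagram m n} (W : Cobordism a b) : ℤ :=
  -∑ᶠ c, W.surface.χ c + (m + n : ℤ) / 2 + 2 * ∑ᶠ c, (W.surface.dots c : ℤ)

lemma deg_comp {m n : ℕ} {a b c : Diagram m n} (V : Cobordism a b) (W : Cobordism b c) :
    (V.comp W).deg = V.deg + W.deg := by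
  have h1 : ∑ᶠ x, (V.comp W).surface.χ x =
      ∑ᶠ x, V.surface.χ x + ∑ᶠ x, W.surface.χ x - (m + n : ℤ) / 2 := by
    simp only [Pi.add_apply, Pi.sub_apply]
    rw [finsum_sub_distrib (Set.toFinite _) (Set.toFinite _),
      finsum_add_distrib (Set.toFinite _) (Set.toFinite _), finsum_push, finsum_push, finsum_push,
      Diagram.sum_χ]
  have h2 : ∑ᶠ x, (V.comp W).surface.dots x =
      ∑ᶠ x, V.surface.dots x + ∑ᶠ x, W.surface.dots x := by
    simp only [Pi.add_apply]
    rw [finsum_add_distrib (Set.toFinite _) (Set.toFinite _), finsum_push, finsum_push]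
  have h3 : ∀ {a b : Diagram m n} (W : Cobordism a b),
      ∑ᶠ x, (W.surface.dots x : ℤ) = ((∑ᶠ x, W.surface.dots x : ℕ) : ℤ) := fun W =>
    ((Nat.castAddMonoidHom ℤ).map_finsum (Set.toFinite _)).symm
  unfold deg
  rw [h3, h3, h3, h1, h2]
  push_cast
  ring

end Cobordism

/-- The coefficient ring `ℤ[α]`. -/
abbrev Coeff : Type := Polynomial ℤ

/-- Formal linear combinations of cobordisms. -/
abbrev Lin {m n : ℕ} (a b : Diagram m n) : Type := Cobordism a b →₀ Coeff

namespace Lin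

/-- The bilinear extension of composition. -/
def comp {m n : ℕ} {a b c : Diagram m n} : Lin a b →ₗ[Coeff] Lin b c →ₗ[Coeff] Lin a c :=
  Finsupp.linearCombination Coeff fun V => Finsupp.lmapDomain Coeff Coeff fun W => V.comp W

/-- The bilinear extension of stacking. -/
def stack {m k n : ℕ} {a a' : Diagram m k} {b b' : Diagram k n} :
    Lin a a' →ₗ[Coeff] Lin b b' →ₗ[Coeff] Lin (a.stack b) (a'.stack b') :=
  Finsupp.linearCombination Coeff fun V => Finsupp.lmapDomain Coeff Coeff fun W => V.stack W

@[simp] lemma comp_single {m n : ℕ} {a b c : Diagram m n} (V : Cobordism a b) (W : Cobordism b c)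
    (r s : Coeff) : comp (Finsupp.single V r) (Finsupp.single W s) =
      Finsupp.single (V.comp W) (r * s) := by
  simp [comp, Finsupp.mapDomain_single]

@[simp] lemma stack_single {m k n : ℕ} {a a' : Diagram m k} {b b' : Diagram k n}
    (V : Cobordism a a') (W : Cobordism b b') (r s : Coeff) :
    stack (Finsupp.single V r) (Finsupp.single W s) = Finsupp.single (V.stack W) (r * s) := by
  simp [stack, Finsupp.mapDomain_single]

end Lin

/-- The value of a sphere with `0`, `1`, `2`, `3` dots. -/
def sphereValue : Fin 4 → Coeff := ![0, 1, 0, Polynomial.X]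

/-- The smallest family of submodules that contains the local relations and is closed under
composition and stacking with arbitrary morphisms. -/
inductive Null : {m n : ℕ} → {a b : Diagram m n} → Lin a b → Prop
  /-- Homeomorphic cobordisms are equal. -/
  | homeo {m n : ℕ} {a b : Diagram m n} (V W : Cobordism a b) (h : V.surface.Homeo W.surface) :
      Null (Finsupp.single V 1 - Finsupp.single W 1)
  /-- Evaluation of dotted spheres. -/
  | sphere {m n : ℕ} {a b : Diagram m n} (V W : Cobordism a b) (i : Fin 4)
      (h : V.surface.Homeo (W.surface.addSphere i)) :
      Null (Finsupp.single V 1 - Finsupp.single W (sphereValue i))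
  /-- A tube is a dot on its one side plus a dot on its other side. -/
  | neck {m n : ℕ} {a b : Diagram m n} (V W W' : Cobordism a b) (S : Surface a.space b.space)
      (c c' : S.Comp) (h : V.surface.Homeo (S.addTube c c')) (hW : W.surface.Homeo (S.addDot c))
      (hW' : W'.surface.Homeo (S.addDot c')) :
      Null (Finsupp.single V 1 - Finsupp.single W 1 - Finsupp.single W' 1)
  /-- A handle is twice a dot. -/
  | handle {m n : ℕ} {a b : Diagram m n} (V W : Cobordism a b) (S : Surface a.space b.space)
      (c : S.Comp) (h : V.surface.Homeo (S.addTube c c)) (hW : W.surface.Homeo (S.addDot c)) :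
      Null (Finsupp.single V 1 - Finsupp.single W 2)
  | zero {m n : ℕ} {a b : Diagram m n} : Null (0 : Lin a b)
  | add {m n : ℕ} {a b : Diagram m n} {x y : Lin a b} (hx : Null x) (hy : Null y) : Null (x + y)
  | smul {m n : ℕ} {a b : Diagram m n} (r : Coeff) {x : Lin a b} (hx : Null x) : Null (r • x)
  | comp_left {m n : ℕ} {a b c : Diagram m n} (x : Lin a b) {y : Lin b c} (hy : Null y) :
      Null (Lin.comp x y)
  | comp_right {m n : ℕ} {a b c : Diagram m n} {x : Lin a b} (hx : Null x) (y : Lin b c) :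
      Null (Lin.comp x y)
  | stack_left {m k n : ℕ} {a a' : Diagram m k} {b b' : Diagram k n} (x : Lin a a') {y : Lin b b'}
      (hy : Null y) : Null (Lin.stack x y)
  | stack_right {m k n : ℕ} {a a' : Diagram m k} {b b' : Diagram k n} {x : Lin a a'} (hx : Null x)
      (y : Lin b b') : Null (Lin.stack x y)

def nullSubmodule {m n : ℕ} (a b : Diagram m n) : Submodule Coeff (Lin a b) where
  carrier := {x | Null x}
  zero_mem' := Null.zero
  add_mem' := Null.add
  smul_mem' r _ := Null.smul r

/-- `ℤ[α]`-linear combinations of dotted cobordisms modulo the local relations. -/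
abbrev Mor {m n : ℕ} (a b : Diagram m n) : Type := Lin a b ⧸ nullSubmodule a b

section lift

variable {R M N P : Type} [CommRing R] [AddCommGroup M] [AddCommGroup N] [AddCommGroup P]
  [Module R M] [Module R N] [Module R P]

/-- The bilinear map on quotients that a bilinear map induces. -/
def lift₂ (p : Submodule R M) (q : Submodule R N) (r : Submodule R P) (B : M →ₗ[R] N →ₗ[R] P)
    (hp : ∀ x ∈ p, ∀ y, B x y ∈ r) (hq : ∀ x, ∀ y ∈ q, B x y ∈ r) :
    (M ⧸ p) →ₗ[R] (N ⧸ q) →ₗ[R] (P ⧸ r) :=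
  (q.liftQ (p.liftQ (B.compr₂ r.mkQ) (fun x hx => LinearMap.ext fun y => by
    simpa using hp x hx y)).flip (fun y hy => LinearMap.ext fun x => by
      obtain ⟨x, rfl⟩ := p.mkQ_surjective x
      exact (Submodule.Quotient.mk_eq_zero r).2 (hq x y hy))).flip

@[simp] lemma lift₂_mk (p : Submodule R M) (q : Submodule R N) (r : Submodule R P)
    (B : M →ₗ[R] N →ₗ[R] P) (hp : ∀ x ∈ p, ∀ y, B x y ∈ r) (hq : ∀ x, ∀ y ∈ q, B x y ∈ r)
    (x : M) (y : N) :
    lift₂ p q r B hp hq (Submodule.Quotient.mk x) (Submodule.Quotient.mk y) =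
      Submodule.Quotient.mk (B x y) := rfl

end lift

namespace Mor

/-- The class of a cobordism with a coefficient. -/
def of {m n : ℕ} {a b : Diagram m n} (V : Cobordism a b) (r : Coeff) : Mor a b :=
  Submodule.Quotient.mk (Finsupp.single V r)

def comp {m n : ℕ} {a b c : Diagram m n} : Mor a b →ₗ[Coeff] Mor b c →ₗ[Coeff] Mor a c :=
  lift₂ _ _ _ Lin.comp (fun _ hx y => Null.comp_right hx y) (fun x _ hy => Null.comp_left x hy)

def stack {m k n : ℕ} {a a' : Diagram m k} {b b' : Diagram k n} :
    Mor a a' →ₗ[Coeff] Mor b b' →ₗ[Coeff] Mor (a.stack b) (a'.stack b') :=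
  lift₂ _ _ _ Lin.stack (fun _ hx y => Null.stack_right hx y) (fun x _ hy => Null.stack_left x hy)

lemma comp_of {m n : ℕ} {a b c : Diagram m n} (V : Cobordism a b) (W : Cobordism b c)
    (r s : Coeff) : comp (of V r) (of W s) = of (V.comp W) (r * s) :=
  congrArg _ (Lin.comp_single V W r s)

lemma stack_of {m k n : ℕ} {a a' : Diagram m k} {b b' : Diagram k n}
    (V : Cobordism a a') (W : Cobordism b b') (r s : Coeff) :
    stack (of V r) (of W s) = of (V.stack W) (r * s) :=
  congrArg _ (Lin.stack_single V W r s)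

lemma of_eq {m n : ℕ} {a b : Diagram m n} {V W : Cobordism a b} (h : V.surface.Homeo W.surface)
    (r : Coeff) : of V r = of W r := by
  have := Null.smul r (Null.homeo V W h)
  rw [smul_sub, Finsupp.smul_single, Finsupp.smul_single, smul_eq_mul, mul_one] at this
  exact (Submodule.Quotient.eq _).2 this

lemma induction {m n : ℕ} {a b : Diagram m n} {p : Mor a b → Prop} (x : Mor a b) (zero : p 0)
    (add : ∀ x y, p x → p y → p (x + y)) (of : ∀ V r, p (of V r)) : p x := by
  obtain ⟨x, rfl⟩ := Submodule.Quotient.mk_surjective _ x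
  induction x using Finsupp.induction_linear with
  | zero => exact zero
  | add x y hx hy => exact add _ _ hx hy
  | single V r => exact of V r

/-- The identity morphism. -/
def id {m n : ℕ} (a : Diagram m n) : Mor a a := of (Cobordism.refl a) 1

lemma id_comp {m n : ℕ} {a b : Diagram m n} (x : Mor a b) : comp (id a) x = x := by
  induction x using induction with
  | zero => simp
  | add x y hx hy => rw [map_add, hx, hy]
  | of V r =>
    rw [id, comp_of, one_mul]
    exact of_eq (Surface.id_comp _) r

lemma comp_id {m n : ℕ} {a b : Diagram m n} (x : Mor a b) : comp x (id b) = x := by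
  induction x using induction with
  | zero => simp
  | add x y hx hy => rw [map_add, LinearMap.add_apply, hx, hy]
  | of V r =>
    rw [id, comp_of, mul_one]
    exact of_eq (Surface.comp_id _) r

lemma comp_assoc {m n : ℕ} {a b c d : Diagram m n} (x : Mor a b) (y : Mor b c) (z : Mor c d) :
    comp (comp x y) z = comp x (comp y z) := by
  induction x using induction with
  | zero => simp
  | add x x' hx hy => simp only [map_add, LinearMap.add_apply, hx, hy]
  | of U r =>
    induction y using induction with
    | zero => simp
    | add x x' hx hy => simp only [map_add, LinearMap.add_apply, hx, hy]
    | of V s =>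
      induction z using induction with
      | zero => simp
      | add x x' hx hy => simp only [map_add, hx, hy]
      | of W t =>
        rw [comp_of, comp_of, comp_of, comp_of, mul_assoc]
        exact of_eq (Surface.comp_assoc _ _ _) _

lemma stack_id {m k n : ℕ} (a : Diagram m k) (b : Diagram k n) :
    stack (id a) (id b) = id (a.stack b) := by
  rw [id, id, id, stack_of, one_mul]
  exact of_eq (Surface.stack_cylinder _ _) _

lemma stack_comp {m k n : ℕ} {a a' a'' : Diagram m k} {b b' b'' : Diagram k n} (x : Mor a a')
    (x' : Mor a' a'') (y : Mor b b') (y' : Mor b' b'') :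
    stack (comp x x') (comp y y') = comp (stack x y) (stack x' y') := by
  induction x using induction with
  | zero => simp
  | add x x' hx hy => simp only [map_add, LinearMap.add_apply, hx, hy]
  | of U r =>
    induction y using induction with
    | zero => simp
    | add x x' hx hy => simp only [map_add, LinearMap.add_apply, hx, hy]
    | of V s =>
      induction x' using induction with
      | zero => simp
      | add x x' hx hy => simp only [map_add, LinearMap.add_apply, hx, hy]
      | of U' r' =>
        induction y' using induction with
        | zero => simp
        | add x x' hx hy => simp only [map_add, hx, hy]
        | of V' s' =>
          simp only [comp_of, stack_of]
          rw [mul_mul_mul_comm]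
          exact of_eq (Surface.stack_comp_stack _ _ _ _) _

/-- The integral span of the `α ^ j • W` with `4 * j + deg W = d`. -/
def homogeneous {m n : ℕ} (a b : Diagram m n) (d : ℤ) : AddSubgroup (Mor a b) :=
  AddSubgroup.closure {x | ∃ (W : Cobordism a b) (j : ℕ), 4 * (j : ℤ) + W.deg = d ∧
    x = of W (Polynomial.X ^ j)}

lemma comp_mem_homogeneous {m n : ℕ} {a b c : Diagram m n} {x : Mor a b} {y : Mor b c} {d e : ℤ}
    (hx : x ∈ homogeneous a b d) (hy : y ∈ homogeneous b c e) :
    comp x y ∈ homogeneous a c (d + e) := by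
  induction hx using AddSubgroup.closure_induction with
  | zero => simp [zero_mem]
  | add x x' _ _ h h' => rw [map_add, LinearMap.add_apply]; exact add_mem h h'
  | neg x _ h => rw [map_neg, LinearMap.neg_apply]; exact neg_mem h
  | mem x hx =>
    obtain ⟨V, i, hV, rfl⟩ := hx
    induction hy using AddSubgroup.closure_induction with
    | zero => simp [zero_mem]
    | add x x' _ _ h h' => rw [map_add]; exact add_mem h h'
    | neg x _ h => rw [map_neg]; exact neg_mem h
    | mem y hy =>
      obtain ⟨W, j, hW, rfl⟩ := hy
      refine AddSubgroup.subset_closure ⟨V.comp W, i + j, ?_, ?_⟩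
      · rw [Cobordism.deg_comp]; push_cast; linarith
      · rw [comp_of, pow_add]

end Mor

/-- The category `Cob^m_n` of formally shifted diagrams `q^shift diagram`. -/
structure Cob (m n : ℕ) where
  diagram : Diagram m n
  shift : ℤ

namespace Cob

variable {m k n : ℕ}

instance : Category (Cob m n) where
  Hom X Y := Mor X.diagram Y.diagram
  id X := Mor.id X.diagram
  comp f g := Mor.comp f g
  id_comp := Mor.id_comp
  comp_id := Mor.comp_id
  assoc := Mor.comp_assoc

instance : Preadditive (Cob m n) where
  homGroup X Y := inferInstanceAs (AddCommGroup (Mor X.diagram Y.diagram))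
  add_comp _ _ _ f f' g := LinearMap.map_add₂ Mor.comp f f' g
  comp_add _ _ _ f g g' := (Mor.comp f).map_add g g'

/-- `f : q^k a ⟶ q^l b` has quantum degree `d`. -/
def IsHomogeneous (d : ℤ) {X Y : Cob m n} (f : X ⟶ Y) : Prop :=
  f ∈ Mor.homogeneous X.diagram Y.diagram (d - (Y.shift - X.shift))

/-- Stacking `a` on top. -/
@[simps] def stackAbove (a : Diagram m k) : Cob k n ⥤ Cob m n where
  obj X := ⟨a.stack X.diagram, X.shift⟩
  map f := Mor.stack (Mor.id a) f
  map_id X := Mor.stack_id a X.diagram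
  map_comp f g := by
    change Mor.stack (Mor.id a) (Mor.comp f g) = _
    conv_lhs => rw [← Mor.id_comp (Mor.id a)]
    exact Mor.stack_comp _ _ _ _

/-- Stacking `b` below. -/
@[simps] def stackBelow (b : Diagram k n) : Cob m k ⥤ Cob m n where
  obj X := ⟨X.diagram.stack b, X.shift⟩
  map f := Mor.stack f (Mor.id b)
  map_id X := Mor.stack_id X.diagram b
  map_comp f g := by
    change Mor.stack (Mor.comp f g) (Mor.id b) = _
    conv_lhs => rw [← Mor.id_comp (Mor.id b)]
    exact Mor.stack_comp _ _ _ _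

instance (a : Diagram m k) : (stackAbove (n := n) a).Additive where
  map_add {_ _ f g} := (Mor.stack (Mor.id a)).map_add f g

instance (b : Diagram k n) : (stackBelow (m := m) b).Additive where
  map_add {_ _ f g} := LinearMap.map_add₂ Mor.stack f g (Mor.id b)

end Cob

/-- The closure of `Cob^m_n` under finite direct sums. -/
abbrev BN (m n : ℕ) : Type 1 := Mat_ (Cob m n)

namespace BN

variable {m k n : ℕ}

instance {m' n' : ℕ} (F : Cob m n ⥤ Cob m' n') [F.Additive] : F.mapMat_.Additive where
  map_add {_ _ f g} := by
    ext i j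
    exact F.map_add (f := f i j) (g := g i j)

/-- All matrix entries have quantum degree `d`. -/
def IsHomogeneous (d : ℤ) {A B : BN m n} (f : A ⟶ B) : Prop :=
  ∀ i j, Cob.IsHomogeneous d (f i j)

lemma IsHomogeneous.comp {A B C : BN m n} {d e l : ℤ} {f : A ⟶ B} {g : B ⟶ C}
    (hf : IsHomogeneous d f) (hg : IsHomogeneous e g) (hl : d + e = l) :
    IsHomogeneous l (f ≫ g) := by
  subst hl
  intro i j
  rw [Mat_.comp_apply]
  refine AddSubgroup.sum_mem _ fun x _ => ?_
  have h := Mor.comp_mem_homogeneous (hf i x) (hg x j)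
  rwa [show d - ((B.X x).shift - (A.X i).shift) + (e - ((C.X j).shift - (B.X x).shift)) =
    d + e - ((C.X j).shift - (A.X i).shift) by ring] at h

lemma IsHomogeneous.add {A B : BN m n} {d : ℤ} {f g : A ⟶ B}
    (hf : IsHomogeneous d f) (hg : IsHomogeneous d g) : IsHomogeneous d (f + g) :=
  fun i j => AddSubgroup.add_mem _ (hf i j) (hg i j)

lemma IsHomogeneous.units_smul {A B : BN m n} {d : ℤ} {f : A ⟶ B} (u : ℤˣ)
    (hf : IsHomogeneous d f) : IsHomogeneous d (u • f) := by
  obtain rfl | rfl := Int.units_eq_one_or u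
  · rwa [one_smul]
  · rw [Units.neg_smul, one_smul]
    exact fun i j => AddSubgroup.neg_mem _ (hf i j)

end BN

open CochainComplex.HomComplex

/-- Chain complexes over the graded category `BN^m_n`: the differential has quantum degree `0`. -/
structure Ch (m n : ℕ) where
  cpx : CochainComplex (BN m n) ℤ
  homogeneous : ∀ i j, BN.IsHomogeneous 0 (cpx.d i j)

namespace Ch

variable {m k n : ℕ}

/-- Contractible: the identity is null-homotopic, by a homotopy of quantum degree `0`. -/
def IsContractible (K : CochainComplex (BN m n) ℤ) : Prop :=
  ∃ h : Homotopy (𝟙 K) 0, ∀ i j, BN.IsHomogeneous 0 (h.hom i j)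

/-- `a ⊗ K`, the diagram `a` stacked on top of `K`. -/
def stackAbove (a : Diagram m k) (K : CochainComplex (BN k n) ℤ) : CochainComplex (BN m n) ℤ :=
  ((Cob.stackAbove a).mapMat_.mapHomologicalComplex (ComplexShape.up ℤ)).obj K

/-- `K ⊗ b`, the diagram `b` stacked below `K`. -/
def stackBelow (K : CochainComplex (BN m k) ℤ) (b : Diagram k n) : CochainComplex (BN m n) ℤ :=
  ((Cob.stackBelow b).mapMat_.mapHomologicalComplex (ComplexShape.up ℤ)).obj K

/-- The family `z` has quantum degree `d`. -/
def IsHomogeneous {A B : Ch m n} {k : ℤ} (d : ℤ) (z : Cochain A.cpx B.cpx k) : Prop :=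
  ∀ p q (h : p + k = q), BN.IsHomogeneous d (z.v p q h)

lemma IsHomogeneous.comp {A B C : Ch m n} {k l j : ℤ} {d e : ℤ} {z : Cochain A.cpx B.cpx k}
    {w : Cochain B.cpx C.cpx l} (hz : IsHomogeneous d z) (hw : IsHomogeneous e w) (h : k + l = j) :
    IsHomogeneous (d + e) (z.comp w h) := fun p q hpq => by
  rw [Cochain.comp_v z w h p (p + k) q rfl (by omega)]
  exact (hz _ _ _).comp (hw _ _ _) rfl

lemma IsHomogeneous.δ {A B : Ch m n} {k l : ℤ} {d : ℤ} {z : Cochain A.cpx B.cpx k}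
    (hz : IsHomogeneous d z) (h : k + 1 = l) : IsHomogeneous d (δ k l z) := fun p q hpq => by
  rw [δ_v k l h z p q hpq _ _ rfl rfl]
  exact ((hz _ _ _).comp (B.homogeneous _ _) (add_zero d)).add
    (((A.homogeneous _ _).comp (hz _ _ _) (zero_add d)).units_smul _)

/-- `Hom^k(A, B)`: the group spanned by the families `A^i ⟶ B^(i + k)` that are homogeneous for the
quantum degree. -/
def hom (A B : Ch m n) (k : ℤ) : AddSubgroup (Cochain A.cpx B.cpx k) :=
  AddSubgroup.closure {z | ∃ d, IsHomogeneous d z}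

lemma comp_mem_hom {A B C : Ch m n} {k l j : ℤ} {z : Cochain A.cpx B.cpx k}
    {w : Cochain B.cpx C.cpx l} (hz : z ∈ hom A B k) (hw : w ∈ hom B C l) (h : k + l = j) :
    z.comp w h ∈ hom A C j := by
  induction hz using AddSubgroup.closure_induction with
  | zero => rw [Cochain.zero_comp]; exact zero_mem _
  | add x x' _ _ hx hx' => rw [Cochain.add_comp]; exact add_mem hx hx'
  | neg x _ hx => rw [Cochain.neg_comp]; exact neg_mem hx
  | mem x hx =>
    induction hw using AddSubgroup.closure_induction with
    | zero => rw [Cochain.comp_zero]; exact zero_mem _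
    | add y y' _ _ hy hy' => rw [Cochain.comp_add]; exact add_mem hy hy'
    | neg y _ hy => rw [Cochain.comp_neg]; exact neg_mem hy
    | mem y hy =>
      obtain ⟨d, hx⟩ := hx
      obtain ⟨e, hy⟩ := hy
      exact AddSubgroup.subset_closure ⟨d + e, hx.comp hy h⟩

lemma δ_mem_hom {A B : Ch m n} {k l : ℤ} {z : Cochain A.cpx B.cpx k} (hz : z ∈ hom A B k) :
    δ k l z ∈ hom A B l := by
  by_cases h : k + 1 = l
  · induction hz using AddSubgroup.closure_induction with
    | zero => rw [δ_zero]; exact zero_mem _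
    | add x x' _ _ hx hx' => rw [δ_add]; exact add_mem hx hx'
    | neg x _ hx => rw [δ_neg]; exact neg_mem hx
    | mem x hx =>
      obtain ⟨d, hx⟩ := hx
      exact AddSubgroup.subset_closure ⟨d, hx.δ h⟩
  · rw [δ_shape k l h]
    exact zero_mem _

/-- The complex `Hom^•(A, B)` with differential `f ↦ d_B ∘ f - (-1)^k f ∘ d_A` on `Hom^k`. -/
def homComplex (A B : Ch m n) : CochainComplex (ModuleCat.{0} ℤ) ℤ where
  X k := ModuleCat.of ℤ (hom A B k)
  d k l := ModuleCat.ofHom <| AddMonoidHom.toIntLinearMap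
    { toFun := fun z => ⟨δ k l z.1, δ_mem_hom z.2⟩
      map_zero' := Subtype.ext (δ_zero k l)
      map_add' := fun z w => Subtype.ext (δ_add k l z.1 w.1) }
  shape k l h := by
    refine ModuleCat.hom_ext (LinearMap.ext fun z => ?_)
    exact Subtype.ext (δ_shape k l h z.1)
  d_comp_d' i j k _ _ := by
    refine ModuleCat.hom_ext (LinearMap.ext fun z => ?_)
    exact Subtype.ext (δ_δ i j k z.1)

/-- The sheet algebra of `P`, as a complex. -/
abbrev endComplex (P : Ch m n) : CochainComplex (ModuleCat.{0} ℤ) ℤ := homComplex P P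

open HomologicalComplex

section tensor

variable {R : Type} [CommRing R]

/-- Bilinear maps. -/
abbrev Bilin (X Y Z : ModuleCat.{0} R) : Type := X →ₗ[R] Y →ₗ[R] Z

/-- The map on the tensor product that a bilinear map induces. -/
def tensorLift {X Y Z : ModuleCat.{0} R} (β : Bilin X Y Z) :
    MonoidalCategoryStruct.tensorObj X Y ⟶ Z :=
  ModuleCat.ofHom (TensorProduct.lift β)

/-- The chain map `K ⊗ L ⟶ M` given by bilinear maps that satisfy the Leibniz rule. -/
def tensorDesc {K L M : CochainComplex (ModuleCat.{0} R) ℤ}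
    (β : ∀ p q k : ℤ, p + q = k → Bilin (K.X p) (L.X q) (M.X k))
    (hβ : ∀ (p q k k' p' q' : ℤ) (h : p + q = k) (hp : p + 1 = p') (hq : q + 1 = q')
      (hk : k + 1 = k') (x : K.X p) (y : L.X q),
      M.d k k' (β p q k h x y) = β p' q k' (by omega) (K.d p p' x) y +
        p.negOnePow • β p q' k' (by omega) x (L.d q q' y)) :
    HomologicalComplex.tensorObj K L ⟶ M where
  f k := mapBifunctorDesc fun p q h => tensorLift (β p q k h)
  comm' k k' hk := by
    apply mapBifunctor.hom_ext
    intro p q h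
    have hk' : k + 1 = k' := hk
    have h' : p + q = k := h
    rw [ι_mapBifunctorDesc_assoc, mapBifunctor.d_eq, Preadditive.add_comp, Preadditive.comp_add,
      mapBifunctor.ι_D₁_assoc, mapBifunctor.ι_D₂_assoc,
      mapBifunctor.d₁_eq K L _ _ (i₁ := p) (i₁' := p + 1) rfl q k' (by change p + 1 + q = k'; omega),
      mapBifunctor.d₂_eq K L _ _ p (i₂ := q) (i₂' := q + 1) rfl k'
        (by change p + (q + 1) = k'; omega)]
    simp only [Linear.units_smul_comp, Category.assoc, ι_mapBifunctorDesc]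
    refine ModuleCat.hom_ext (TensorProduct.ext' fun x y => ?_)
    change M.d k k' (β p q k h x y) = ((1 : ℤˣ) : ℤ) • β (p + 1) q k' _ (K.d p (p + 1) x) y +
      (p.negOnePow : ℤ) • β p (q + 1) k' _ x (L.d q (q + 1) y)
    rw [Units.val_one, one_smul]
    exact hβ p q k k' _ _ h rfl rfl hk' x y

end tensor

/-- `f ⊗ g ↦ f ∘ g` on `End^p ⊗ End^q`. -/
def mulBilin (P : Ch m n) (p q k : ℤ) (h : p + q = k) :
    Bilin (P.endComplex.X p) (P.endComplex.X q) (P.endComplex.X k) :=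
  LinearMap.mk₂ ℤ (fun (f : hom P P p) (g : hom P P q) =>
      (⟨g.1.comp f.1 (by omega), comp_mem_hom g.2 f.2 _⟩ : hom P P k))
    (fun f f' g => Subtype.ext (Cochain.comp_add _ _ _ (by omega)))
    (fun c f g => Subtype.ext (Cochain.comp_smul _ _ _ (by omega)))
    (fun f g g' => Subtype.ext (Cochain.add_comp _ _ _ (by omega)))
    (fun c f g => Subtype.ext (Cochain.smul_comp _ _ _ (by omega)))

/-- The multiplication `f ⊗ g ↦ f ∘ g` of the sheet algebra. -/
def mul (P : Ch m n) : HomologicalComplex.tensorObj P.endComplex P.endComplex ⟶ P.endComplex :=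
  tensorDesc (mulBilin P) fun p q k k' p' q' h hp hq hk f g => Subtype.ext (by
    have h := δ_comp g.1 f.1 (show q + p = k by omega) q' p' k' hk hq hp
    exact h)

/-- `f ⊗ g ↦ (-1)^(p q) g ∘ f` on `End^p ⊗ End^q`. -/
def mulOpBilin (P : Ch m n) (p q k : ℤ) (h : p + q = k) :
    Bilin (P.endComplex.X p) (P.endComplex.X q) (P.endComplex.X k) :=
  LinearMap.mk₂ ℤ (fun (f : hom P P p) (g : hom P P q) =>
      (⟨((p * q).negOnePow : ℤ) • f.1.comp g.1 h,
        AddSubgroup.zsmul_mem _ (comp_mem_hom f.2 g.2 h) _⟩ : hom P P k))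
    (fun _ _ _ => Subtype.ext
      ((congrArg _ (Cochain.add_comp _ _ _ h)).trans (smul_add _ _ _)))
    (fun _ _ _ => Subtype.ext
      ((congrArg _ (Cochain.smul_comp _ _ _ h)).trans (smul_comm _ _ _)))
    (fun _ _ _ => Subtype.ext
      ((congrArg _ (Cochain.comp_add _ _ _ h)).trans (smul_add _ _ _)))
    (fun _ _ _ => Subtype.ext
      ((congrArg _ (Cochain.comp_smul _ _ _ h)).trans (smul_comm _ _ _)))

/-- The opposite multiplication `f ⊗ g ↦ (-1)^(|f||g|) g ∘ f` of the sheet algebra. -/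
def mulOp (P : Ch m n) : HomologicalComplex.tensorObj P.endComplex P.endComplex ⟶ P.endComplex :=
  tensorDesc (mulOpBilin P) fun p q k k' p' q' h hp hq hk (f : hom P P p) (g : hom P P q) =>
    Subtype.ext (by
      change δ k k' (((p * q).negOnePow : ℤ) • f.1.comp g.1 h) =
        ((p' * q).negOnePow : ℤ) • (δ p p' f.1).comp g.1 (by omega) +
          (p.negOnePow : ℤ) • ((p * q').negOnePow : ℤ) • f.1.comp (δ q q' g.1) (by omega)
      have h1 : (((p * q).negOnePow : ℤ) * q.negOnePow) = (p' * q).negOnePow := by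
        rw [← hp, add_mul, one_mul, Int.negOnePow_add, Units.val_mul]
      have h2 : ((p.negOnePow : ℤ) * (p * q').negOnePow) = (p * q).negOnePow := by
        rw [← hq, mul_add, mul_one, Int.negOnePow_add, mul_comm, Units.val_mul, mul_assoc,
          ← Units.val_mul, Int.units_mul_self, Units.val_one, mul_one]
      rw [δ_smul, δ_comp f.1 g.1 h p' q' k' hk hp hq, smul_add, Units.smul_def, smul_smul,
        smul_smul, h1, h2, add_comm])

/-- A universal projector on `n` strands. -/
structure IsUniversalProjector (P : Ch n n) : Prop where
  nonpos : ∀ i > 0, Limits.IsZero (P.cpx.X i)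
  /-- `P^0` is the identity diagram. -/
  zero : ∃ e : P.cpx.X 0 ≅ (Mat_.embedding _).obj ⟨Diagram.one n, 0⟩,
    BN.IsHomogeneous 0 e.hom ∧ BN.IsHomogeneous 0 e.inv
  /-- No shift of the identity diagram is a direct summand of another chain group. -/
  no_summand : ∀ i ≠ 0, ∀ s : ℤ,
    ¬ ∃ (f : (Mat_.embedding _).obj ⟨Diagram.one n, s⟩ ⟶ P.cpx.X i)
        (g : P.cpx.X i ⟶ (Mat_.embedding _).obj ⟨Diagram.one n, s⟩),
      BN.IsHomogeneous 0 f ∧ BN.IsHomogeneous 0 g ∧ f ≫ g = 𝟙 _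
  /-- `P` kills turnbacks. -/
  above : ∀ (i : ℕ) (h : i + 2 ≤ n), IsContractible (stackAbove (Diagram.cap n i h) P.cpx)
  below : ∀ (i : ℕ) (h : i + 2 ≤ n), IsContractible (stackBelow P.cpx (Diagram.cup n i h))

/-- `f ⊗ g` in degree `k = p + q` of the tensor square of the sheet algebra. -/
def tmul (P : Ch n n) {p q k : ℤ} (h : p + q = k) (f : hom P P p) (g : hom P P q) :
    (HomologicalComplex.tensorObj P.endComplex P.endComplex).X k :=
  (ιTensorObj P.endComplex P.endComplex p q k h).hom
    (TensorProduct.tmul ℤ (show P.endComplex.X p from f) (show P.endComplex.X q from g))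

/-- The maps `(End ⊗ End)^k ⟶ End^l` of `H` preserve the quantum degree. -/
def PreservesDegree {P : Ch n n}
    {φ ψ : HomologicalComplex.tensorObj P.endComplex P.endComplex ⟶ P.endComplex}
    (H : Homotopy φ ψ) : Prop :=
  ∀ (p q k l : ℤ) (h : p + q = k) (d e : ℤ) (f : hom P P p) (g : hom P P q),
    IsHomogeneous d f.1 → IsHomogeneous e g.1 →
      IsHomogeneous (d + e) (show hom P P l from (H.hom k l).hom (P.tmul h f g)).1

end Ch

end BarNatan

end

/-! ### Pushforwards along fibres, homeomorphisms of 1-manifolds -/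

noncomputable section

namespace BarNatan

/-! Up to homotopy, an endomorphism of `P` is controlled by its component on `P^0 ≅ 1_n`. This rests
on a decomposition of diagrams. Circles are delooped, zigzags are straightened and distant extrema
exchanged, so every diagram is a direct sum of shifted normal forms: cups, with caps below them
(`Cob.decomposable`). A normal form with as many endpoints at the top as at the bottom and without
caps has no cups either, so it is the identity diagram. Since no shift of `1_n` is a summand of
`P^i` for `i < 0`, the identity of `P^i` lies in the ideal generated by diagrams `X = b ⊗ cap`
(`BN.through_id`).

For such an `X` the complex `X ⊗ P ≅ b ⊗ (cap ⊗ P)` is contractible. So is `Hom(X, P)`: birth and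
saddle satisfy a zigzag relation, through which every map `X ⟶ P` factors through a cap stacked
below the contractible complex `P ⊗ cup`. Two recursions on the degree `i ≤ 0` follow. There is an
operator `H` with `δ H + H δ = 1` on all cochains that vanish on `P^0`
(`Ch.exists_cochain_homotopy`), and the left unitor `P^0 ⊗ P ≅ P` extends to a chain map `v : P ⊗ P
⟶ P` (`Ch.exists_product`).

Let `f_0` be the restriction of `f` to `P^0`. Applying `f_0 ⊗ 1` or `1 ⊗ f_0` and then `v` gives
chain maps `S`, `S'` from the sheet algebra to itself (`Ch.exists_sheet_maps`). On `P^0` the map `S'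
g` agrees with `g`, so `S' ≃ 1`; and `S f` agrees with `S'(1) ∘ f`, where `S'(1) ≃ 1`, so `S ≃ 1`.
On `P^0` both `S f ∘ g` and `± S' g ∘ f` are `f_0 ⊗ g_0` followed by `v`. Hence `f ∘ g ≃ S f ∘ g ≃ ±
S' g ∘ f ≃ ± g ∘ f`, as in `Ch.exists_commutator_homotopy`. Every homotopy is additive and preserves
the quantum degree.

Identities between cobordisms reduce to a bijection of components along which Euler characteristics
and dots push forward correctly. -/

lemma push_inj_apply {A K L M : Type} [AddCommMonoid M] (q : A → K) {e : K → L}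
    (he : Function.Injective e) (w : A → M) (k : K) :
    push (fun a => e (q a)) w (e k) = push q w k := by
  unfold push
  refine finsum_congr fun a => ?_
  by_cases h : q a = k
  · rw [if_pos h, if_pos (congrArg e h)]
  · rw [if_neg h, if_neg fun h' => h (he h')]

lemma push_one_apply {A K : Type} [Fintype A] [DecidableEq K] (q : A → K) (k : K) :
    push q (1 : A → ℤ) k = (Finset.univ.filter fun a => q a = k).card := by
  classical
  rw [push, finsum_eq_sum_of_fintype, ← Finset.sum_boole]
  exact Finset.sum_congr rfl fun a _ => by congr

lemma push_bijective_one {A K M : Type} [AddCommMonoidWithOne M] {e : A → K}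
    (he : Function.Bijective e) : push e (1 : A → M) = 1 := by
  funext k
  obtain ⟨a, rfl⟩ := he.2 k
  exact push_equiv (Equiv.ofBijective e he) 1 a

namespace OneManifold.Homeo

variable {m k n : ℕ}

@[simps] def trans {X Y Z : OneManifold m n} (e : X.Homeo Y) (f : Y.Homeo Z) : X.Homeo Z where
  e := e.e.trans f.e
  top j := by simp [e.top, f.top]
  bot j := by simp [e.bot, f.bot]
  χ c := by simp [e.χ, f.χ]

@[simps] def symm {X Y : OneManifold m n} (e : X.Homeo Y) : Y.Homeo X where
  e := e.e.symm
  top j := by rw [Equiv.symm_apply_eq, e.top]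
  bot j := by rw [Equiv.symm_apply_eq, e.bot]
  χ c := by rw [← e.χ, Equiv.apply_symm_apply]

@[ext] lemma ext {X Y : OneManifold m n} {e f : X.Homeo Y} (h : ∀ x, e.e x = f.e x) : e = f := by
  cases e; cases f
  congr
  exact Equiv.ext h

end OneManifold.Homeo

/-! ### Euler characteristics from endpoints, coherence homeomorphisms -/

namespace Diagram

variable {m k n : ℕ}

/-- Endpoints are counted on each component: a strand beside the arc has one at the top and one at
the bottom, the arc `i` has none at the top and the points `i`, `i + 1` at the bottom. -/
lemma two_smul_χ_cap (n i : ℕ) (h : i + 2 ≤ n) :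
    (cap n i h).space.χ + (cap n i h).space.χ =
      push (cap n i h).space.top 1 + push (cap n i h).space.bot 1 := by
  obtain ⟨n, rfl⟩ : ∃ k, n = k + 2 := ⟨n - 2, by omega⟩
  funext (c : Fin (n + 1))
  change (1 + 1 : ℤ) = push (OneManifold.cap (n + 2) i h).top 1 c +
    push (OneManifold.cap (n + 2) i h).bot 1 c
  rw [push_one_apply, push_one_apply]
  rcases lt_trichotomy (c : ℕ) i with hc | hc | hc
  · rw [show (Finset.univ.filter fun j => (OneManifold.cap (n + 2) i h).top j = c) =
        {(⟨c, by omega⟩ : Fin n)} by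
      ext j; simp only [Finset.mem_filter, Finset.mem_univ, true_and, Finset.mem_singleton,
        Fin.ext_iff]; split_ifs <;> omega,
      show (Finset.univ.filter fun j => (OneManifold.cap (n + 2) i h).bot j = c) =
        {(⟨c, by omega⟩ : Fin (n + 2))} by
      ext j; simp only [Finset.mem_filter, Finset.mem_univ, true_and, Finset.mem_singleton,
        Fin.ext_iff]; split_ifs <;> omega]
    simp
  · rw [show (Finset.univ.filter fun j => (OneManifold.cap (n + 2) i h).top j = c) = ∅ by
      ext j; simp only [Finset.mem_filter, Finset.mem_univ, true_and, Finset.notMem_empty,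
        Fin.ext_iff, iff_false]; split_ifs <;> omega,
      show (Finset.univ.filter fun j => (OneManifold.cap (n + 2) i h).bot j = c) =
        {(⟨c, by omega⟩ : Fin (n + 2)), (⟨c + 1, by omega⟩ : Fin (n + 2))} by
      ext j; simp only [Finset.mem_filter, Finset.mem_univ, true_and, Finset.mem_singleton,
        Finset.mem_insert, Fin.ext_iff]; split_ifs <;> omega]
    rw [Finset.card_pair (by simp [Fin.ext_iff])]
    simp
  · rw [show (Finset.univ.filter fun j => (OneManifold.cap (n + 2) i h).top j = c) =
        {(⟨c - 1, by omega⟩ : Fin n)} by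
      ext j; simp only [Finset.mem_filter, Finset.mem_univ, true_and, Finset.mem_singleton,
        Fin.ext_iff]; split_ifs <;> omega,
      show (Finset.univ.filter fun j => (OneManifold.cap (n + 2) i h).bot j = c) =
        {(⟨c + 1, by omega⟩ : Fin (n + 2))} by
      ext j; simp only [Finset.mem_filter, Finset.mem_univ, true_and, Finset.mem_singleton,
        Fin.ext_iff]; split_ifs <;> omega]
    simp

/-- An arc has two endpoints and a circle has none. -/
lemma two_smul_χ (a : Diagram m n) :
    a.space.χ + a.space.χ = push a.space.top 1 + push a.space.bot 1 := by
  induction a with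
  | one n =>
    change (1 : Fin n → ℤ) + 1 = push (fun j => j) 1 + push (fun j => j) 1
    rw [push_id]
  | cap n i h => exact two_smul_χ_cap n i h
  | cup n i h => exact (two_smul_χ_cap n i h).trans (add_comm _ _)
  | @stack m k n a b iha ihb =>
    -- Each gluing point is a bottom end of `a` and a top end of `b`. Both occurrences disappear
    -- from the count of endpoints, matching the gluing term of `χ` taken twice.
    have h : (push (fun j => Glue.inl (a.space.bot j)) 1 : (a.stack b).space.Comp → ℤ) =
        push (fun j => Glue.inr (b.space.top j)) 1 := by
      congr 1; funext j; exact Glue.sound j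
    have ha := congrArg (push (Glue.inl : _ → (a.stack b).space.Comp)) iha
    have hb := congrArg (push (Glue.inr : _ → (a.stack b).space.Comp)) ihb
    rw [push_add, push_add, push_push, push_push] at ha hb
    change (push Glue.inl a.space.χ + push Glue.inr b.space.χ -
      push (fun j => Glue.inl (a.space.bot j)) 1) + (push Glue.inl a.space.χ +
      push Glue.inr b.space.χ - push (fun j => Glue.inl (a.space.bot j)) 1) =
      push (fun j => Glue.inl (a.space.top j)) 1 + push (fun j => Glue.inr (b.space.bot j)) 1
    rw [← h] at hb
    linear_combination ha + hb

/-- A homeomorphism between 1-manifolds drawn by diagrams is a bijection between the components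
that fixes the endpoints. -/
@[simps] def homeo {a b : Diagram m n} (f : a.space.Comp → b.space.Comp)
    (g : b.space.Comp → a.space.Comp) (hgf : ∀ c, g (f c) = c) (hfg : ∀ c, f (g c) = c)
    (top : ∀ j, f (a.space.top j) = b.space.top j) (bot : ∀ j, f (a.space.bot j) = b.space.bot j) :
    a.space.Homeo b.space where
  e := ⟨f, g, hgf, hfg⟩
  top := top
  bot := bot
  χ c := by
    -- No condition on `χ` is needed: by `two_smul_χ` it is half the number of endpoints, and the
    -- bijection preserves those.
    have hf : Function.Injective f := Function.LeftInverse.injective hgf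
    have ha := congrFun a.two_smul_χ c
    have hb := congrFun b.two_smul_χ (f c)
    simp only [Pi.add_apply] at ha hb
    rw [← funext top, ← funext bot, push_inj_apply _ hf, push_inj_apply _ hf, ← ha] at hb
    change b.space.χ (f c) = _
    omega

/-- `(a ⊗ b) ⊗ c ≅ a ⊗ (b ⊗ c)` -/
def assoc {l : ℕ} (a : Diagram m k) (b : Diagram k l) (c : Diagram l n) :
    ((a.stack b).stack c).space.Homeo (a.stack (b.stack c)).space :=
  homeo
    (Glue.desc (Glue.desc Glue.inl (fun t => Glue.inr (Glue.inl t)) Glue.sound)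
      (fun u => Glue.inr (Glue.inr u)) fun z => congrArg Glue.inr (Glue.sound z))
    (Glue.desc (fun s => Glue.inl (Glue.inl s))
      (Glue.desc (fun t => Glue.inl (Glue.inr t)) Glue.inr Glue.sound)
        fun y => congrArg Glue.inl (Glue.sound y))
    (Glue.ind (Glue.ind (fun _ => rfl) fun _ => rfl) fun _ => rfl)
    (Glue.ind (fun _ => rfl) (Glue.ind (fun _ => rfl) fun _ => rfl))
    (fun _ => rfl) (fun _ => rfl)

/-- `1 ⊗ a ≅ a` -/
def leftUnit (a : Diagram m n) : ((one m).stack a).space.Homeo a.space :=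
  homeo (Glue.desc a.space.top id fun _ => rfl) Glue.inr
    (Glue.ind (fun x => (Glue.sound x).symm) fun _ => rfl) (fun _ => rfl) (fun _ => rfl)
    (fun _ => rfl)

/-- `a ⊗ 1 ≅ a` -/
def rightUnit (a : Diagram m n) : (a.stack (one n)).space.Homeo a.space :=
  homeo (Glue.desc id a.space.bot fun _ => rfl) Glue.inl
    (Glue.ind (fun _ => rfl) fun x => (Glue.sound x)) (fun _ => rfl) (fun _ => rfl)
    (fun _ => rfl)

/-- Homeomorphisms can be stacked. -/
def stackHomeo {a a' : Diagram m k} {b b' : Diagram k n} (e : a.space.Homeo a'.space)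
    (f : b.space.Homeo b'.space) : (a.stack b).space.Homeo (a'.stack b').space :=
  homeo
    (Glue.desc (fun x => Glue.inl (e.e x)) (fun y => Glue.inr (f.e y)) fun j => by
      rw [e.bot, f.top]; exact Glue.sound j)
    (Glue.desc (fun x => Glue.inl (e.e.symm x)) (fun y => Glue.inr (f.e.symm y)) fun j => by
      rw [← e.bot, ← f.top, Equiv.symm_apply_apply, Equiv.symm_apply_apply]; exact Glue.sound j)
    (Glue.ind (fun x => congrArg Glue.inl (e.e.symm_apply_apply x))
      fun x => congrArg Glue.inr (f.e.symm_apply_apply x))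
    (Glue.ind (fun x => congrArg Glue.inl (e.e.apply_symm_apply x))
      fun x => congrArg Glue.inr (f.e.apply_symm_apply x))
    (fun j => congrArg Glue.inl (e.top j)) (fun j => congrArg Glue.inr (f.bot j))

end Diagram

/-! ### Collars: gluing cylinders to surfaces -/

namespace Surface

variable {m k n : ℕ}

/-- A collar only relabels the end of `S`: its components are absorbed by those that they meet, and
its Euler characteristic cancels that of the curves along which it is glued. -/
lemma comp_cylinder_homeo {X Y Y' : OneManifold m n} (S : Surface X Y) (e : Y.Homeo Y')
    {T : Surface X Y'} (φ : S.Comp ≃ T.Comp) (hs : ∀ x, φ (S.src x) = T.src x)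
    (ht : ∀ y, φ (S.tgt y) = T.tgt (e.e y)) (hχ : push φ S.χ = T.χ) (hd : push φ S.dots = T.dots) :
    (S.comp (cylinder e)).Homeo T := by
  refine homeo_of_maps (Glue.desc φ T.tgt ht)
    (fun c => Glue.inl (φ.symm c)) ?_ (fun c => φ.apply_symm_apply c)
    hs (fun _ => rfl) ?_ ?_
  · refine Glue.ind (fun c => congrArg Glue.inl (φ.symm_apply_apply c)) fun y => ?_
    obtain ⟨y, rfl⟩ := e.e.surjective y
    change Glue.inl (φ.symm (T.tgt (e.e y))) = _
    rw [← ht, φ.symm_apply_apply]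
    exact Glue.sound y
  · have h : push (fun y => T.tgt (e.e y)) Y.χ = push T.tgt Y'.χ := by
      rw [← push_push e.e T.tgt]
      congr 1
      funext y
      obtain ⟨y, rfl⟩ := e.e.surjective y
      rw [push_equiv, e.χ]
    simp only [comp, push_add, push_sub, push_push, Glue.desc_inl, Glue.desc_inr, ht, h]
    change push φ S.χ + push T.tgt Y'.χ - push T.tgt Y'.χ = _
    rw [hχ, add_sub_cancel_right]
  · simp only [comp, push_add, push_push]
    change push φ S.dots + push T.tgt 0 = T.dots
    rw [hd, push_zero, add_zero]

lemma cylinder_comp_homeo {X X' Y : OneManifold m n} (e : X.Homeo X') (S : Surface X' Y)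
    {T : Surface X Y} (φ : S.Comp ≃ T.Comp) (hs : ∀ x, φ (S.src (e.e x)) = T.src x)
    (ht : ∀ y, φ (S.tgt y) = T.tgt y) (hχ : push φ S.χ = T.χ) (hd : push φ S.dots = T.dots) :
    ((cylinder e).comp S).Homeo T := by
  refine homeo_of_maps (Glue.desc (fun x => φ (S.src x)) φ fun _ => rfl)
    (fun c => Glue.inr (φ.symm c)) ?_ (fun c => φ.apply_symm_apply c)
    hs ht ?_ ?_
  · refine Glue.ind (fun x => ?_) fun c => congrArg Glue.inr (φ.symm_apply_apply c)
    change Glue.inr (φ.symm (φ (S.src x))) = _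
    rw [φ.symm_apply_apply]
    exact (Glue.sound x).symm
  · simp only [comp, push_add, push_sub, push_push, Glue.desc_inl, Glue.desc_inr]
    change push (fun x => φ (S.src x)) X'.χ + push φ S.χ - push (fun x => φ (S.src x)) X'.χ = _
    rw [hχ, add_sub_cancel_left]
  · simp only [comp, push_add, push_push]
    change push (fun x => φ (S.src x)) 0 + push φ S.dots = T.dots
    rw [hd, push_zero, zero_add]

lemma Homeo.symm {X Y : OneManifold m n} {S T : Surface X Y} (h : S.Homeo T) : T.Homeo S := by
  obtain ⟨e, hs, ht, hχ, hd⟩ := h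
  refine ⟨e.symm, fun x => ?_, fun x => ?_, fun x => ?_, fun x => ?_⟩
  · rw [← hs, e.symm_apply_apply]
  · rw [← ht, e.symm_apply_apply]
  · rw [← hχ, e.apply_symm_apply]
  · rw [← hd, e.apply_symm_apply]

lemma Homeo.trans {X Y : OneManifold m n} {S T U : Surface X Y} (h : S.Homeo T)
    (h' : T.Homeo U) : S.Homeo U := by
  obtain ⟨e, hs, ht, hχ, hd⟩ := h
  obtain ⟨e', hs', ht', hχ', hd'⟩ := h'
  refine ⟨e.trans e', fun x => ?_, fun x => ?_, fun x => ?_, fun x => ?_⟩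
  · rw [Equiv.trans_apply, hs, hs']
  · rw [Equiv.trans_apply, ht, ht']
  · rw [Equiv.trans_apply, hχ', hχ]
  · rw [Equiv.trans_apply, hd', hd]

/-- Surfaces that differ by homeomorphisms of their ends. -/
lemma natural {X X' Y Y' : OneManifold m n} (S : Surface X Y) (T : Surface X' Y')
    (e : X.Homeo X') (e' : Y.Homeo Y') (φ : S.Comp → T.Comp) (ψ : T.Comp → S.Comp)
    (h1 : ∀ c, ψ (φ c) = c) (h2 : ∀ c, φ (ψ c) = c)
    (hs : ∀ x, φ (S.src x) = T.src (e.e x)) (ht : ∀ y, φ (S.tgt y) = T.tgt (e'.e y))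
    (hχ : push φ S.χ = T.χ) (hd : push φ S.dots = T.dots) :
    (S.comp (cylinder e')).Homeo ((cylinder e).comp T) :=
  -- Both sides are compared with `T` with its source relabelled along `e`, a surface from `X` to
  -- `Y'`.
  (comp_cylinder_homeo S e' (T := { T with
      src := fun x => T.src (e.e x)
      top := fun j => by rw [e.top, T.top]
      bot := fun j => by rw [e.bot, T.bot] }) ⟨φ, ψ, h1, h2⟩ hs ht hχ hd).trans
    (cylinder_comp_homeo e T (Equiv.refl _) (fun _ => rfl) (fun _ => rfl) (push_id _)
      (push_id _)).symm

lemma cylinder_comp_cylinder {X Y Z : OneManifold m n} (e : X.Homeo Y) (f : Y.Homeo Z) :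
    ((cylinder e).comp (cylinder f)).Homeo (cylinder (e.trans f)) :=
  cylinder_comp_homeo e _ (Equiv.refl _) (fun _ => rfl) (fun _ => rfl) (push_id _) (push_id _)

end Surface

/-! ### Cylinders as isomorphisms, naturality of associator and unitors -/

namespace Mor

variable {m k l n : ℕ}

/-- The isomorphism given by the cylinder over a homeomorphism. -/
def cyl {a b : Diagram m n} (e : a.space.Homeo b.space) : Mor a b := of (.cylinder e) 1

lemma cyl_refl (a : Diagram m n) : cyl (OneManifold.Homeo.refl a.space) = id a := rfl

lemma cyl_comp {a b c : Diagram m n} (e : a.space.Homeo b.space) (f : b.space.Homeo c.space) :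
    comp (cyl e) (cyl f) = cyl (e.trans f) := by
  rw [cyl, cyl, comp_of, one_mul]
  exact of_eq (Surface.cylinder_comp_cylinder e f) 1

lemma cyl_eq_id {a : Diagram m n} {e : a.space.Homeo a.space} (h : ∀ x, e.e x = x) :
    cyl e = id a := by
  rw [← cyl_refl]
  congr 1
  exact OneManifold.Homeo.ext h

lemma cyl_symm_comp {a b : Diagram m n} (e : a.space.Homeo b.space) :
    comp (cyl e.symm) (cyl e) = id b := by
  rw [cyl_comp, cyl_eq_id]; simp

lemma cyl_comp_symm {a b : Diagram m n} (e : a.space.Homeo b.space) :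
    comp (cyl e) (cyl e.symm) = id a := by
  rw [cyl_comp, cyl_eq_id]; simp

lemma cyl_stack {a a' : Diagram m k} {b b' : Diagram k n} (e : a.space.Homeo a'.space)
    (f : b.space.Homeo b'.space) : stack (cyl e) (cyl f) = cyl (Diagram.stackHomeo e f) := by
  rw [cyl, cyl, stack_of, one_mul]
  refine of_eq ?_ 1
  refine Surface.homeo_of_maps
    (S := (Surface.cylinder e).stack (Surface.cylinder f))
    (T := Surface.cylinder (Diagram.stackHomeo e f))
    (Glue.desc Glue.inl Glue.inr fun j => by
      change Glue.inl (e.e (a.space.bot j)) = Glue.inr (f.e (b.space.top j))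
      rw [e.bot, f.top]; exact Glue.sound j)
    (Glue.desc Glue.inl Glue.inr fun j => by
      change Glue.inl (a'.space.bot j) = Glue.inr (b'.space.top j)
      rw [← e.bot, ← f.top]; exact Glue.sound j)
    (Glue.ind (fun _ => rfl) fun _ => rfl) (Glue.ind (fun _ => rfl) fun _ => rfl)
    (Glue.ind (fun _ => rfl) fun _ => rfl) (Glue.ind (fun _ => rfl) fun _ => rfl) ?_ ?_
  · simp only [Surface.stack, push_add, push_sub, push_push, Glue.desc_inl, Glue.desc_inr, e.bot]
  · simp only [Surface.stack, push_zero, add_zero]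

lemma induction₂ {m' n' : ℕ} {a b : Diagram m n} {a' b' : Diagram m' n'}
    {p : Mor a b → Mor a' b' → Prop} (x : Mor a b) (y : Mor a' b') (zl : ∀ y, p 0 y)
    (zr : ∀ x, p x 0)
    (addl : ∀ x x' y, p x y → p x' y → p (x + x') y)
    (addr : ∀ x y y', p x y → p x y' → p x (y + y')) (of : ∀ V W r s, p (of V r) (of W s)) :
    p x y := by
  induction x using induction with
  | zero => exact zl y
  | add x x' h h' => exact addl _ _ _ h h'
  | of V r =>
    induction y using induction with
    | zero => exact zr _
    | add x x' h h' => exact addr _ _ _ h h'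
    | of W s => exact of V W r s

/-- The components of the two surfaces correspond by the reassociation of gluings that defines
`Diagram.assoc`, so the ends match; multilinearity reduces the claim to single cobordisms. -/
lemma assoc_naturality {a a' : Diagram m k} {b b' : Diagram k l} {c c' : Diagram l n}
    (x : Mor a a') (y : Mor b b') (z : Mor c c') :
    comp (stack (stack x y) z) (cyl (Diagram.assoc a' b' c')) =
      comp (cyl (Diagram.assoc a b c)) (stack x (stack y z)) := by
  induction x, y using induction₂ with
  | zl => simp
  | zr => simp
  | addl x x' y hx hy => simp only [map_add, LinearMap.add_apply, hx, hy]
  | addr x x' y hx hy => simp only [map_add, LinearMap.add_apply, hx, hy]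
  | of U V r s =>
    induction z using induction with
    | zero => simp
    | add x x' hx hy => simp only [map_add, LinearMap.add_apply, hx, hy]
    | of W t =>
      rw [cyl, cyl, stack_of, stack_of, comp_of, stack_of, stack_of, comp_of, one_mul, mul_one,
        mul_assoc]
      refine of_eq (Surface.natural ((U.surface.stack V.surface).stack W.surface)
        (U.surface.stack (V.surface.stack W.surface)) _ _
        (Glue.desc (Glue.desc Glue.inl (fun t => Glue.inr (Glue.inl t)) Glue.sound)
          (fun u => Glue.inr (Glue.inr u)) fun z => congrArg Glue.inr (Glue.sound z))
        (Glue.desc (fun s => Glue.inl (Glue.inl s))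
          (Glue.desc (fun t => Glue.inl (Glue.inr t)) Glue.inr Glue.sound)
            fun y => congrArg Glue.inl (Glue.sound y))
        (Glue.ind (Glue.ind (fun _ => rfl) fun _ => rfl) fun _ => rfl)
        (Glue.ind (fun _ => rfl) (Glue.ind (fun _ => rfl) fun _ => rfl))
        (Glue.ind (Glue.ind (fun _ => rfl) fun _ => rfl) fun _ => rfl)
        (Glue.ind (Glue.ind (fun _ => rfl) fun _ => rfl) fun _ => rfl) ?_ ?_) _
      · simp only [Surface.stack, push_add, push_sub, push_push]
        change push (fun t => Glue.inl t) U.surface.χ +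
          push (fun t => Glue.inr (Glue.inl t)) V.surface.χ -
          push (fun j => Glue.inl (U.surface.src (a.space.bot j))) 1 +
          push (fun t => Glue.inr (Glue.inr t)) W.surface.χ -
          push (fun j => Glue.inr (Glue.inl (V.surface.src (b.space.bot j)))) 1 = _
        abel
      · simp only [Surface.stack, push_add, push_push]
        exact add_assoc _ _ _

/-- The sheets over the strands are absorbed by the components that they touch. A sheet contributes
`1` to the Euler characteristic and its gluing segment takes `1` away. -/
lemma leftUnit_naturality {a a' : Diagram m n} (x : Mor a a') :
    comp (stack (id (.one m)) x) (cyl a'.leftUnit) = comp (cyl a.leftUnit) x := by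
  induction x using induction with
  | zero => simp
  | add x x' hx hy => simp only [map_add, LinearMap.add_apply, hx, hy]
  | of W t =>
    rw [cyl, cyl, id, stack_of, comp_of, comp_of, one_mul, mul_one]
    refine of_eq (Surface.natural ((Surface.cylinder (.refl (.strands m))).stack W.surface) W.surface
      a.leftUnit a'.leftUnit (Glue.desc (fun j => W.surface.src (a.space.top j)) (fun c => c) fun _ => rfl) Glue.inr
      (Glue.ind (fun x => (Glue.sound x).symm) fun _ => rfl) (fun _ => rfl)
      (Glue.ind (fun _ => rfl) fun _ => rfl)
      (Glue.ind (fun j => W.surface.top j) fun _ => rfl) ?_ ?_) _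
    · simp only [Surface.stack, push_add, push_sub, push_push]
      change push (fun j => W.surface.src (a.space.top j)) 1 + push (fun c => c) W.surface.χ -
        push (fun j => W.surface.src (a.space.top j)) 1 = W.surface.χ
      rw [push_id, add_sub_cancel_left]
    · simp only [Surface.stack, push_add, push_push]
      change push (fun j => W.surface.src (a.space.top j)) 0 + push (fun c => c) W.surface.dots =
        W.surface.dots
      rw [push_id, push_zero, zero_add]

lemma rightUnit_naturality {a a' : Diagram m n} (x : Mor a a') :
    comp (stack x (id (.one n))) (cyl a'.rightUnit) = comp (cyl a.rightUnit) x := by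
  induction x using induction with
  | zero => simp
  | add x x' hx hy => simp only [map_add, LinearMap.add_apply, hx, hy]
  | of W t =>
    rw [cyl, cyl, id, stack_of, comp_of, comp_of, one_mul, mul_one, mul_one]
    refine of_eq (Surface.natural (W.surface.stack (Surface.cylinder (.refl (.strands n)))) W.surface
      a.rightUnit a'.rightUnit (Glue.desc (fun c => c) (fun j => W.surface.src (a.space.bot j)) fun _ => rfl) Glue.inl
      (Glue.ind (fun _ => rfl) fun x => Glue.sound x) (fun _ => rfl)
      (Glue.ind (fun _ => rfl) fun _ => rfl)
      (Glue.ind (fun _ => rfl) fun j => W.surface.bot j) ?_ ?_) _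
    · simp only [Surface.stack, push_add, push_sub, push_push]
      change push (fun c => c) W.surface.χ + push (fun j => W.surface.src (a.space.bot j)) 1 -
        push (fun j => W.surface.src (a.space.bot j)) 1 = W.surface.χ
      rw [push_id, add_sub_cancel_right]
    · simp only [Surface.stack, push_add, push_push]
      change push (fun c => c) W.surface.dots + push (fun j => W.surface.src (a.space.bot j)) 0 =
        W.surface.dots
      rw [push_id, push_zero, add_zero]

lemma cyl_mem_homogeneous {a b : Diagram m n} (e : a.space.Homeo b.space) :
    cyl e ∈ homogeneous a b 0 := by
  refine AddSubgroup.subset_closure ⟨.cylinder e, 0, ?_, by rw [pow_zero]; rfl⟩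
  have h := b.sum_χ
  simp only [Cobordism.deg, Cobordism.surface, Pi.zero_apply, Nat.cast_zero, finsum_zero]
  rw [h]; ring

end Mor

/-! ### Planar isotopies of a cap above a cup -/

namespace Diagram

/-- An arc on the right of a cup that meets it in one point can be pulled straight. -/
def straighten (n i j : ℕ) (hi : i + 2 ≤ n) (hj : j + 2 ≤ n) (h : i = j + 1 ∨ j = i + 1) :
    ((cap n j hj).stack (cup n i hi)).space.Homeo (one (n - 2)).space :=
  -- The gluing relation at the middle point `p`, for components given by their numerical values, so
  -- that the side conditions become arithmetic.
  have hs : ∀ (p : Fin n) (x y : Fin (n - 1)), (x : ℕ) = (if (p : ℕ) ≤ j then p else p - 1 : ℕ) →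
      (y : ℕ) = (if (p : ℕ) ≤ i then p else p - 1 : ℕ) →
      (Glue.inl x : ((cap n j hj).stack (cup n i hi)).space.Comp) = Glue.inr y := by
    intro p x y hx hy
    have h := Glue.sound (f := (cap n j hj).space.bot) (g := (cup n i hi).space.top) p
    rwa [show (cap n j hj).space.bot p = x from Fin.ext hx.symm,
      show (cup n i hi).space.top p = y from Fin.ext hy.symm] at h
  -- `u` and `v` give the strand into which a component of the cap or of the cup is pulled. Both
  -- arcs lie on strand `min i j`; the other components close the gap left by an arc.
  let u : Fin (n - 1) → Fin (n - 2) := fun x =>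
    ⟨if (x : ℕ) < j then x else if (x : ℕ) = j then min i j else x - 1, by
      split_ifs <;> omega⟩
  let v : Fin (n - 1) → Fin (n - 2) := fun x =>
    ⟨if (x : ℕ) < i then x else if (x : ℕ) = i then min i j else x - 1, by
      split_ifs <;> omega⟩
  have huv : ∀ p : Fin n, u ((cap n j hj).space.bot p) = v ((cup n i hi).space.top p) := fun p =>
    Fin.ext (by
      simp only [u, v]
      split_ifs <;> omega)
  have hl : ∀ x : Fin (n - 1), (Glue.inl ((cap n j hj).space.top (u x)) :
      ((cap n j hj).stack (cup n i hi)).space.Comp) = Glue.inl x := fun x => by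
    by_cases hx : (x : ℕ) = j
    -- The bent strand is followed along the arc of the cup: its two ends are the middle points used
    -- here, and they link a strand of the cap to the arc of the cap.
    · rcases h with h | h
      · refine (hs ⟨j + 2, by omega⟩ _ ⟨j + 1, by omega⟩ ?_ ?_).trans
          (hs ⟨j + 1, by omega⟩ _ _ ?_ ?_).symm
        all_goals simp only [u]; split_ifs <;> omega
      · refine (hs ⟨i, by omega⟩ _ ⟨i, by omega⟩ ?_ ?_).trans
          (hs ⟨i + 1, by omega⟩ _ _ ?_ ?_).symm
        all_goals simp only [u]; split_ifs <;> omega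
    · exact congrArg Glue.inl (Fin.ext (by simp only [u]; split_ifs <;> omega))
  homeo (Glue.desc u v huv) (fun k => Glue.inl ((cap n j hj).space.top k))
    (Glue.ind hl fun y => by
      rw [← hs ⟨if (y : ℕ) ≤ i then y else y + 1, by split_ifs <;> omega⟩
        ⟨if (if (y : ℕ) ≤ i then y else y + 1 : ℕ) ≤ j then (if (y : ℕ) ≤ i then y else y + 1 : ℕ)
          else (if (y : ℕ) ≤ i then y else y + 1 : ℕ) - 1, by split_ifs <;> omega⟩ y rfl
          (by simp only; split_ifs <;> omega)]
      exact hl _)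
    (fun k => Fin.ext (by change (u _ : ℕ) = _; simp only [u]; split_ifs <;> omega))
    (fun k => Fin.ext (by change (u _ : ℕ) = _; simp only [u]; split_ifs <;> omega))
    (fun k => Fin.ext (by change (v _ : ℕ) = _; simp only [v]; split_ifs <;> omega))

set_option maxHeartbeats 1000000 in
/-- A distant arc can be moved past a cup. -/
def exchange (n i j i' j' : ℕ) (hi : i + 2 ≤ n) (hj : j + 2 ≤ n) (hi' : i' + 2 ≤ n - 2)
    (hj' : j' + 2 ≤ n - 2)
    (h : (j + 2 ≤ i ∧ i' = i - 2 ∧ j' = j) ∨ (i + 2 ≤ j ∧ i' = i ∧ j' = j - 2)) :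
    ((cap n j hj).stack (cup n i hi)).space.Homeo
      ((cup (n - 2) i' hi').stack (cap (n - 2) j' hj')).space :=
  have hs : ∀ (p : Fin n) (x y : Fin (n - 1)), (x : ℕ) = (if (p : ℕ) ≤ j then p else p - 1 : ℕ) →
      (y : ℕ) = (if (p : ℕ) ≤ i then p else p - 1 : ℕ) →
      (Glue.inl x : ((cap n j hj).stack (cup n i hi)).space.Comp) = Glue.inr y := by
    intro p x y hx hy
    have h := Glue.sound (f := (cap n j hj).space.bot) (g := (cup n i hi).space.top) p
    rwa [show (cap n j hj).space.bot p = x from Fin.ext hx.symm,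
      show (cup n i hi).space.top p = y from Fin.ext hy.symm] at h
  have hs' : ∀ (p : Fin (n - 2 - 2)) (x y : Fin (n - 2 - 1)),
      (x : ℕ) = (if (p : ℕ) < i' then p else p + 1 : ℕ) →
      (y : ℕ) = (if (p : ℕ) < j' then p else p + 1 : ℕ) →
      (Glue.inl x : ((cup (n - 2) i' hi').stack (cap (n - 2) j' hj')).space.Comp) =
        Glue.inr y := by
    intro p x y hx hy
    have h := Glue.sound (f := (cup (n - 2) i' hi').space.bot)
      (g := (cap (n - 2) j' hj').space.top) p
    rwa [show (cup (n - 2) i' hi').space.bot p = x from Fin.ext hx.symm,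
      show (cap (n - 2) j' hj').space.top p = y from Fin.ext hy.symm] at h
  -- For a piece with arc `k`, `e k` sends an endpoint on the side away from the arc to its
  -- component, and `s k` inverts it off the arc. On the side of the arc, `s (k + 1)` sends an
  -- endpoint to its component, and `e (k + 1)` is a section.
  let s : ℕ → ℕ → ℕ := fun k x => if x < k then x else x - 1
  let e : ℕ → ℕ → ℕ := fun k x => if x < k then x else x + 1
  let u : Fin (n - 1) → ((cup (n - 2) i' hi').stack (cap (n - 2) j' hj')).space.Comp := fun x =>
    if (x : ℕ) = j then Glue.inr (⟨j', by omega⟩ : Fin (n - 2 - 1))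
    else Glue.inl (⟨s (i' + 1) (s j x), by simp only [s]; split_ifs <;> omega⟩ : Fin (n - 2 - 1))
  let v : Fin (n - 1) → ((cup (n - 2) i' hi').stack (cap (n - 2) j' hj')).space.Comp := fun x =>
    if (x : ℕ) = i then Glue.inl (⟨i', by omega⟩ : Fin (n - 2 - 1))
    else Glue.inr (⟨s (j' + 1) (s i x), by simp only [s]; split_ifs <;> omega⟩ : Fin (n - 2 - 1))
  let u' : Fin (n - 2 - 1) → ((cap n j hj).stack (cup n i hi)).space.Comp := fun x =>
    if (x : ℕ) = i' then Glue.inr (⟨i, by omega⟩ : Fin (n - 1))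
    else Glue.inl (⟨e j (e (i' + 1) x), by simp only [e]; split_ifs <;> omega⟩ : Fin (n - 1))
  let v' : Fin (n - 2 - 1) → ((cap n j hj).stack (cup n i hi)).space.Comp := fun x =>
    if (x : ℕ) = j' then Glue.inl (⟨j, by omega⟩ : Fin (n - 1))
    else Glue.inr (⟨e i (e (j' + 1) x), by simp only [e]; split_ifs <;> omega⟩ : Fin (n - 1))
  have huv : ∀ p : Fin n, u ((cap n j hj).space.bot p) = v ((cup n i hi).space.top p) := by
    intro p
    obtain ⟨x, hx⟩ : ∃ x, x = (cap n j hj).space.bot p := ⟨_, rfl⟩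
    obtain ⟨y, hy⟩ : ∃ y, y = (cup n i hi).space.top p := ⟨_, rfl⟩
    rw [← hx, ← hy]
    replace hx : (x : ℕ) = (if (p : ℕ) ≤ j then p else p - 1 : ℕ) := congrArg Fin.val hx
    replace hy : (y : ℕ) = (if (p : ℕ) ≤ i then p else p - 1 : ℕ) := congrArg Fin.val hy
    change Fin (n - 1) at x y
    simp only [u, v]
    by_cases h1 : (x : ℕ) = j
    · rw [if_pos h1, if_neg (by split_ifs at hx hy <;> omega)]
      exact congrArg Glue.inr (Fin.ext (by simp only [s]; split_ifs at hx hy ⊢ <;> omega))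
    · rw [if_neg h1]
      by_cases h2 : (y : ℕ) = i
      · rw [if_pos h2]
        exact congrArg Glue.inl (Fin.ext (by simp only [s]; split_ifs at hx hy ⊢ <;> omega))
      · rw [if_neg h2]
        -- Neither component is an arc, so after the exchange the strand crosses the middle line at
        -- one of its `n - 4` points, whose number is recovered from `x`.
        refine hs' ⟨s i' (s (i' + 1) (s j x)), ?_⟩ _ _ ?_ ?_
        all_goals
          simp only [s]
          rcases h with ⟨h, rfl, rfl⟩ | ⟨h, rfl, rfl⟩ <;> split_ifs at hx hy ⊢ <;> omega
  have huv' : ∀ p : Fin (n - 2 - 2), u' ((cup (n - 2) i' hi').space.bot p) =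
      v' ((cap (n - 2) j' hj').space.top p) := by
    intro p
    obtain ⟨x, hx⟩ : ∃ x, x = (cup (n - 2) i' hi').space.bot p := ⟨_, rfl⟩
    obtain ⟨y, hy⟩ : ∃ y, y = (cap (n - 2) j' hj').space.top p := ⟨_, rfl⟩
    rw [← hx, ← hy]
    replace hx : (x : ℕ) = (if (p : ℕ) < i' then p else p + 1 : ℕ) := congrArg Fin.val hx
    replace hy : (y : ℕ) = (if (p : ℕ) < j' then p else p + 1 : ℕ) := congrArg Fin.val hy
    change Fin (n - 2 - 1) at x y
    have h1 : (x : ℕ) ≠ i' := by split_ifs at hx <;> omega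
    have h2 : (y : ℕ) ≠ j' := by split_ifs at hy <;> omega
    simp only [u', v']
    rw [if_neg h1, if_neg h2]
    refine hs ⟨e j (e j (e (i' + 1) x)), ?_⟩ _ _ ?_ ?_
    all_goals simp only [e]; split_ifs at hx hy ⊢ <;> omega
  homeo (Glue.desc u v huv) (Glue.desc u' v' huv')
    (Glue.ind (fun x => by
      change Glue.desc u' v' huv' (u x) = Glue.inl x
      by_cases h1 : (x : ℕ) = j
      · simp only [u, if_pos h1]
        simp only [Glue.desc_inr, v']
        rw [if_pos trivial]
        exact congrArg Glue.inl (Fin.ext h1.symm)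
      · simp only [u, if_neg h1]
        simp only [Glue.desc_inl, u']
        by_cases h2 : s (i' + 1) (s j x) = i'
        · rw [if_pos h2]
          refine (hs ⟨e j x, ?_⟩ _ _ ?_ ?_).symm
          all_goals simp only [s, e] at h2 ⊢; split_ifs at h2 ⊢ <;> omega
        · rw [if_neg h2]
          exact congrArg Glue.inl (Fin.ext (by
            simp only [s, e] at h2 ⊢; split_ifs at h2 ⊢ <;> omega))) fun y => by
      change Glue.desc u' v' huv' (v y) = Glue.inr y
      change Fin (n - 1) at y
      by_cases h1 : (y : ℕ) = i
      · simp only [v, if_pos h1]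
        simp only [Glue.desc_inl, u']
        rw [if_pos trivial]
        exact congrArg Glue.inr (Fin.ext h1.symm)
      · simp only [v, if_neg h1]
        simp only [Glue.desc_inr, v']
        by_cases h2 : s (j' + 1) (s i y) = j'
        · rw [if_pos h2]
          refine hs ⟨e i y, ?_⟩ _ _ ?_ ?_
          all_goals simp only [s, e] at h2 ⊢; split_ifs at h2 ⊢ <;> omega
        · rw [if_neg h2]
          exact congrArg Glue.inr (Fin.ext (by
            simp only [s, e] at h2 ⊢; split_ifs at h2 ⊢ <;> omega)))
    (Glue.ind (fun x => by
      change Glue.desc u v huv (u' x) = Glue.inl x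
      change Fin (n - 2 - 1) at x
      by_cases h1 : (x : ℕ) = i'
      · simp only [u', if_pos h1]
        simp only [Glue.desc_inr, v]
        rw [if_pos trivial]
        exact congrArg Glue.inl (Fin.ext h1.symm)
      · simp only [u', if_neg h1]
        simp only [Glue.desc_inl, u]
        rw [if_neg (by simp only [e]; split_ifs <;> omega)]
        exact congrArg Glue.inl (Fin.ext (by simp only [s, e]; split_ifs <;> omega)))
      fun y => by
      change Glue.desc u v huv (v' y) = Glue.inr y
      change Fin (n - 2 - 1) at y
      by_cases h1 : (y : ℕ) = j'
      · simp only [v', if_pos h1]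
        simp only [Glue.desc_inl, u]
        rw [if_pos trivial]
        exact congrArg Glue.inr (Fin.ext h1.symm)
      · simp only [v', if_neg h1]
        simp only [Glue.desc_inr, v]
        rw [if_neg (by simp only [e]; split_ifs <;> omega)]
        exact congrArg Glue.inr (Fin.ext (by simp only [s, e]; split_ifs <;> omega)))
    (fun k => by
      change u _ = Glue.inl ((cup (n - 2) i' hi').space.top k)
      simp only [u]
      rw [if_neg (by split_ifs <;> omega)]
      exact congrArg Glue.inl (Fin.ext (by simp only [s]; split_ifs <;> omega)))
    (fun k => by
      change v _ = Glue.inr ((cap (n - 2) j' hj').space.bot k)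
      simp only [v]
      rw [if_neg (by split_ifs <;> omega)]
      exact congrArg Glue.inr (Fin.ext (by simp only [s]; split_ifs <;> omega)))

end Diagram

/-! ### Delooping a circle -/

lemma push_unit {K : Type} {M : Type} [AddCommMonoid M] [DecidableEq K] (k : K) (w : M) :
    push (fun _ : Unit => k) (fun _ => w) = Pi.single k w := by
  funext l
  rw [push, finsum_eq_sum_of_fintype]
  simp [Pi.single_apply, eq_comm]

lemma push_some {A M : Type} [AddCommMonoid M] (w : A → M) :
    push some w = fun c => Option.elim c 0 w := by
  funext c
  cases c with
  | none => simp [push]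
  | some c =>
    exact (push_inj_apply (fun a => a) (Option.some_injective A) w c).trans (congrFun (push_id w) c)

lemma finsum_one (A : Type) [Fintype A] : ∑ᶠ _ : A, (1 : ℤ) = Fintype.card A := by
  rw [finsum_eq_sum_of_fintype]; simp

/-- The boundary circles form a quotient type; a bijection `q` onto a finite type of known size
counts the disks. -/
lemma Cobordism.deg_disks {m n : ℕ} {a b : Diagram m n}
    (d : Surface.Boundary a.space b.space → ℕ) {K : Type} [Fintype K]
    {q : Surface.Boundary a.space b.space → K} (hq : Function.Bijective q) :
    (disks a b d).deg = -(Fintype.card K : ℤ) + (m + n : ℤ) / 2 + 2 * ((∑ᶠ c, d c : ℕ) : ℤ) := by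
  have h1 : ∑ᶠ c, (disks a b d).surface.χ c = Fintype.card K := by
    change ∑ᶠ c : Surface.Boundary a.space b.space, (1 : Surface.Boundary a.space b.space → ℤ) c = _
    rw [← finsum_push q, push_bijective_one hq, ← finsum_one]
    rfl
  have h2 : ∑ᶠ c, ((disks a b d).surface.dots c : ℤ) = ((∑ᶠ c, d c : ℕ) : ℤ) :=
    ((Nat.castAddMonoidHom ℤ).map_finsum (Set.toFinite _)).symm
  rw [Cobordism.deg, h1, h2]

namespace Deloop

variable {m : ℕ} {b : Diagram m m} (r : b.space.Comp ≃ Option (Fin m))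

section

variable (b)

/-- Cobordisms from the identity diagram to its disjoint union `b` with a circle: disks with `k`
dots on the disk that bounds the circle `o`. -/
def birth (o : b.space.Comp) (k : ℕ) : Cobordism (.one m) b :=
  .disks _ _ (push (fun _ : Unit => Glue.inr o) fun _ => k)

def death (o : b.space.Comp) (k : ℕ) : Cobordism b (.one m) :=
  .disks _ _ (push (fun _ : Unit => Glue.inl o) fun _ => k)

end

variable {r} (ht : ∀ j, r (b.space.top j) = some j) (hb : ∀ j, r (b.space.bot j) = some j)
include ht hb

/-- The labelling `r` calls the strands `some j` and the circle `none`. A strand has two endpoints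
and the circle has none, which determines `χ` by `two_smul_χ`. -/
lemma push_χ : push r b.space.χ = push some 1 := by
  have h := congrArg (push r) b.two_smul_χ
  rw [push_add, push_add, push_push, push_push] at h
  rw [show (fun a => r (b.space.top a)) = some from funext ht,
    show (fun a => r (b.space.bot a)) = some from funext hb] at h
  funext c
  have hc := congrFun h c
  simp only [Pi.add_apply] at hc
  omega

/-- Label `some j` is the boundary circle formed by the two copies of strand `j`, label `none` the
circle of `b`. -/
def birthMap : Surface.Boundary (Diagram.one m).space b.space → Option (Fin m) :=
  Glue.desc some r (by rintro (j | j); exacts [(ht j).symm, (hb j).symm])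

def deathMap : Surface.Boundary b.space (Diagram.one m).space → Option (Fin m) :=
  Glue.desc r some (by rintro (j | j); exacts [ht j, hb j])

lemma birthMap_bijective : Function.Bijective (birthMap ht hb) := by
  refine Function.bijective_iff_has_inverse.2 ⟨fun c => Glue.inr (r.symm c), ?_,
    fun c => r.apply_symm_apply c⟩
  refine Glue.ind (fun j => ?_) fun c => congrArg Glue.inr (r.symm_apply_apply c)
  change Glue.inr (r.symm (some j)) = _
  rw [← ht, r.symm_apply_apply]
  exact (Glue.sound (f := Sum.elim (Diagram.one m).space.top (Diagram.one m).space.bot)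
    (g := Sum.elim b.space.top b.space.bot) (Sum.inl j)).symm

lemma deathMap_bijective : Function.Bijective (deathMap ht hb) := by
  refine Function.bijective_iff_has_inverse.2 ⟨fun c => Glue.inl (r.symm c), ?_,
    fun c => r.apply_symm_apply c⟩
  refine Glue.ind (fun c => congrArg Glue.inl (r.symm_apply_apply c)) fun j => ?_
  change Glue.inl (r.symm (some j)) = _
  rw [← ht, r.symm_apply_apply]
  exact Glue.sound (f := Sum.elim b.space.top b.space.bot)
    (g := Sum.elim (Diagram.one m).space.top (Diagram.one m).space.bot) (Sum.inl j)

lemma deg_birth (o : b.space.Comp) (k : ℕ) : (birth b o k).deg = 2 * k - 1 := by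
  rw [birth, Cobordism.deg_disks _ (birthMap_bijective ht hb), finsum_push,
    finsum_eq_sum_of_fintype]
  simp
  omega

lemma deg_death (o : b.space.Comp) (k : ℕ) : (death b o k).deg = 2 * k - 1 := by
  rw [death, Cobordism.deg_disks _ (deathMap_bijective ht hb), finsum_push,
    finsum_eq_sum_of_fintype]
  simp
  omega

/-- The two disks on the circle close up to a sphere that collects all dots; the two disks over a
strand glue to the sheet of the identity. -/
lemma birth_death_homeo {o : b.space.Comp} (ho : r o = none) (k l : ℕ) :
    ((birth b o k).comp (death b o l)).surface.Homeo
      ((Cobordism.refl (.one m)).surface.addSphere (k + l)) := by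
  refine Surface.homeo_of_maps (S := (birth b o k).surface.comp (death b o l).surface)
    (T := (Surface.cylinder (.refl (.strands m))).addSphere (k + l))
    (Glue.desc (birthMap ht hb) (deathMap ht hb) fun _ => rfl)
    (fun c => Glue.inl (Glue.inr (r.symm c))) ?_ (fun c => r.apply_symm_apply c) (fun _ => rfl)
    (fun _ => rfl) ?_ ?_
  · have h : ∀ x, (Glue.inl (Glue.inr x) : ((birth b o k).surface.comp
        (death b o l).surface).Comp) = Glue.inr (Glue.inl x) := Glue.sound
    have h1 : ∀ j, Glue.inr (r.symm (some j)) = (Glue.inl j : (birth b o k).surface.Comp) :=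
      fun j => (birthMap_bijective ht hb).1 (r.apply_symm_apply _)
    have h2 : ∀ j, Glue.inl (r.symm (some j)) = (Glue.inr j : (death b o k).surface.Comp) :=
      fun j => (deathMap_bijective ht hb).1 (r.apply_symm_apply _)
    refine Glue.ind (Glue.ind (fun j => congrArg Glue.inl (h1 j)) fun c => ?_)
      (Glue.ind (fun c => ?_) fun j => (h _).trans (congrArg Glue.inr (h2 j)))
    · exact congrArg (fun c => Glue.inl (Glue.inr c)) (r.symm_apply_apply c)
    · exact (congrArg (fun c => Glue.inl (Glue.inr c)) (r.symm_apply_apply c)).trans (h c)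
  · simp only [Surface.comp, push_add, push_sub, push_push]
    change push (birthMap ht hb) 1 + push (deathMap ht hb) 1 - push r b.space.χ = _
    rw [push_bijective_one (birthMap_bijective ht hb),
      push_bijective_one (deathMap_bijective ht hb), push_χ ht hb, push_some]
    funext c
    cases c <;> rfl
  · simp only [Surface.comp, push_add, push_push]
    change push (birthMap ht hb) (push _ _) + push (deathMap ht hb) (push _ _) = _
    rw [push_push, push_push]
    change push (fun _ => r o) _ + push (fun _ => r o) _ = _
    classical
    rw [ho, push_unit, push_unit]
    funext c
    cases c <;> simp

lemma birth_comp_death {o : b.space.Comp} (ho : r o = none) (k l : ℕ) (h : k + l = 1) :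
    Mor.comp (Mor.of (birth b o k) 1) (Mor.of (death b o l) 1) = Mor.id (.one m) := by
  rw [Mor.comp_of, one_mul]
  have := birth_death_homeo ht hb ho k l
  rw [h] at this
  exact (Submodule.Quotient.eq _).2 (Null.sphere _ (Cobordism.refl _) 1 this)

/-- A tube between the two disks on the circle restores `circle × [0,1]`, while the two disks over a
strand are already glued along it. -/
lemma neck_homeo {o : b.space.Comp} (ho : r o = none) :
    (((death b o 0).surface.comp (birth b o 0).surface).addTube (Glue.inl (Glue.inl o))
      (Glue.inr (Glue.inr o))).Homeo (Cobordism.refl b).surface := by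
  have htb : ∀ j, b.space.top j = b.space.bot j := fun j => r.injective ((ht j).trans (hb j).symm)
  set S := (death b o 0).surface.comp (birth b o 0).surface with hS
  let p : Surface.Boundary b.space (Diagram.one m).space → b.space.Comp := Glue.desc (fun x => x) b.space.top (by
    rintro (j | j); exacts [rfl, (htb j).symm])
  let p' : Surface.Boundary (Diagram.one m).space b.space → b.space.Comp := Glue.desc b.space.top (fun x => x) (by
    rintro (j | j); exacts [rfl, htb j])
  let f : (S.addTube (Glue.inl (Glue.inl o)) (Glue.inr (Glue.inr o))).Comp → b.space.Comp :=
    Quot.lift (Glue.desc p p' fun j => rfl) (by rintro _ _ ⟨rfl, rfl⟩; rfl)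
  have h1 : ∀ j, (Glue.inl (b.space.top j) : (death b o 0).surface.Comp) = Glue.inr j :=
    fun j => Glue.sound (f := Sum.elim b.space.top b.space.bot)
      (g := Sum.elim (Diagram.one m).space.top (Diagram.one m).space.bot) (Sum.inl j)
  have h2 : ∀ j, (Glue.inl j : (birth b o 0).surface.Comp) = Glue.inr (b.space.top j) :=
    fun j => Glue.sound (f := Sum.elim (Diagram.one m).space.top (Diagram.one m).space.bot)
      (g := Sum.elim b.space.top b.space.bot) (Sum.inl j)
  have h3 : ∀ j, (Glue.inl (Glue.inr j) : S.Comp) = Glue.inr (Glue.inl j) := Glue.sound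
  have hj : ∀ j, (Glue.inl (Glue.inl (b.space.top j)) : S.Comp) =
      Glue.inr (Glue.inr (b.space.top j)) := fun j => by rw [← h2, ← h3, ← h1]
  refine Surface.homeo_of_maps (T := Surface.cylinder (.refl b.space)) f
    (fun x => Quot.mk _ (Glue.inl (Glue.inl x))) ?_ (fun _ => rfl) (fun _ => rfl) (fun _ => rfl)
    ?_ ?_
  · rintro ⟨c⟩
    revert c
    refine Glue.ind (Glue.ind (fun c => rfl) fun j => ?_) (Glue.ind (fun j => ?_) fun x => ?_)
    · exact congrArg (fun z => Quot.mk _ (Glue.inl z)) (h1 j)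
    · exact congrArg (fun z => Quot.mk _ z) ((hj j).trans (congrArg Glue.inr (h2 j).symm))
    · change Quot.mk _ (Glue.inl (Glue.inl x)) = Quot.mk _ (Glue.inr (Glue.inr x))
      cases h : r x with
      | none =>
        obtain rfl : x = o := r.injective (h.trans ho.symm)
        exact Quot.sound ⟨rfl, rfl⟩
      | some j =>
        obtain rfl : x = b.space.top j := r.injective (h.trans (ht j).symm)
        exact congrArg (fun z => Quot.mk _ z) (hj j)
  · simp only [Surface.addTube, Surface.comp, push_add, push_sub, push_push]
    change push p 1 + push p' 1 - push b.space.top 1 - push (fun _ : Unit => o) 2 = b.space.χ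
    have hp : (fun c => r (p c)) = deathMap ht hb := funext (Glue.ind (fun _ => rfl) fun j => ht j)
    have hp' : (fun c => r (p' c)) = birthMap ht hb := funext (Glue.ind (fun j => ht j) fun _ => rfl)
    -- Compared after labelling by `r`: over a strand, two disks minus the gluing arc give `1`; over
    -- the circle, two disks minus the `2` of the tube give `0`.
    have key : push r (push p 1 + push p' 1 - push b.space.top 1 - push (fun _ : Unit => o) 2) =
        push r b.space.χ := by
      classical
      simp only [push_add, push_sub, push_push]
      rw [hp, hp', push_bijective_one (birthMap_bijective ht hb), show (fun a => r (b.space.top a)) = some from funext ht,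
        push_bijective_one (deathMap_bijective ht hb), push_χ ht hb, push_some, ho]
      change 1 + 1 - _ - push _ (fun _ => 2) = _
      rw [push_unit]
      funext c
      cases c <;> simp
    funext c
    rw [← push_equiv r (push p 1 + push p' 1 - push b.space.top 1 - push (fun _ : Unit => o) 2) c,
      key, push_equiv]
  · simp only [Surface.addTube, Surface.comp, push_add, push_push]
    change push p (push _ fun _ => 0) + push p' (push _ fun _ => 0) = 0
    classical
    rw [push_push, push_push, push_unit, push_unit, Pi.single_zero, Pi.single_zero, add_zero]

/-- This is neck cutting: by `neck_homeo` the identity has a tube between the components `cl` and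
`cr`, so it is the sum of the surfaces with a dot on one of them. -/
lemma death_comp_birth {o : b.space.Comp} (ho : r o = none) :
    Mor.comp (Mor.of (death b o 1) 1) (Mor.of (birth b o 0) 1) +
      Mor.comp (Mor.of (death b o 0) 1) (Mor.of (birth b o 1) 1) = Mor.id b := by
  classical
  rw [Mor.comp_of, Mor.comp_of, one_mul]
  let S := (death b o 0).surface.comp (birth b o 0).surface
  obtain ⟨cl, hcl⟩ : ∃ c : S.Comp, c = Glue.inl (Glue.inl o) := ⟨_, rfl⟩
  obtain ⟨cr, hcr⟩ : ∃ c : S.Comp, c = Glue.inr (Glue.inr o) := ⟨_, rfl⟩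
  have hd : ∀ k l, ((death b o k).comp (birth b o l)).surface.dots =
      (Pi.single cl k + Pi.single cr l : S.Comp → ℕ) := by
    intro k l
    have h1 : push (Glue.inl : Surface.Boundary b.space (Diagram.one m).space → S.Comp)
        (push (fun _ : Unit => Glue.inl o) fun _ => k) = Pi.single cl k := by
      rw [push_push, push_unit, hcl]; rfl
    have h2 : push (Glue.inr : Surface.Boundary (Diagram.one m).space b.space → S.Comp)
        (push (fun _ : Unit => Glue.inr o) fun _ => l) = Pi.single cr l := by
      rw [push_push, push_unit, hcr]; rfl
    exact congrArg₂ (fun x y : S.Comp → ℕ => x + y) h1 h2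
  have hS : S.dots = 0 := (hd 0 0).trans (by rw [Pi.single_zero, Pi.single_zero, add_zero])
  refine ((Submodule.Quotient.eq _).2 ?_).symm
  have h := Null.neck (Cobordism.refl b) ((death b o 1).comp (birth b o 0))
    ((death b o 0).comp (birth b o 1)) S cl cr
    (by rw [hcl, hcr]; exact (neck_homeo ht hb ho).symm)
    ⟨Equiv.refl S.Comp, fun _ => rfl, fun _ => rfl, fun _ => rfl, fun c => ?_⟩
    ⟨Equiv.refl S.Comp, fun _ => rfl, fun _ => rfl, fun _ => rfl, fun c => ?_⟩
  · rw [sub_sub] at h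
    exact h
  · change (S.dots + Pi.single cl 1 : S.Comp → ℕ) c = _
    rw [hS, zero_add]
    refine Eq.trans ?_ (congrFun (hd 1 0) c).symm
    rw [Pi.single_zero, add_zero]
  · change (S.dots + Pi.single cr 1 : S.Comp → ℕ) c = _
    rw [hS, zero_add]
    refine Eq.trans ?_ (congrFun (hd 0 1) c).symm
    rw [Pi.single_zero, zero_add]

end Deloop

/-! ### Components of a cap above its reflection -/

namespace Diagram

/-- The components of the disjoint union of a circle with `n - 2` strands. -/
def capCupComp (n i : ℕ) (h : i + 2 ≤ n) :
    ((cap n i h).stack (cup n i h)).space.Comp ≃ Option (Fin (n - 2)) :=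
  let u : Fin (n - 1) → Option (Fin (n - 2)) := fun x =>
    if hx : (x : ℕ) = i then none
    else some ⟨if (x : ℕ) < i then x else x - 1, by split_ifs <;> omega⟩
  have hl : ∀ x, (u x).elim (Glue.inl (⟨i, by omega⟩ : Fin (n - 1)))
      (fun t => Glue.inl ((cap n i h).space.top t)) =
      (Glue.inl x : ((cap n i h).stack (cup n i h)).space.Comp) := fun x => by
    simp only [u]
    by_cases hx : (x : ℕ) = i
    · rw [dif_pos hx]
      exact congrArg Glue.inl (Fin.ext hx.symm)
    · rw [dif_neg hx]
      exact congrArg Glue.inl (Fin.ext (by simp only; split_ifs <;> omega))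
  { toFun := Glue.desc u u fun _ => rfl
    invFun := fun c => c.elim (Glue.inl (⟨i, by omega⟩ : Fin (n - 1)))
      (fun t => Glue.inl ((cap n i h).space.top t))
    left_inv := Glue.ind hl fun y => (hl y).trans <| by
      obtain ⟨p, hp⟩ : ∃ p, (cap n i h).space.bot p = y :=
        ⟨⟨if (y : ℕ) ≤ i then y else y + 1, by split_ifs <;> omega⟩,
          Fin.ext (by simp only; split_ifs <;> omega)⟩
      rw [← hp]
      exact Glue.sound p
    right_inv := fun c => by
      cases c with
      | none =>
        change u _ = none
        simp only [u]
        rw [dif_pos trivial]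
      | some t =>
        change u _ = some t
        simp only [u]
        rw [dif_neg (by split_ifs <;> omega)]
        exact congrArg some (Fin.ext (by simp only; split_ifs <;> omega)) }

lemma capCupComp_top (n i : ℕ) (h : i + 2 ≤ n) (j : Fin (n - 2)) :
    capCupComp n i h (((cap n i h).stack (cup n i h)).space.top j) = some j :=
  (capCupComp n i h).apply_symm_apply (some j)

lemma capCupComp_bot (n i : ℕ) (h : i + 2 ≤ n) (j : Fin (n - 2)) :
    capCupComp n i h (((cap n i h).stack (cup n i h)).space.bot j) = some j :=
  capCupComp_top n i h j

lemma capCupComp_circle (n i : ℕ) (h : i + 2 ≤ n) :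
    capCupComp n i h (Glue.inl (⟨i, by omega⟩ : Fin (n - 1))) = none :=
  (capCupComp n i h).apply_symm_apply none

/-- Counting endpoints does not require `φ` to be bijective: by `two_smul_χ`, twice either side is
the number of endpoints over each component of `b`. -/
lemma push_χ_eq {m n : ℕ} {a b : Diagram m n} (φ : a.space.Comp → b.space.Comp)
    (ht : ∀ j, φ (a.space.top j) = b.space.top j) (hb : ∀ j, φ (a.space.bot j) = b.space.bot j) :
    push φ a.space.χ = b.space.χ := by
  have h := congrArg (push φ) a.two_smul_χ
  rw [push_add, push_add, push_push, push_push,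
    show (fun j => φ (a.space.top j)) = b.space.top from funext ht,
    show (fun j => φ (a.space.bot j)) = b.space.bot from funext hb, ← b.two_smul_χ] at h
  funext c
  have hc := congrFun h c
  simp only [Pi.add_apply] at hc
  omega

end Diagram

/-! ### The zigzag relation between birth and saddle -/

namespace Surface

variable {m n : ℕ} {X Y Z : OneManifold m n}

lemma push_stack_χ {k : ℕ} {X X' : OneManifold m k} {Y Y' : OneManifold k n} (S : Surface X X')
    (T : Surface Y Y') {K : Type} (q : (S.stack T).Comp → K) :
    push q (S.stack T).χ = push (fun c => q (Glue.inl c)) S.χ +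
      push (fun c => q (Glue.inr c)) T.χ - push (fun j => q (Glue.inl (S.src (X.bot j)))) 1 := by
  simp only [stack, push_add, push_sub, push_push]

lemma push_stack_dots {k : ℕ} {X X' : OneManifold m k} {Y Y' : OneManifold k n} (S : Surface X X')
    (T : Surface Y Y') {K : Type} (q : (S.stack T).Comp → K) :
    push q (S.stack T).dots = push (fun c => q (Glue.inl c)) S.dots +
      push (fun c => q (Glue.inr c)) T.dots := by
  simp only [stack, push_add, push_push]

lemma tgt_comp_surjective {S : Surface X Y} {T : Surface Y Z} (hS : Function.Surjective S.tgt)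
    (hT : Function.Surjective T.tgt) : Function.Surjective (S.comp T).tgt := by
  refine Glue.ind (fun c => ?_) fun c => ?_
  · obtain ⟨y, rfl⟩ := hS c
    obtain ⟨z, hz⟩ := hT (T.src y)
    refine ⟨z, (congrArg Glue.inr hz).trans (Glue.sound y).symm⟩
  · obtain ⟨z, rfl⟩ := hT c
    exact ⟨z, rfl⟩

lemma tgt_cylinder_surjective (e : X.Homeo Y) : Function.Surjective (cylinder e).tgt :=
  fun y => ⟨y, rfl⟩

/-- When every component reaches the target, `S.tgt` is inverse to `f`. No inverse has to be written
out on an iterated gluing. -/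
lemma homeo_cylinder {S : Surface X X} (hS : Function.Surjective S.tgt) (f : S.Comp → X.Comp)
    (hs : ∀ x, f (S.src x) = x) (ht : ∀ x, f (S.tgt x) = x) (hχ : push f S.χ = X.χ)
    (hd : push f S.dots = 0) : S.Homeo (cylinder (.refl X)) :=
  homeo_of_maps f S.tgt (fun c => by obtain ⟨x, rfl⟩ := hS c; rw [ht]) ht hs ht hχ hd

end Surface

namespace Zigzag

open Diagram

variable (n i : ℕ) (h : i + 2 ≤ n)

lemma bot_surjective : Function.Surjective (cap n i h).space.bot := fun y =>
  ⟨⟨if (y : ℕ) ≤ i then y else y + 1, by split_ifs <;> omega⟩,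
    Fin.ext (by simp only; split_ifs <;> omega)⟩

/-- The birth of a circle between a cap and a cup. -/
def unit : Cobordism (one (n - 2)) ((cap n i h).stack (cup n i h)) :=
  .disks _ _ 0

/-- The saddle between a cup and a cap. -/
def counit : Cobordism ((cup n i h).stack (cap n i h)) (one n) := .disks _ _ 0

/-- Each boundary circle contains exactly one component of the cap, so these components number the
disks. -/
def unitMap : Surface.Boundary (one (n - 2)).space ((cap n i h).stack (cup n i h)).space →
    (cap n i h).space.Comp :=
  Glue.desc (cap n i h).space.top (Glue.desc id id fun _ => rfl) (by rintro (j | j) <;> rfl)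

def counitMap : Surface.Boundary ((cup n i h).stack (cap n i h)).space (one n).space →
    (cap n i h).space.Comp :=
  Glue.desc (Glue.desc id id fun _ => rfl) (cap n i h).space.bot (by rintro (j | j) <;> rfl)

lemma unitMap_bijective : Function.Bijective (unitMap n i h) := by
  refine Function.bijective_iff_has_inverse.2 ⟨fun x => Glue.inr (Glue.inl x), ?_, fun _ => rfl⟩
  refine Glue.ind (fun j => ?_) (Glue.ind (fun _ => rfl) fun x => ?_)
  · exact (Glue.sound (f := Sum.elim (one (n - 2)).space.top (one (n - 2)).space.bot)
      (g := Sum.elim ((cap n i h).stack (cup n i h)).space.top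
        ((cap n i h).stack (cup n i h)).space.bot) (Sum.inl j)).symm
  · obtain ⟨p, rfl⟩ := bot_surjective n i h x
    exact congrArg Glue.inr (Glue.sound p)

lemma counitMap_bijective : Function.Bijective (counitMap n i h) := by
  have hp : ∀ p, (Glue.inl (Glue.inl ((cap n i h).space.bot p)) :
      Surface.Boundary ((cup n i h).stack (cap n i h)).space (one n).space) = Glue.inr p :=
    fun p => Glue.sound (f := Sum.elim ((cup n i h).stack (cap n i h)).space.top
        ((cup n i h).stack (cap n i h)).space.bot)
      (g := Sum.elim (one n).space.top (one n).space.bot) (Sum.inl p)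
  refine Function.bijective_iff_has_inverse.2 ⟨fun x => Glue.inl (Glue.inl x), ?_, fun _ => rfl⟩
  refine Glue.ind (Glue.ind (fun _ => rfl) fun x => ?_) hp
  obtain ⟨p, rfl⟩ := bot_surjective n i h x
  exact (hp p).trans (Glue.sound (f := Sum.elim ((cup n i h).stack (cap n i h)).space.top
        ((cup n i h).stack (cap n i h)).space.bot)
      (g := Sum.elim (one n).space.top (one n).space.bot) (Sum.inr p)).symm

/-- There are `n - 1` disks, and half the number of endpoints is `n - 2`. For the saddle it is `n`,
so that degree is `1`. -/
lemma deg_unit : (unit n i h).deg = -1 := by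
  rw [unit, Cobordism.deg_disks 0 (unitMap_bijective n i h), Fintype.card_fin]
  simp
  omega

lemma deg_counit : (counit n i h).deg = 1 := by
  rw [counit, Cobordism.deg_disks 0 (counitMap_bijective n i h), Fintype.card_fin]
  simp
  omega

/-- A map from the components of a surface without dots to those of a diagram that is compatible
with the endpoints. -/
structure Over {m n : ℕ} {x y : Diagram m n} (a : Diagram m n) (S : Surface x.space y.space) where
  f : S.Comp → a.space.Comp
  top : ∀ j, f (S.tgt (y.space.top j)) = a.space.top j
  bot : ∀ j, f (S.tgt (y.space.bot j)) = a.space.bot j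
  surj : Function.Surjective S.tgt
  dots : push f S.dots = 0

namespace Over

variable {m n : ℕ} {x y z a : Diagram m n} {S : Surface x.space y.space}
  {T : Surface y.space z.space}

def comp (F : Over a S) (G : Over a T) (hFG : ∀ c, F.f (S.tgt c) = G.f (T.src c)) :
    Over a (S.comp T) where
  f := Glue.desc F.f G.f hFG
  top := G.top
  bot := G.bot
  surj := Surface.tgt_comp_surjective F.surj G.surj
  dots := by
    simp only [Surface.comp, push_add, push_push]
    exact (congrArg₂ _ F.dots G.dots).trans (add_zero _)

/-- The gluing locus maps to `a` compatibly with endpoints, so by `push_χ_eq` it contributes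
`a.space.χ` whatever `y` is. -/
lemma comp_χ (F : Over a S) (G : Over a T) (hFG : ∀ c, F.f (S.tgt c) = G.f (T.src c)) :
    push (F.comp G hFG).f (S.comp T).χ = push F.f S.χ + push G.f T.χ - a.space.χ := by
  have h := push_χ_eq (fun c => F.f (S.tgt c)) F.top F.bot
  rw [← h]
  simp only [Surface.comp, push_add, push_sub, push_push]
  rfl

def cylinder (e : x.space.Homeo y.space) (f : y.space.Comp → a.space.Comp)
    (top : ∀ j, f (y.space.top j) = a.space.top j) (bot : ∀ j, f (y.space.bot j) = a.space.bot j) :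
    Over a (Surface.cylinder e) :=
  ⟨f, top, bot, Surface.tgt_cylinder_surjective e, push_zero f⟩

end Over

def unitSurface : Surface ((one (n - 2)).stack (cap n i h)).space
    (((cap n i h).stack (cup n i h)).stack (cap n i h)).space :=
  ((unit n i h).stack (.refl (cap n i h))).surface

def counitSurface : Surface ((cap n i h).stack ((cup n i h).stack (cap n i h))).space
    ((cap n i h).stack (one n)).space :=
  (Cobordism.stack (.refl (cap n i h)) (counit n i h)).surface

def overUnit : Over (cap n i h) (unitSurface n i h) where
  f := Glue.desc (unitMap n i h) id fun _ => rfl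
  top _ := rfl
  bot _ := rfl
  surj := by
    refine Glue.ind (fun c => ?_) fun c => ⟨Glue.inr c, rfl⟩
    have hx : c = Glue.inr (Glue.inl (unitMap n i h c)) := (unitMap_bijective n i h).1 rfl
    exact ⟨Glue.inl (Glue.inl (unitMap n i h c)), congrArg Glue.inl hx.symm⟩
  dots := (Surface.push_stack_dots _ _ _).trans
    ((congrArg₂ _ (push_zero _) (push_zero _)).trans (add_zero _))

def overCounit : Over (cap n i h) (counitSurface n i h) where
  f := Glue.desc id (counitMap n i h) fun _ => rfl
  top _ := rfl
  bot _ := rfl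
  surj := by
    refine Glue.ind (fun c => ⟨Glue.inl c, rfl⟩) fun c => ?_
    obtain ⟨p, hp⟩ := bot_surjective n i h (counitMap n i h c)
    exact ⟨Glue.inr p, congrArg Glue.inr ((counitMap_bijective n i h).1 hp)⟩
  dots := (Surface.push_stack_dots _ _ _).trans
    ((congrArg₂ _ (push_zero _) (push_zero _)).trans (add_zero _))

lemma overUnit_χ : push (overUnit n i h).f (unitSurface n i h).χ =
    1 + (cap n i h).space.χ - push (cap n i h).space.top 1 := by
  refine (Surface.push_stack_χ _ _ _).trans ?_
  change push (unitMap n i h) 1 + push (fun x => x) (cap n i h).space.χ -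
    push (cap n i h).space.top 1 = _
  rw [push_bijective_one (unitMap_bijective n i h), push_id]

lemma overCounit_χ : push (overCounit n i h).f (counitSurface n i h).χ =
    (cap n i h).space.χ + 1 - push (cap n i h).space.bot 1 := by
  refine (Surface.push_stack_χ _ _ _).trans ?_
  change push (fun x => x) (cap n i h).space.χ + push (counitMap n i h) 1 -
    push (cap n i h).space.bot 1 = _
  rw [push_bijective_one (counitMap_bijective n i h), push_id]

def overLeftUnit : Over (cap n i h) (Surface.cylinder (leftUnit (cap n i h)).symm) :=
  .cylinder _ (Glue.desc (cap n i h).space.top id fun _ => rfl) (fun _ => rfl) fun _ => rfl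

def overRightUnit : Over (cap n i h) (Surface.cylinder (rightUnit (cap n i h))) :=
  .cylinder _ id (fun _ => rfl) fun _ => rfl

def overAssoc : Over (cap n i h)
    (Surface.cylinder (assoc (cap n i h) (cup n i h) (cap n i h))) :=
  .cylinder _ (Glue.desc id (Glue.desc id id fun _ => rfl) fun _ => rfl) (fun _ => rfl)
    fun _ => rfl

def over₁ := (overCounit n i h).comp (overRightUnit n i h)
  (Glue.ind (fun _ => rfl) fun _ => rfl)

def over₂ := (overAssoc n i h).comp (over₁ n i h)
  (Glue.ind (fun _ => rfl) (Glue.ind (fun _ => rfl) fun _ => rfl))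

def over₃ := (overUnit n i h).comp (over₂ n i h)
  (Glue.ind (Glue.ind (fun _ => rfl) fun _ => rfl) fun _ => rfl)

def over₄ := (overLeftUnit n i h).comp (over₃ n i h) (Glue.ind (fun _ => rfl) fun _ => rfl)

/-- All five pieces map compatibly to the components of the cap, and each component of the composite
reaches the target, so only the Euler characteristic needs a computation. -/
lemma zigzag_homeo : ((Cobordism.cylinder (leftUnit (cap n i h)).symm).comp
    (((unit n i h).stack (.refl (cap n i h))).comp
      ((Cobordism.cylinder (assoc (cap n i h) (cup n i h) (cap n i h))).comp
        ((Cobordism.stack (.refl (cap n i h)) (counit n i h)).comp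
          (Cobordism.cylinder (rightUnit (cap n i h))))))).surface.Homeo
      (Cobordism.refl (cap n i h)).surface := by
  refine Surface.homeo_cylinder (over₄ n i h).surj (over₄ n i h).f (fun _ => rfl) (fun _ => rfl)
    ?_ (over₄ n i h).dots
  refine (Over.comp_χ _ _ _).trans ?_
  rw [over₃, Over.comp_χ, over₂, Over.comp_χ, over₁, Over.comp_χ, overUnit_χ, overCounit_χ]
  have e1 : push (overLeftUnit n i h).f (Surface.cylinder (leftUnit (cap n i h)).symm).χ =
    (cap n i h).space.χ := push_χ_eq (a := (one (n - 2)).stack (cap n i h)) _ (fun _ => rfl) fun _ => rfl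
  have e2 : push (overAssoc n i h).f
    (Surface.cylinder (assoc (cap n i h) (cup n i h) (cap n i h))).χ =
    (cap n i h).space.χ := push_χ_eq (a := (cap n i h).stack ((cup n i h).stack (cap n i h))) _ (fun _ => rfl) fun _ => rfl
  have e3 : push (overRightUnit n i h).f (Surface.cylinder (rightUnit (cap n i h))).χ =
    (cap n i h).space.χ := push_χ_eq (a := cap n i h) _ (fun _ => rfl) fun _ => rfl
  rw [e1, e2, e3]
  have := (cap n i h).two_smul_χ
  have hone : (cap n i h).space.χ = 1 := rfl
  -- Five pieces and four gluings give `2 + χ` minus the number of endpoints, that is `2 - χ`, which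
  -- is `χ` because every component is an arc.
  linear_combination this - 2 * hone

end Zigzag

/-! ### Degrees of stacked morphisms -/

namespace Mor

variable {m k l n : ℕ}

lemma of_mem_homogeneous {a b : Diagram m n} (V : Cobordism a b) {d : ℤ} (h : V.deg = d) :
    of V 1 ∈ homogeneous a b d :=
  AddSubgroup.subset_closure ⟨V, 0, by simpa using h, by rw [pow_zero]⟩

/-- Gluing along `k` segments lowers the Euler characteristic by `k`; the halves of the shared
endpoints, counted in both summands, compensate. `two_mul_sum_χ` supplies the parity for the
divisions by two. -/
lemma deg_stack {a a' : Diagram m k} {b b' : Diagram k n} (V : Cobordism a a')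
    (W : Cobordism b b') : (V.stack W).deg = V.deg + W.deg := by
  have h1 : ∑ᶠ x, (V.stack W).surface.χ x =
      ∑ᶠ x, V.surface.χ x + ∑ᶠ x, W.surface.χ x - k := by
    simp only [Pi.add_apply, Pi.sub_apply]
    rw [finsum_sub_distrib (Set.toFinite _) (Set.toFinite _),
      finsum_add_distrib (Set.toFinite _) (Set.toFinite _), finsum_push, finsum_push, finsum_push]
    simp [finsum_eq_sum_of_fintype]
  have h2 : ∑ᶠ x, (V.stack W).surface.dots x =
      ∑ᶠ x, V.surface.dots x + ∑ᶠ x, W.surface.dots x := by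
    simp only [Pi.add_apply]
    rw [finsum_add_distrib (Set.toFinite _) (Set.toFinite _), finsum_push, finsum_push]
  have h3 : ∀ {m n : ℕ} {a b : Diagram m n} (W : Cobordism a b),
      ∑ᶠ x, (W.surface.dots x : ℤ) = ((∑ᶠ x, W.surface.dots x : ℕ) : ℤ) := fun W =>
    ((Nat.castAddMonoidHom ℤ).map_finsum (Set.toFinite _)).symm
  have ha := a.two_mul_sum_χ
  have hb := b.two_mul_sum_χ
  unfold Cobordism.deg
  rw [h3, h3, h3, h1, h2]
  push_cast
  omega

lemma stack_mem_homogeneous {a a' : Diagram m k} {b b' : Diagram k n} {x : Mor a a'}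
    {y : Mor b b'} {d e : ℤ} (hx : x ∈ homogeneous a a' d) (hy : y ∈ homogeneous b b' e) :
    stack x y ∈ homogeneous (a.stack b) (a'.stack b') (d + e) := by
  induction hx using AddSubgroup.closure_induction with
  | zero => simp [zero_mem]
  | add x x' _ _ h h' => rw [map_add, LinearMap.add_apply]; exact add_mem h h'
  | neg x _ h => rw [map_neg, LinearMap.neg_apply]; exact neg_mem h
  | mem x hx =>
    obtain ⟨V, i, hV, rfl⟩ := hx
    induction hy using AddSubgroup.closure_induction with
    | zero => simp [zero_mem]
    | add x x' _ _ h h' => rw [map_add]; exact add_mem h h'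
    | neg x _ h => rw [map_neg]; exact neg_mem h
    | mem y hy =>
      obtain ⟨W, j, hW, rfl⟩ := hy
      refine AddSubgroup.subset_closure ⟨V.stack W, i + j, ?_, ?_⟩
      · rw [deg_stack]; push_cast; linarith
      · rw [stack_of, pow_add]

lemma id_mem_homogeneous (a : Diagram m n) : id a ∈ homogeneous a a 0 :=
  cyl_mem_homogeneous (OneManifold.Homeo.refl a.space)

lemma comp_stack_id {a a' a'' : Diagram m k} (b : Diagram k n) (x : Mor a a') (y : Mor a' a'') :
    stack (comp x y) (id b) = comp (stack x (id b)) (stack y (id b)) := by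
  rw [← stack_comp, id_comp]

lemma id_stack_comp (a : Diagram m k) {b b' b'' : Diagram k n} (x : Mor b b') (y : Mor b' b'') :
    stack (id a) (comp x y) = comp (stack (id a) x) (stack (id a) y) := by
  rw [← stack_comp, id_comp]

end Mor

/-! ### The saddle as a natural map with a section -/

namespace Zigzag

open Diagram Mor

variable {m : ℕ} (n i : ℕ) (h : i + 2 ≤ n)

/-- The saddle from `d` with a cup and a cap below to `d`. -/
def fold (d : Diagram m n) : Mor ((d.stack (cup n i h)).stack (cap n i h)) d :=
  comp (cyl (assoc d (cup n i h) (cap n i h)))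
    (comp (stack (id d) (of (counit n i h) 1)) (cyl (rightUnit d)))

/-- The morphism `x` and the saddle live on different factors of the stack, so they commute by the
interchange law. -/
lemma fold_naturality {d d' : Diagram m n} (x : Mor d d') :
    comp (stack (stack x (id (cup n i h))) (id (cap n i h))) (fold n i h d') =
      comp (fold n i h d) x := by
  rw [fold, ← comp_assoc, assoc_naturality, stack_id, fold]
  simp only [comp_assoc]
  rw [← rightUnit_naturality, ← comp_assoc (stack _ _) (stack _ _), ← stack_comp, id_comp,
    ← comp_assoc (stack _ _) (stack _ _), ← stack_comp, id_comp, comp_id, comp_id]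

lemma fold_mem_homogeneous (d : Diagram m n) : fold n i h d ∈ homogeneous _ d 1 := by
  have := comp_mem_homogeneous (cyl_mem_homogeneous (assoc d (cup n i h) (cap n i h)))
    (comp_mem_homogeneous (stack_mem_homogeneous (id_mem_homogeneous d)
      (of_mem_homogeneous _ (deg_counit n i h))) (cyl_mem_homogeneous (rightUnit d)))
  exact this

lemma zigzag : comp (cyl (leftUnit (cap n i h)).symm)
    (comp (stack (of (unit n i h) 1) (id (cap n i h)))
      (comp (cyl (assoc (cap n i h) (cup n i h) (cap n i h)))
        (comp (stack (id (cap n i h)) (of (counit n i h) 1)) (cyl (rightUnit (cap n i h)))))) =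
    Mor.id (cap n i h) := by
  simp only [cyl, Mor.id, comp_of, stack_of, one_mul]
  exact of_eq (zigzag_homeo n i h) 1

/-- A section of `fold`. -/
def unfold (c : Diagram m (n - 2)) : Mor (c.stack (cap n i h))
    (((c.stack (cap n i h)).stack (cup n i h)).stack (cap n i h)) :=
  comp (stack (id c) (comp (cyl (leftUnit (cap n i h)).symm)
    (stack (of (unit n i h) 1) (id (cap n i h)))))
    (cyl (((assoc c ((cap n i h).stack (cup n i h)) (cap n i h)).symm).trans
      (stackHomeo (assoc c (cap n i h) (cup n i h)).symm (.refl _))))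

/-- Coherence of the reassociations extracts the common top factor `c` and leaves `zigzag` below it.
-/
lemma unfold_fold (c : Diagram m (n - 2)) :
    comp (unfold n i h c) (fold n i h (c.stack (cap n i h))) = Mor.id (c.stack (cap n i h)) := by
  have h1 : cyl (rightUnit (c.stack (cap n i h))) = comp (cyl (assoc c (cap n i h) (one n)))
      (stack (id c) (cyl (rightUnit (cap n i h)))) := by
    rw [← cyl_refl, cyl_stack, cyl_comp]
    congr 1
    refine OneManifold.Homeo.ext (Glue.ind (Glue.ind (fun _ => rfl) fun _ => rfl) fun _ => ?_)
    rfl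
  have h2 : cyl (((((assoc c ((cap n i h).stack (cup n i h)) (cap n i h)).symm).trans
      (stackHomeo (assoc c (cap n i h) (cup n i h)).symm (.refl _))).trans
      (assoc (c.stack (cap n i h)) (cup n i h) (cap n i h))).trans
        (assoc c (cap n i h) ((cup n i h).stack (cap n i h)))) =
      stack (id c) (cyl (assoc (cap n i h) (cup n i h) (cap n i h))) := by
    rw [← cyl_refl, cyl_stack]
    congr 1
    exact OneManifold.Homeo.ext (Glue.ind (fun _ => rfl)
      (Glue.ind (Glue.ind (fun _ => rfl) fun _ => rfl) fun _ => rfl))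
  have h3 : stack (id (c.stack (cap n i h))) (of (counit n i h) 1) =
      stack (stack (id c) (id (cap n i h))) (of (counit n i h) 1) := by rw [stack_id]
  rw [fold, h1, h3, ← comp_assoc (stack _ _) (cyl _), assoc_naturality, unfold]
  simp only [comp_assoc]
  rw [← comp_assoc (cyl _) (cyl _), cyl_comp, ← comp_assoc (cyl _) (cyl _), cyl_comp, h2]
  simp only [← id_stack_comp, comp_assoc]
  rw [zigzag, stack_id]

lemma unfold_mem_homogeneous (c : Diagram m (n - 2)) :
    unfold n i h c ∈ homogeneous (c.stack (cap n i h)) _ (-1) := by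
  have := comp_mem_homogeneous (stack_mem_homogeneous (id_mem_homogeneous c)
    (comp_mem_homogeneous (cyl_mem_homogeneous (leftUnit (cap n i h)).symm)
      (stack_mem_homogeneous (of_mem_homogeneous _ (deg_unit n i h))
        (id_mem_homogeneous (cap n i h)))))
    (cyl_mem_homogeneous (((assoc c ((cap n i h).stack (cup n i h)) (cap n i h)).symm).trans
      (stackHomeo (assoc c (cap n i h) (cup n i h)).symm (.refl _))))
  exact this

end Zigzag

/-! ### Decomposition of diagrams into normal forms -/

section Normal

variable {m k n : ℕ}

/-- Cups, one below the other. -/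
inductive CupWord {m : ℕ} : ∀ {n : ℕ}, Diagram m n → Prop
  | one : CupWord (.one m)
  | cup {n : ℕ} {a : Diagram m n} (i : ℕ) (h : i + 2 ≤ n) (ha : CupWord a) :
      CupWord (a.stack (.cup n i h))

/-- Cups, and caps below them. -/
inductive NormalForm {m : ℕ} : ∀ {n : ℕ}, Diagram m n → Prop
  | cups {n : ℕ} {a : Diagram m n} (ha : CupWord a) : NormalForm a
  | cap {n : ℕ} (i : ℕ) (h : i + 2 ≤ n) {a : Diagram m (n - 2)} (ha : NormalForm a) :
      NormalForm (a.stack (.cap n i h))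

lemma CupWord.le {a : Diagram m n} (ha : CupWord a) : n ≤ m := by
  induction ha with
  | one => rfl
  | cup i h ha ih => omega

/-- Each cup lowers the number of endpoints, so `n = m` leaves the empty word. The equality is
heterogeneous since `n` is an index of the type. -/
lemma CupWord.heq_one {a : Diagram m n} (ha : CupWord a) (h : n = m) : a ≍ Diagram.one m := by
  cases ha with
  | one => rfl
  | cup i h ha => have := ha.le; omega

namespace Cob

lemma IsHomogeneous.comp {X Y Z : Cob m n} {d e : ℤ} {f : X ⟶ Y} {g : Y ⟶ Z}
    (hf : IsHomogeneous d f) (hg : IsHomogeneous e g) : IsHomogeneous (d + e) (f ≫ g) := by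
  have h := Mor.comp_mem_homogeneous hf hg
  rwa [show d - (Y.shift - X.shift) + (e - (Z.shift - Y.shift)) =
    d + e - (Z.shift - X.shift) by ring] at h

lemma isHomogeneous_id (X : Cob m n) : IsHomogeneous 0 (𝟙 X) := by
  have h := Mor.id_mem_homogeneous X.diagram
  rwa [show (0 : ℤ) = 0 - (X.shift - X.shift) by ring] at h

lemma IsHomogeneous.stackBelow {X Y : Cob m k} {d : ℤ} {f : X ⟶ Y} (hf : IsHomogeneous d f)
    (b : Diagram k n) : IsHomogeneous d ((stackBelow b).map f) := by
  have h := Mor.stack_mem_homogeneous hf (Mor.id_mem_homogeneous b)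
  rwa [add_zero] at h

/-- A direct sum of diagrams in normal form. -/
inductive Decomposable : Cob m n → Prop
  | normal {X : Cob m n} (h : NormalForm X.diagram) : Decomposable X
  | iso {X Y : Cob m n} (f : X ⟶ Y) (g : Y ⟶ X) (hf : IsHomogeneous 0 f) (hg : IsHomogeneous 0 g)
      (hfg : f ≫ g = 𝟙 X) (hgf : g ≫ f = 𝟙 Y) (h : Decomposable Y) : Decomposable X
  | sum {X Y Z : Cob m n} (f : X ⟶ Y) (g : Y ⟶ X) (f' : X ⟶ Z) (g' : Z ⟶ X)
      (hf : IsHomogeneous 0 f) (hg : IsHomogeneous 0 g)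
      (hf' : IsHomogeneous 0 f') (hg' : IsHomogeneous 0 g')
      (hgf : g ≫ f = 𝟙 Y) (hgf' : g' ≫ f' = 𝟙 Z) (hfg : f ≫ g + f' ≫ g' = 𝟙 X)
      (h : Decomposable Y) (h' : Decomposable Z) : Decomposable X

lemma Decomposable.stackBelow {X : Cob m k} (hX : Decomposable X) (b : Diagram k n)
    (hb : ∀ Y : Cob m k, NormalForm Y.diagram → Decomposable ((stackBelow b).obj Y)) :
    Decomposable ((stackBelow b).obj X) := by
  induction hX with
  | normal h => exact hb _ h
  | iso f g hf hg hfg hgf _ ih =>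
    refine .iso _ _ (hf.stackBelow b) (hg.stackBelow b) ?_ ?_ ih
    · rw [← Functor.map_comp, hfg, CategoryTheory.Functor.map_id]
    · rw [← Functor.map_comp, hgf, CategoryTheory.Functor.map_id]
  | sum f g f' g' hf hg hf' hg' hgf hgf' hfg _ _ ih ih' =>
    refine .sum _ _ _ _ (hf.stackBelow b) (hg.stackBelow b) (hf'.stackBelow b)
      (hg'.stackBelow b) ?_ ?_ ?_ ih ih'
    · rw [← Functor.map_comp, hgf, CategoryTheory.Functor.map_id]
    · rw [← Functor.map_comp, hgf', CategoryTheory.Functor.map_id]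
    · rw [← Functor.map_comp, ← Functor.map_comp, ← Functor.map_add, hfg, CategoryTheory.Functor.map_id]

lemma Decomposable.of_homeo {a b : Diagram m n} {s : ℤ} (h : Decomposable ⟨b, s⟩)
    (e : a.space.Homeo b.space) : Decomposable ⟨a, s⟩ := by
  refine .iso (X := ⟨a, s⟩) (Y := ⟨b, s⟩) (Mor.cyl e) (Mor.cyl e.symm) ?_ ?_
    (Mor.cyl_comp_symm e) (Mor.cyl_symm_comp e) h
  · change Mor.cyl e ∈ Mor.homogeneous a b (0 - (s - s))
    rw [sub_self, sub_zero]
    exact Mor.cyl_mem_homogeneous e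
  · change Mor.cyl e.symm ∈ Mor.homogeneous b a (0 - (s - s))
    rw [sub_self, sub_zero]
    exact Mor.cyl_mem_homogeneous e.symm

/-- The circle deloops to `q⁻¹ ⊕ q`, each summand being split off by a birth and a death with one
dot between them. Orthogonality of the summands follows from the two retractions and the
decomposition of the identity, so only spheres with one dot are evaluated. -/
lemma Decomposable.circle {b : Diagram m (n - 2)} (i : ℕ) (h : i + 2 ≤ n)
    (hb : ∀ s, Decomposable ⟨b, s⟩) (s : ℤ) :
    Decomposable ⟨b.stack ((Diagram.cap n i h).stack (.cup n i h)), s⟩ := by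
  have hb' : ∀ s, Decomposable ⟨b.stack (.one (n - 2)), s⟩ := fun s =>
    (hb s).of_homeo b.rightUnit
  let o : ((Diagram.cap n i h).stack (.cup n i h)).space.Comp :=
    Glue.inl (⟨i, by omega⟩ : Fin (n - 1))
  have ho := Diagram.capCupComp_circle n i h
  have ht := Diagram.capCupComp_top n i h
  have hbot := Diagram.capCupComp_bot n i h
  have hB : ∀ k : ℕ, Mor.stack (Mor.id b) (Mor.of (Deloop.birth _ o k) 1) ∈
      Mor.homogeneous _ _ (2 * (k : ℤ) - 1) := fun k => by
    have := Mor.stack_mem_homogeneous (Mor.id_mem_homogeneous b)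
      (Mor.of_mem_homogeneous _ (Deloop.deg_birth ht hbot o k))
    rwa [zero_add] at this
  have hD : ∀ k : ℕ, Mor.stack (Mor.id b) (Mor.of (Deloop.death _ o k) 1) ∈
      Mor.homogeneous _ _ (2 * (k : ℤ) - 1) := fun k => by
    have := Mor.stack_mem_homogeneous (Mor.id_mem_homogeneous b)
      (Mor.of_mem_homogeneous _ (Deloop.deg_death ht hbot o k))
    rwa [zero_add] at this
  refine .sum (X := ⟨b.stack ((Diagram.cap n i h).stack (.cup n i h)), s⟩)
    (Y := ⟨b.stack (.one (n - 2)), s - 1⟩) (Z := ⟨b.stack (.one (n - 2)), s + 1⟩)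
    (Mor.stack (Mor.id b) (Mor.of (Deloop.death _ o 1) 1))
    (Mor.stack (Mor.id b) (Mor.of (Deloop.birth _ o 0) 1))
    (Mor.stack (Mor.id b) (Mor.of (Deloop.death _ o 0) 1))
    (Mor.stack (Mor.id b) (Mor.of (Deloop.birth _ o 1) 1)) ?_ ?_ ?_ ?_ ?_ ?_ ?_ (hb' _) (hb' _)
  · have := hD 1
    rwa [show (2 * (1 : ℕ) - 1 : ℤ) = 0 - (s - 1 - s) by push_cast; ring] at this
  · have := hB 0
    rwa [show (2 * (0 : ℕ) - 1 : ℤ) = 0 - (s - (s - 1)) by push_cast; ring] at this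
  · have := hD 0
    rwa [show (2 * (0 : ℕ) - 1 : ℤ) = 0 - (s + 1 - s) by push_cast; ring] at this
  · have := hB 1
    rwa [show (2 * (1 : ℕ) - 1 : ℤ) = 0 - (s - (s + 1)) by push_cast; ring] at this
  · refine (Mor.id_stack_comp _ _ _).symm.trans ?_
    rw [Deloop.birth_comp_death ht hbot ho 0 1 rfl]
    exact Mor.stack_id _ _
  · refine (Mor.id_stack_comp _ _ _).symm.trans ?_
    rw [Deloop.birth_comp_death ht hbot ho 1 0 rfl]
    exact Mor.stack_id _ _
  · change Mor.comp _ _ + Mor.comp _ _ = Mor.id _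
    rw [← Mor.id_stack_comp, ← Mor.id_stack_comp, ← map_add, Deloop.death_comp_birth ht hbot ho]
    exact Mor.stack_id _ _

/-- The cup is moved up through the caps. Against the lowest cap it closes a circle if `i = j`,
straightens to a strand if `i` and `j` are adjacent, and otherwise slides past it to meet the next
cap. -/
lemma decomposable_stack_cup {a : Diagram m n} (ha : NormalForm a) (i : ℕ) (h : i + 2 ≤ n)
    (s : ℤ) : Decomposable ⟨a.stack (.cup n i h), s⟩ := by
  induction ha generalizing i s with
  | cups ha => exact .normal (.cups (.cup i h ha))
  | @cap n j hj b hb ih =>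
    have hb' : ∀ s, Decomposable ⟨b, s⟩ := fun s => .normal hb
    refine Decomposable.of_homeo ?_ (Diagram.assoc b (.cap n j hj) (.cup n i h))
    by_cases hij : i = j
    · subst hij
      exact Decomposable.circle i h hb' s
    by_cases h1 : i = j + 1 ∨ j = i + 1
    · exact ((hb' s).of_homeo b.rightUnit).of_homeo
        (Diagram.stackHomeo (.refl _) (Diagram.straighten n i j h hj h1))
    obtain ⟨i', j', hi', hj', h2⟩ : ∃ i' j', i' + 2 ≤ n - 2 ∧ j' + 2 ≤ n - 2 ∧
        ((j + 2 ≤ i ∧ i' = i - 2 ∧ j' = j) ∨ (i + 2 ≤ j ∧ i' = i ∧ j' = j - 2)) := by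
      by_cases h3 : j + 2 ≤ i
      · exact ⟨i - 2, j, by omega, by omega, .inl ⟨h3, rfl, rfl⟩⟩
      · exact ⟨i, j - 2, by omega, by omega, .inr ⟨by omega, rfl, rfl⟩⟩
    refine Decomposable.of_homeo ?_ (Diagram.stackHomeo (.refl _)
      (Diagram.exchange n i j i' j' h hj hi' hj' h2))
    refine Decomposable.of_homeo ?_ (Diagram.assoc b _ _).symm
    -- The cup now lies directly below `b`, where the induction hypothesis applies; adding the cap
    -- below keeps normal forms normal.
    exact (ih i' hi' s).stackBelow (.cap (n - 2) j' hj') fun Y hY => .normal (.cap j' hj' hY)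

lemma decomposable_stack (b : Diagram k n) {m : ℕ} (a : Diagram m k)
    (ha : ∀ s, Decomposable ⟨a, s⟩) (s : ℤ) : Decomposable ⟨a.stack b, s⟩ := by
  induction b generalizing m s with
  | one n => exact (ha s).of_homeo a.rightUnit
  | cap n i h => exact (ha s).stackBelow (.cap n i h) fun Y hY => .normal (.cap i h hY)
  | cup n i h =>
    exact (ha s).stackBelow (.cup n i h) fun Y hY => decomposable_stack_cup hY i h Y.shift
  | stack b c ihb ihc =>
    exact (ihc _ (ihb a ha) s).of_homeo (Diagram.assoc a b c).symm

lemma decomposable (X : Cob m n) : Decomposable X :=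
  (decomposable_stack X.diagram (.one m) (fun _ => .normal (.cups .one)) X.shift).of_homeo
    X.diagram.leftUnit.symm

end Cob

end Normal

/-! ### The ideal generated by caps, and identity summands -/

namespace BN

variable {m n : ℕ}

lemma isHomogeneous_zero {A B : BN m n} (d : ℤ) : IsHomogeneous d (0 : A ⟶ B) :=
  fun _ _ => zero_mem _

lemma isHomogeneous_id (A : BN m n) : IsHomogeneous 0 (𝟙 A) := by
  intro x y
  by_cases h : x = y
  · subst h
    rw [Mat_.id_apply_self]
    exact Cob.isHomogeneous_id _
  · rw [Mat_.id_apply_of_ne _ _ _ h]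
    exact zero_mem _

lemma isHomogeneous_embedding {X Y : Cob m n} {d : ℤ} {f : X ⟶ Y} (hf : Cob.IsHomogeneous d f) :
    IsHomogeneous d ((Mat_.embedding _).map f) := fun _ _ => hf

/-- A column of the identity matrix, as `incl` is a row. Its entries already have the right types,
without transport between equal summands. -/
def proj (A : BN m n) (x : A.ι) : A ⟶ (Mat_.embedding _).obj (A.X x) :=
  fun y _ => (𝟙 A : A ⟶ A) y x

def incl (A : BN m n) (x : A.ι) : (Mat_.embedding _).obj (A.X x) ⟶ A :=
  fun _ y => (𝟙 A : A ⟶ A) x y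

lemma proj_homogeneous (A : BN m n) (x : A.ι) : IsHomogeneous 0 (proj A x) :=
  fun _ _ => isHomogeneous_id A _ _

lemma incl_homogeneous (A : BN m n) (x : A.ι) : IsHomogeneous 0 (incl A x) :=
  fun _ _ => isHomogeneous_id A _ _

lemma incl_proj (A : BN m n) (x : A.ι) : incl A x ≫ proj A x = 𝟙 _ := by
  ext i j
  exact (congrFun (congrFun (Category.id_comp (𝟙 A)) x) x).trans
    ((Mat_.id_apply_self A x).trans (Mat_.id_apply_self ((Mat_.embedding _).obj (A.X x)) i).symm)

lemma sum_apply {A B : BN m n} {ι : Type} (s : Finset ι) (f : ι → (A ⟶ B)) (x : A.ι) (y : B.ι) :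
    (∑ i ∈ s, f i) x y = ∑ i ∈ s, f i x y :=
  map_sum (⟨⟨fun f : A ⟶ B => f x y, rfl⟩, fun _ _ => rfl⟩ : (A ⟶ B) →+ (A.X x ⟶ B.X y)) f s

lemma sum_proj_incl (A : BN m n) : ∑ x, proj A x ≫ incl A x = 𝟙 A := by
  ext i j
  refine (sum_apply _ _ i j).trans
    (Eq.trans ?_ (congrFun (congrFun (Category.id_comp (𝟙 A)) i) j))
  refine Finset.sum_congr rfl fun x _ => ?_
  exact Fintype.sum_unique (ι := PUnit) _

/-- The ideal that the identity morphisms of the diagrams with a cap at the bottom generate. -/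
inductive Through : ∀ {A B : BN n n}, (A ⟶ B) → Prop
  | id (i : ℕ) (h : i + 2 ≤ n) (b : Diagram n (n - 2)) (s : ℤ) :
      Through (𝟙 ((Mat_.embedding _).obj ⟨b.stack (.cap n i h), s⟩))
  | zero {A B : BN n n} : Through (0 : A ⟶ B)
  | add {A B : BN n n} {f g : A ⟶ B} (hf : Through f) (hg : Through g) : Through (f + g)
  | comp {A B C D : BN n n} {f : A ⟶ B} (hf : IsHomogeneous 0 f) {t : B ⟶ C} (ht : Through t)
      {g : C ⟶ D} (hg : IsHomogeneous 0 g) : Through (f ≫ t ≫ g)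

/-- A shift of the identity diagram is a direct summand. -/
def HasOne (A : BN n n) : Prop :=
  ∃ (s : ℤ) (f : (Mat_.embedding _).obj ⟨Diagram.one n, s⟩ ⟶ A)
    (g : A ⟶ (Mat_.embedding _).obj ⟨Diagram.one n, s⟩),
      IsHomogeneous 0 f ∧ IsHomogeneous 0 g ∧ f ≫ g = 𝟙 _

lemma HasOne.of_retract {A B : BN n n} (hA : HasOne A) {f : A ⟶ B} {g : B ⟶ A}
    (hf : IsHomogeneous 0 f) (hg : IsHomogeneous 0 g) (hfg : f ≫ g = 𝟙 A) : HasOne B := by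
  obtain ⟨s, u, v, hu, hv, huv⟩ := hA
  refine ⟨s, u ≫ f, g ≫ v, hu.comp hf (add_zero 0), hg.comp hv (add_zero 0), ?_⟩
  rw [Category.assoc, ← Category.assoc f, hfg, Category.id_comp, huv]

/-- A normal form either ends in a cap, so that its identity generates the ideal, or is a cup word
with equally many endpoints at both ends, hence the identity diagram. The alternative passes through
isomorphisms and direct sums. -/
lemma through_or_hasOne (X : Cob n n) :
    Through (𝟙 ((Mat_.embedding _).obj X)) ∨ HasOne ((Mat_.embedding _).obj X) := by
  have hX := X.decomposable
  induction hX with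
  | @normal X h =>
    obtain ⟨a, s⟩ := X
    change NormalForm a at h
    cases h with
    | cups h =>
      obtain rfl := eq_of_heq (h.heq_one rfl)
      exact .inr ⟨s, 𝟙 _, 𝟙 _, isHomogeneous_id _, isHomogeneous_id _, Category.comp_id _⟩
    | cap i h ha => exact .inl (.id i h _ s)
  | iso f g hf hg hfg hgf _ ih =>
    rcases ih with ih | ih
    · left
      rw [← CategoryTheory.Functor.map_id, ← hfg, Functor.map_comp]
      have := ih.comp (isHomogeneous_embedding hf) (isHomogeneous_embedding hg)
      rwa [Category.id_comp] at this
    · refine .inr (ih.of_retract (isHomogeneous_embedding hg) (isHomogeneous_embedding hf) ?_)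
      rw [← Functor.map_comp, hgf, CategoryTheory.Functor.map_id]
  | sum f g f' g' hf hg hf' hg' hgf hgf' hfg _ _ ih ih' =>
    rcases ih with ih | ih
    · rcases ih' with ih' | ih'
      · left
        rw [← CategoryTheory.Functor.map_id, ← hfg, Functor.map_add, Functor.map_comp, Functor.map_comp]
        have h := ih.comp (isHomogeneous_embedding hf) (isHomogeneous_embedding hg)
        have h' := ih'.comp (isHomogeneous_embedding hf') (isHomogeneous_embedding hg')
        rw [Category.id_comp] at h h'
        exact h.add h'
      · refine .inr (ih'.of_retract (isHomogeneous_embedding hg') (isHomogeneous_embedding hf') ?_)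
        rw [← Functor.map_comp, hgf', CategoryTheory.Functor.map_id]
    · refine .inr (ih.of_retract (isHomogeneous_embedding hg) (isHomogeneous_embedding hf) ?_)
      rw [← Functor.map_comp, hgf, CategoryTheory.Functor.map_id]

lemma through_id {A : BN n n} (hA : ¬ HasOne A) : Through (𝟙 A) := by
  rw [← sum_proj_incl]
  refine Finset.sum_induction _ Through (fun _ _ => .add) .zero fun x _ => ?_
  rcases through_or_hasOne (A.X x) with h | h
  · have := h.comp (proj_homogeneous A x) (incl_homogeneous A x)
    rwa [Category.id_comp] at this
  · exact absurd (h.of_retract (incl_homogeneous A x) (proj_homogeneous A x) (incl_proj A x)) hA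

end BN

/-! ### Stacking of direct sums, unitors -/

namespace BN

variable {m k l n : ℕ}

/-- Stacking `A` on top of `B`. -/
abbrev tens (A : BN m k) (B : BN k n) : BN m n where
  ι := A.ι × B.ι
  X x := ⟨(A.X x.1).diagram.stack (B.X x.2).diagram, (A.X x.1).shift + (B.X x.2).shift⟩

def tensMap {A A' : BN m k} {B B' : BN k n} :
    (A ⟶ A') →+ (B ⟶ B') →+ (tens A B ⟶ tens A' B') :=
  AddMonoidHom.mk' (fun f => AddMonoidHom.mk'
    (fun g x y => Mor.stack (f x.1 y.1) (g x.2 y.2))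
    fun g g' => by
      ext x y
      exact (Mor.stack (f x.1 y.1)).map_add (g x.2 y.2) (g' x.2 y.2))
    fun f f' => by
      ext g x y
      exact LinearMap.map_add₂ Mor.stack (f x.1 y.1) (f' x.1 y.1) (g x.2 y.2)

lemma tensMap_id (A : BN m k) (B : BN k n) : tensMap (𝟙 A) (𝟙 B) = 𝟙 (tens A B) := by
  ext ⟨x, y⟩ ⟨x', y'⟩
  change Mor.stack ((𝟙 A : A ⟶ A) x x') ((𝟙 B : B ⟶ B) y y') = _
  by_cases hx : x = x'
  · by_cases hy : y = y'
    · subst hx hy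
      rw [Mat_.id_apply_self, Mat_.id_apply_self]
      exact (Mor.stack_id _ _).trans (Mat_.id_apply_self (tens A B) (x, y)).symm
    · rw [Mat_.id_apply_of_ne B _ _ hy]
      refine (map_zero _).trans (Mat_.id_apply_of_ne (tens A B) (x, y) (x', y') ?_).symm
      exact fun h => hy (congrArg Prod.snd h)
  · rw [Mat_.id_apply_of_ne A _ _ hx]
    refine (LinearMap.map_zero₂ Mor.stack _).trans
      (Mat_.id_apply_of_ne (tens A B) (x, y) (x', y') ?_).symm
    exact fun h => hx (congrArg Prod.fst h)

lemma tensMap_comp {A A' A'' : BN m k} {B B' B'' : BN k n} (f : A ⟶ A') (f' : A' ⟶ A'')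
    (g : B ⟶ B') (g' : B' ⟶ B'') :
    tensMap (f ≫ f') (g ≫ g') = tensMap f g ≫ tensMap f' g' := by
  ext ⟨x, y⟩ ⟨x'', y''⟩
  change Mor.stack (∑ x', Mor.comp (f x x') (f' x' x'')) (∑ y', Mor.comp (g y y') (g' y' y'')) =
    ∑ z : A'.ι × B'.ι, Mor.comp (Mor.stack (f x z.1) (g y z.2))
      (Mor.stack (f' z.1 x'') (g' z.2 y''))
  refine (LinearMap.map_sum₂ Mor.stack _ _ _).trans (Eq.trans ?_ (Fintype.sum_prod_type _).symm)
  refine Finset.sum_congr rfl fun x' _ => (map_sum _ _ _).trans ?_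
  exact Finset.sum_congr rfl fun y' _ => Mor.stack_comp _ _ _ _

lemma tensMap_homogeneous {A A' : BN m k} {B B' : BN k n} {d e c : ℤ} {f : A ⟶ A'} {g : B ⟶ B'}
    (hf : IsHomogeneous d f) (hg : IsHomogeneous e g) (hc : d + e = c) :
    IsHomogeneous c (tensMap f g) := by
  subst hc
  intro x y
  have h := Mor.stack_mem_homogeneous (hf x.1 y.1) (hg x.2 y.2)
  rwa [show d - ((A'.X y.1).shift - (A.X x.1).shift) + (e - ((B'.X y.2).shift - (B.X x.2).shift)) =
    d + e - ((A'.X y.1).shift + (B'.X y.2).shift - ((A.X x.1).shift + (B.X x.2).shift)) by ring]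
    at h

section Reindex

variable {C D : Type} [Category.{0} C] [Preadditive C] [Category.{0} D] [Preadditive D]
  {F G H : C ⥤ D} {A B : Mat_ C} {I J K : Type} [Fintype I] [Fintype J] [Fintype K]

/-- The functor `F` on the direct sum `A`, with the summands indexed by `I`. -/
abbrev mapObj (F : C ⥤ D) (e : I ≃ A.ι) : Mat_ D where
  ι := I
  X i := F.obj (A.X (e i))

/-- The index sets are free so that a functor applied to `A` can be compared with a stack whose
summands are indexed by `PUnit × A.ι` or `A.ι × PUnit`. -/
def mapHom (F : C ⥤ D) (f : A ⟶ B) (e : I ≃ A.ι) (e' : J ≃ B.ι) : mapObj F e ⟶ mapObj F e' :=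
  fun i j => F.map (f (e i) (e' j))

/-- The natural transformation `τ` on the direct sum `A`. -/
def mapNat (τ : F ⟶ G) (e : I ≃ A.ι) (e' : J ≃ A.ι) : mapObj F e ⟶ mapObj G e' :=
  fun i j => τ.app (A.X (e i)) ≫ G.map ((𝟙 A : A ⟶ A) (e i) (e' j))

lemma sum_map_comp_map [F.Additive] {A' : Mat_ C} (f : A ⟶ B) (g : B ⟶ A') (e : I ≃ B.ι) (x : A.ι)
    (y : A'.ι) : ∑ i, F.map (f x (e i)) ≫ F.map (g (e i) y) = F.map ((f ≫ g) x y) := by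
  rw [e.sum_comp (fun j => F.map (f x j) ≫ F.map (g j y)), Mat_.comp_apply, F.map_sum]
  simp only [F.map_comp]

lemma mapNat_comp [H.Additive] (τ : F ⟶ G) (σ : G ⟶ H) (e : I ≃ A.ι) (e' : J ≃ A.ι)
    (e'' : K ≃ A.ι) : mapNat τ e e' ≫ mapNat σ e' e'' = mapNat (τ ≫ σ) e e'' := by
  ext i k
  rw [Mat_.comp_apply]
  simp only [mapNat, Category.assoc, NatTrans.naturality_assoc, NatTrans.comp_app]
  rw [← Preadditive.comp_sum, ← Preadditive.comp_sum, sum_map_comp_map, Category.comp_id]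

lemma mapNat_id [F.Additive] (e : I ≃ A.ι) : mapNat (𝟙 F) e e = 𝟙 _ := by
  ext i j
  simp only [mapNat, NatTrans.id_app, Category.id_comp]
  by_cases h : i = j
  · subst h
    rw [Mat_.id_apply_self, Mat_.id_apply_self, F.map_id]
  · rw [Mat_.id_apply_of_ne _ _ _ h, Mat_.id_apply_of_ne _ _ _ (e.injective.ne h), F.map_zero]

lemma mapNat_naturality [F.Additive] [G.Additive] (τ : F ⟶ G) (f : A ⟶ B) (e : I ≃ A.ι)
    (e' : J ≃ A.ι) (e₁ : K ≃ B.ι) {L : Type} [Fintype L] (e₁' : L ≃ B.ι) :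
    mapHom F f e e₁ ≫ mapNat τ e₁ e₁' = mapNat τ e e' ≫ mapHom G f e' e₁' := by
  ext i j
  rw [Mat_.comp_apply, Mat_.comp_apply]
  simp only [mapNat, mapHom, Category.assoc, NatTrans.naturality_assoc]
  rw [← Preadditive.comp_sum, ← Preadditive.comp_sum, sum_map_comp_map, sum_map_comp_map,
    Category.comp_id, Category.id_comp]

end Reindex

end BN

namespace Cob

variable {m k l n : ℕ}

lemma isHomogeneous_cyl {a b : Diagram m n} (e : a.space.Homeo b.space) {s t : ℤ} (h : s = t) :
    IsHomogeneous (X := ⟨a, s⟩) (Y := ⟨b, t⟩) 0 (Mor.cyl e) := by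
  subst h
  change Mor.cyl e ∈ Mor.homogeneous a b (0 - (s - s))
  rw [sub_self, sub_zero]
  exact Mor.cyl_mem_homogeneous e

/-- Morphisms do not see the shifts, so `s` and `t` are arbitrary; having degree `0` is a separate
matter that needs `s = t`. -/
def cylIso {a b : Diagram m n} (e : a.space.Homeo b.space) (s t : ℤ) :
    (⟨a, s⟩ : Cob m n) ≅ ⟨b, t⟩ where
  hom := Mor.cyl e
  inv := Mor.cyl e.symm
  hom_inv_id := Mor.cyl_comp_symm e
  inv_hom_id := Mor.cyl_symm_comp e

/-- Stacking `X` on top, with its shift. -/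
def stackLeft (X : Cob m k) : Cob k n ⥤ Cob m n where
  obj Y := ⟨X.diagram.stack Y.diagram, X.shift + Y.shift⟩
  map f := Mor.stack (Mor.id X.diagram) f
  map_id Y := Mor.stack_id X.diagram Y.diagram
  map_comp f g := Mor.id_stack_comp X.diagram f g

/-- Stacking `Y` below, with its shift. -/
def stackRight (Y : Cob k n) : Cob m k ⥤ Cob m n where
  obj X := ⟨X.diagram.stack Y.diagram, X.shift + Y.shift⟩
  map f := Mor.stack f (Mor.id Y.diagram)
  map_id X := Mor.stack_id X.diagram Y.diagram
  map_comp f g := Mor.comp_stack_id Y.diagram f g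

instance (X : Cob m k) : (stackLeft (n := n) X).Additive where
  map_add {_ _ f g} := (Mor.stack (Mor.id X.diagram)).map_add f g

instance (Y : Cob k n) : (stackRight (m := m) Y).Additive where
  map_add {_ _ f g} := LinearMap.map_add₂ Mor.stack f g (Mor.id Y.diagram)

def leftUnitor (m n : ℕ) : stackLeft (n := n) ⟨.one m, 0⟩ ≅ 𝟭 (Cob m n) :=
  NatIso.ofComponents (fun Y => cylIso Y.diagram.leftUnit (0 + Y.shift) Y.shift)
    fun f => Mor.leftUnit_naturality f

def rightUnitor (m n : ℕ) : stackRight (m := m) ⟨.one n, 0⟩ ≅ 𝟭 (Cob m n) :=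
  NatIso.ofComponents (fun Y => cylIso Y.diagram.rightUnit (Y.shift + 0) Y.shift)
    fun f => Mor.rightUnit_naturality f

/-- Brings the diagram `c`, later a cap, next to the variable, where contractibility of `c ⊗ P` can
be used. -/
def associator (b : Diagram m k) (c : Diagram k l) (s : ℤ) :
    stackLeft (n := n) ⟨b.stack c, s⟩ ≅ stackAbove c ⋙ stackLeft ⟨b, s⟩ :=
  NatIso.ofComponents
    (fun Y => cylIso (Diagram.assoc b c Y.diagram) (s + Y.shift) (s + Y.shift)) fun f => by
      have h := Mor.assoc_naturality (Mor.id b) (Mor.id c) f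
      rwa [Mor.stack_id] at h

def fold (m n i : ℕ) (h : i + 2 ≤ n) :
    stackBelow (m := m) (.cup n i h) ⋙ stackBelow (.cap n i h) ⟶ 𝟭 (Cob m n) where
  app X := Zigzag.fold n i h X.diagram
  naturality _ _ f := Zigzag.fold_naturality n i h f

end Cob

namespace BN

variable {m k l n : ℕ}

/-- The unit of `tens`. -/
abbrev one (n : ℕ) : BN n n := (Mat_.embedding _).obj ⟨Diagram.one n, 0⟩

lemma tensMap_embedding_left (X : Cob m k) {A B : BN k n} (f : A ⟶ B) :
    tensMap (𝟙 ((Mat_.embedding _).obj X)) f =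
      mapHom (Cob.stackLeft X) f (Equiv.punitProd A.ι) (Equiv.punitProd B.ι) := by
  ext x y
  exact congrArg (Mor.stack · (f x.2 y.2)) (Mat_.id_apply_self ((Mat_.embedding _).obj X) ⟨⟩)

lemma tensMap_embedding_right (X : Cob k n) {A B : BN m k} (f : A ⟶ B) :
    tensMap f (𝟙 ((Mat_.embedding _).obj X)) =
      mapHom (Cob.stackRight X) f (Equiv.prodPUnit A.ι) (Equiv.prodPUnit B.ι) := by
  ext x y
  exact congrArg (Mor.stack (f x.1 y.1)) (Mat_.id_apply_self ((Mat_.embedding _).obj X) ⟨⟩)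

lemma mapNat_homogeneous {m' n' : ℕ} {F G : Cob m n ⥤ Cob m' n'} (τ : F ⟶ G) {A : BN m n}
    {I J : Type} [Fintype I] [Fintype J] (e : I ≃ A.ι) (e' : J ≃ A.ι) {d : ℤ}
    (hτ : ∀ X, Cob.IsHomogeneous d (τ.app X))
    (hG : ∀ {X Y : Cob m n} {f : X ⟶ Y}, Cob.IsHomogeneous 0 f → Cob.IsHomogeneous 0 (G.map f)) :
    IsHomogeneous d (mapNat τ e e') := fun i j => by
  have h := (hτ (A.X (e i))).comp (hG (isHomogeneous_id A (e i) (e' j)))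
  rwa [add_zero] at h

def leftUnitor (A : BN m n) : tens (one m) A ≅ A where
  hom := mapNat (Cob.leftUnitor m n).hom (Equiv.punitProd A.ι) (Equiv.refl A.ι)
  inv := mapNat (Cob.leftUnitor m n).inv (Equiv.refl A.ι) (Equiv.punitProd A.ι)
  hom_inv_id := by
    refine (mapNat_comp _ _ _ _ _).trans ?_
    rw [Iso.hom_inv_id]
    exact mapNat_id _
  inv_hom_id := by
    refine (mapNat_comp _ _ _ _ _).trans ?_
    rw [Iso.inv_hom_id]
    exact mapNat_id _

def rightUnitor (A : BN m n) : tens A (one n) ≅ A where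
  hom := mapNat (Cob.rightUnitor m n).hom (Equiv.prodPUnit A.ι) (Equiv.refl A.ι)
  inv := mapNat (Cob.rightUnitor m n).inv (Equiv.refl A.ι) (Equiv.prodPUnit A.ι)
  hom_inv_id := by
    refine (mapNat_comp _ _ _ _ _).trans ?_
    rw [Iso.hom_inv_id]
    exact mapNat_id _
  inv_hom_id := by
    refine (mapNat_comp _ _ _ _ _).trans ?_
    rw [Iso.inv_hom_id]
    exact mapNat_id _

lemma leftUnitor_naturality {A B : BN m n} (f : A ⟶ B) :
    tensMap (𝟙 (one m)) f ≫ (leftUnitor B).hom = (leftUnitor A).hom ≫ f := by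
  rw [tensMap_embedding_left]
  exact mapNat_naturality (Cob.leftUnitor m n).hom f _ _ _ _

lemma rightUnitor_naturality {A B : BN m n} (f : A ⟶ B) :
    tensMap f (𝟙 (one n)) ≫ (rightUnitor B).hom = (rightUnitor A).hom ≫ f := by
  rw [tensMap_embedding_right]
  exact mapNat_naturality (Cob.rightUnitor m n).hom f _ _ _ _

lemma leftUnitor_homogeneous (A : BN m n) : IsHomogeneous 0 (leftUnitor A).hom :=
  mapNat_homogeneous _ _ _ (fun _ => Cob.isHomogeneous_cyl _ (zero_add _)) fun h => h

lemma leftUnitor_inv_homogeneous (A : BN m n) : IsHomogeneous 0 (leftUnitor A).inv :=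
  mapNat_homogeneous _ _ _ (fun _ => Cob.isHomogeneous_cyl _ (zero_add _).symm) fun {X Y f} h => by
    have := Mor.stack_mem_homogeneous (Mor.id_mem_homogeneous (.one m)) h
    change Mor.stack (Mor.id (.one m)) f ∈ Mor.homogeneous _ _ (0 - (0 + Y.shift - (0 + X.shift)))
    rw [zero_add] at this
    rwa [zero_add, zero_add]

lemma rightUnitor_inv_homogeneous (A : BN m n) : IsHomogeneous 0 (rightUnitor A).inv :=
  mapNat_homogeneous _ _ _ (fun _ => Cob.isHomogeneous_cyl _ (add_zero _).symm) fun {X Y f} h => by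
    have := Mor.stack_mem_homogeneous h (Mor.id_mem_homogeneous (.one n))
    change Mor.stack f (Mor.id (.one n)) ∈ Mor.homogeneous _ _ (0 - (Y.shift + 0 - (X.shift + 0)))
    rw [add_zero] at this
    rwa [add_zero, add_zero]

/-- Makes the two inclusions of `P^0` into `P^0 ⊗ P^0` coincide, the one point at which left and
right multiplication are compared. -/
lemma leftUnitor_one : (leftUnitor (one n)).hom = (rightUnitor (one n)).hom := by
  have h : (Diagram.one n).leftUnit = (Diagram.one n).rightUnit :=
    OneManifold.Homeo.ext (Glue.ind (fun _ => rfl) fun _ => rfl)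
  ext x y
  change Mor.comp (Mor.cyl (Diagram.one n).leftUnit) _ =
    Mor.comp (Mor.cyl (Diagram.one n).rightUnit) _
  rw [h]
  rfl

end BN
-- Null-homotopies from the contractions of `P`
namespace BN

variable {m k n : ℕ}

lemma _root_.CategoryTheory.Homotopy.contraction {C : Type*} [Category C] [Preadditive C]
    {K : CochainComplex C ℤ} (h : Homotopy (𝟙 K) 0) {i j l : ℤ} (hij : i + 1 = j)
    (hjl : j + 1 = l) : h.hom j i ≫ K.d i j + K.d j l ≫ h.hom l j = 𝟙 (K.X j) := by
  have h1 := h.comm j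
  rw [dNext_eq h.hom (show (ComplexShape.up ℤ).Rel j l from hjl),
    prevD_eq h.hom (show (ComplexShape.up ℤ).Rel i j from hij), HomologicalComplex.id_f,
    HomologicalComplex.zero_f, add_zero, add_comm] at h1
  exact h1.symm

lemma mapMat_map_homogeneous {m' n' : ℕ} {F : Cob m n ⥤ Cob m' n'} [F.Additive]
    (hF : ∀ {X Y : Cob m n} {f : X ⟶ Y} {d : ℤ}, Cob.IsHomogeneous d f →
      Cob.IsHomogeneous d (F.map f)) {A B : BN m n} {f : A ⟶ B} {d : ℤ} (hf : IsHomogeneous d f) :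
    IsHomogeneous d (F.mapMat_.map f) := fun i j => hF (hf i j)

/-- Composition with `t` is null-homotopic on `Hom(-, P)`. -/
def LeftNull (P : Ch n n) {X X' : BN n n} (t : X ⟶ X') : Prop :=
  ∃ H : ∀ l l' : ℤ, (X' ⟶ P.cpx.X l) →+ (X ⟶ P.cpx.X l'),
    (∀ l l' d f, IsHomogeneous d f → IsHomogeneous d (H l l' f)) ∧
    ∀ j l l' (_ : j + 1 = l) (_ : l + 1 = l') (f : X' ⟶ P.cpx.X l),
      H l j f ≫ P.cpx.d j l + H l' l (f ≫ P.cpx.d l l') = t ≫ f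

/-- `t ⊗ 1` is null-homotopic. -/
def TensNull (P : Ch n n) {X X' : BN n n} (t : X ⟶ X') : Prop :=
  ∃ K : ∀ l l' : ℤ, tens X (P.cpx.X l) ⟶ tens X' (P.cpx.X l'),
    (∀ l l', IsHomogeneous 0 (K l l')) ∧
    ∀ j l l' (_ : j + 1 = l) (_ : l + 1 = l'),
      K l j ≫ tensMap (𝟙 X') (P.cpx.d j l) + tensMap (𝟙 X) (P.cpx.d l l') ≫ K l' l =
        tensMap t (𝟙 (P.cpx.X l))

variable {P : Ch n n}

/-- With `F` stacking a cup and `G` stacking a cap, naturality of the saddle `φ` recovers `f` as `u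
≫ G (F f) ≫ φ`. Inserting the contraction `w` of `F P` gives the homotopy. The degrees `-1` of `u`
and `1` of `φ` cancel. -/
lemma leftNull_of_retract {m k : ℕ} (F : BN n n ⥤ BN m k) (G : BN m k ⥤ BN n n) [F.Additive]
    [G.Additive]
    (hF : ∀ {A B : BN n n} {f : A ⟶ B} {d : ℤ}, IsHomogeneous d f → IsHomogeneous d (F.map f))
    (hG : ∀ {A B : BN m k} {f : A ⟶ B} {d : ℤ}, IsHomogeneous d f → IsHomogeneous d (G.map f))
    (φ : ∀ A : BN n n, G.obj (F.obj A) ⟶ A)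
    (hφ : ∀ {A B : BN n n} (f : A ⟶ B), G.map (F.map f) ≫ φ B = φ A ≫ f)
    (hφ1 : ∀ A, IsHomogeneous 1 (φ A)) {X : BN n n} (u : X ⟶ G.obj (F.obj X))
    (hu1 : IsHomogeneous (-1) u) (hu : u ≫ φ X = 𝟙 X)
    (w : ∀ l l', F.obj (P.cpx.X l) ⟶ F.obj (P.cpx.X l')) (hw1 : ∀ l l', IsHomogeneous 0 (w l l'))
    (hw2 : ∀ {j l l' : ℤ} (_ : j + 1 = l) (_ : l + 1 = l'),
      w l j ≫ F.map (P.cpx.d j l) + F.map (P.cpx.d l l') ≫ w l' l = 𝟙 (F.obj (P.cpx.X l))) :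
    LeftNull P (𝟙 X) := by
  refine ⟨fun l l' => AddMonoidHom.mk' (fun f : X ⟶ P.cpx.X l =>
    u ≫ G.map (F.map f ≫ w l l') ≫ φ (P.cpx.X l')) ?_, ?_, ?_⟩
  · intro f g
    simp only [Functor.map_add, Preadditive.add_comp, Preadditive.comp_add]
  · intro l l' d f hf
    refine hu1.comp (e := d + 1) ((IsHomogeneous.comp (d := d) ?_ (hφ1 _) rfl)) (by ring)
    exact hG ((hF hf).comp (hw1 _ _) (add_zero _))
  · intro j l l' h1 h2 f
    change (u ≫ G.map (F.map f ≫ w l j) ≫ φ (P.cpx.X j)) ≫ P.cpx.d j l +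
      u ≫ G.map (F.map (f ≫ P.cpx.d l l') ≫ w l' l) ≫ φ (P.cpx.X l) = 𝟙 X ≫ f
    simp only [Category.assoc]
    rw [← hφ, ← Preadditive.comp_add, ← Category.assoc (G.map _), ← Preadditive.add_comp,
      ← G.map_comp, ← G.map_add, F.map_comp]
    simp only [Category.assoc]
    rw [← Preadditive.comp_add, hw2 h1 h2, Category.comp_id, hφ, ← Category.assoc, hu]

/-- The saddles on a direct sum. -/
def fold (i : ℕ) (h : i + 2 ≤ n) (A : BN n n) :
    (Cob.stackBelow (m := n) (.cap n i h)).mapMat_.obj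
      ((Cob.stackBelow (m := n) (.cup n i h)).mapMat_.obj A) ⟶ A :=
  mapNat (Cob.fold n n i h) (Equiv.refl A.ι) (Equiv.refl A.ι)

lemma fold_naturality (i : ℕ) (h : i + 2 ≤ n) {A B : BN n n} (f : A ⟶ B) :
    (Cob.stackBelow (m := n) (.cap n i h)).mapMat_.map
      ((Cob.stackBelow (m := n) (.cup n i h)).mapMat_.map f) ≫ fold i h B = fold i h A ≫ f :=
  mapNat_naturality (Cob.fold n n i h) f (Equiv.refl A.ι) (Equiv.refl A.ι) (Equiv.refl B.ι)
    (Equiv.refl B.ι)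

lemma fold_homogeneous (i : ℕ) (h : i + 2 ≤ n) (A : BN n n) : IsHomogeneous 1 (fold i h A) :=
  mapNat_homogeneous _ _ _ (fun Y => by
    change Zigzag.fold n i h Y.diagram ∈ Mor.homogeneous _ _ (1 - (Y.shift - Y.shift))
    rw [sub_self, sub_zero]
    exact Zigzag.fold_mem_homogeneous n i h _) fun h => h

/-- A section of `fold`. -/
def unfold (i : ℕ) (h : i + 2 ≤ n) (b : Diagram n (n - 2)) (s : ℤ) :
    (Mat_.embedding _).obj ⟨b.stack (.cap n i h), s⟩ ⟶
    (Cob.stackBelow (m := n) (.cap n i h)).mapMat_.obj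
      ((Cob.stackBelow (m := n) (.cup n i h)).mapMat_.obj
        ((Mat_.embedding _).obj ⟨b.stack (.cap n i h), s⟩)) :=
  fun _ _ => Zigzag.unfold n i h b

lemma unfold_fold (i : ℕ) (h : i + 2 ≤ n) (b : Diagram n (n - 2)) (s : ℤ) :
    unfold i h b s ≫ fold i h _ = 𝟙 _ := by
  ext x y
  refine (Fintype.sum_unique (ι := PUnit) _).trans (Eq.trans ?_ (Mat_.id_apply_self _ x).symm)
  refine (congrArg (fun z => Mor.comp (Zigzag.unfold n i h b) (Mor.comp (Zigzag.fold n i h _) z))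
    (Mat_.id_apply_self ((Mat_.embedding (Cob n n)).obj ⟨b.stack (.cap n i h), s⟩) x)).trans ?_
  exact (congrArg _ (Mor.comp_id _)).trans (Zigzag.unfold_fold n i h b)

lemma unfold_homogeneous (i : ℕ) (h : i + 2 ≤ n) (b : Diagram n (n - 2)) (s : ℤ) :
    IsHomogeneous (-1) (unfold i h b s) := fun x y => by
  change Zigzag.unfold n i h b ∈ Mor.homogeneous _ _ (-1 - (s - s))
  rw [sub_self, sub_zero]
  exact Zigzag.unfold_mem_homogeneous n i h b

lemma leftNull_id (hP : P.IsUniversalProjector) (i : ℕ) (h : i + 2 ≤ n) (b : Diagram n (n - 2))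
    (s : ℤ) : LeftNull P (𝟙 ((Mat_.embedding _).obj ⟨b.stack (.cap n i h), s⟩)) := by
  obtain ⟨c, hc⟩ := hP.below i h
  exact leftNull_of_retract _ _ (mapMat_map_homogeneous fun h => h.stackBelow _)
    (mapMat_map_homogeneous fun h => h.stackBelow _) (fold i h) (fold_naturality i h)
    (fold_homogeneous i h) (unfold i h b s) (unfold_homogeneous i h b s) (unfold_fold i h b s)
    (fun l l' => c.hom l l') hc fun h1 h2 => c.contraction h1 h2

/-- `(b ⊗ cap) ⊗ P ≅ b ⊗ (cap ⊗ P)`, and the contraction of `cap ⊗ P` is conjugated by this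
isomorphism. -/
lemma tensNull_id (hP : P.IsUniversalProjector) (i : ℕ) (h : i + 2 ≤ n) (b : Diagram n (n - 2))
    (s : ℤ) : TensNull P (𝟙 ((Mat_.embedding _).obj ⟨b.stack (.cap n i h), s⟩)) := by
  obtain ⟨c, hc⟩ := hP.above i h
  let F := (Cob.stackAbove (n := n) (.cap n i h)).mapMat_
  let X : BN n n := (Mat_.embedding _).obj ⟨b.stack (.cap n i h), s⟩
  let Y : BN n (n - 2) := (Mat_.embedding _).obj ⟨b, s⟩
  let τ := Cob.associator (n := n) b (.cap n i h) s
  let φ : ∀ A : BN n n, tens X A ⟶ tens Y (F.obj A) := fun A =>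
    mapNat τ.hom (Equiv.punitProd A.ι) (Equiv.punitProd A.ι)
  let ψ : ∀ A : BN n n, tens Y (F.obj A) ⟶ tens X A := fun A =>
    mapNat τ.inv (Equiv.punitProd A.ι) (Equiv.punitProd A.ι)
  have hφψ : ∀ A, φ A ≫ ψ A = 𝟙 _ := fun A => by
    refine (mapNat_comp _ _ _ _ _).trans ?_
    rw [Iso.hom_inv_id]
    exact mapNat_id _
  have hφ : ∀ {A B : BN n n} (f : A ⟶ B), tensMap (𝟙 X) f ≫ φ B =
      φ A ≫ tensMap (𝟙 Y) (F.map f) := fun f => by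
    rw [tensMap_embedding_left, tensMap_embedding_left]
    exact mapNat_naturality τ.hom f _ _ _ _
  have hψ : ∀ {A B : BN n n} (f : A ⟶ B), tensMap (𝟙 Y) (F.map f) ≫ ψ B =
      ψ A ≫ tensMap (𝟙 X) f := fun f => by
    rw [tensMap_embedding_left, tensMap_embedding_left]
    exact mapNat_naturality τ.inv f _ _ _ _
  have hφ1 : ∀ A, IsHomogeneous 0 (φ A) := fun A =>
    mapNat_homogeneous _ _ _ (fun _ => Cob.isHomogeneous_cyl _ rfl) fun {Z W f} hf => by
      have := Mor.stack_mem_homogeneous (Mor.id_mem_homogeneous b)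
        (Mor.stack_mem_homogeneous (Mor.id_mem_homogeneous (.cap n i h)) hf)
      rw [zero_add, zero_add] at this
      change Mor.stack (Mor.id b) (Mor.stack (Mor.id (.cap n i h)) f) ∈
        Mor.homogeneous _ _ (0 - (s + W.shift - (s + Z.shift)))
      rwa [add_sub_add_left_eq_sub]
  have hψ1 : ∀ A, IsHomogeneous 0 (ψ A) := fun A =>
    mapNat_homogeneous _ _ _ (fun _ => Cob.isHomogeneous_cyl _ rfl) fun {Z W f} hf => by
      have := Mor.stack_mem_homogeneous (Mor.id_mem_homogeneous (b.stack (.cap n i h))) hf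
      rw [zero_add] at this
      change Mor.stack (Mor.id (b.stack (.cap n i h))) f ∈
        Mor.homogeneous _ _ (0 - (s + W.shift - (s + Z.shift)))
      rwa [add_sub_add_left_eq_sub]
  obtain ⟨w, hw⟩ : ∃ w : ∀ l l', F.obj (P.cpx.X l) ⟶ F.obj (P.cpx.X l'),
    ∀ l l', w l l' = c.hom l l' := ⟨fun l l' => c.hom l l', fun _ _ => rfl⟩
  have hw1 : ∀ l l', IsHomogeneous 0 (w l l') := fun l l' => by
    rw [hw]; exact hc l l'
  have hw2 : ∀ {j l l' : ℤ} (_ : j + 1 = l) (_ : l + 1 = l'),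
      w l j ≫ F.map (P.cpx.d j l) + F.map (P.cpx.d l l') ≫ w l' l = 𝟙 (F.obj (P.cpx.X l)) :=
    fun h1 h2 => by
      rw [hw, hw]; exact c.contraction h1 h2
  refine ⟨fun l l' => φ _ ≫ tensMap (𝟙 Y) (w l l') ≫ ψ _, fun l l' => ?_, ?_⟩
  · exact (hφ1 _).comp ((tensMap_homogeneous (isHomogeneous_id Y) (hw1 l l') (add_zero 0)).comp
      (hψ1 _) (add_zero 0)) (add_zero 0)
  · intro j l l' h1 h2
    change (φ _ ≫ tensMap (𝟙 Y) (w l j) ≫ ψ _) ≫ tensMap (𝟙 X) (P.cpx.d j l) +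
      tensMap (𝟙 X) (P.cpx.d l l') ≫ φ _ ≫ tensMap (𝟙 Y) (w l' l) ≫ ψ _ =
        tensMap (𝟙 X) (𝟙 (P.cpx.X l))
    rw [← Category.assoc (tensMap (𝟙 X) _), hφ]
    simp only [Category.assoc]
    rw [← hψ, ← Preadditive.comp_add, ← Category.assoc (tensMap _ _), ← tensMap_comp,
      ← Category.assoc (tensMap _ _), ← tensMap_comp, ← Preadditive.add_comp, Category.comp_id,
      ← map_add, hw2 h1 h2, tensMap_id, Category.id_comp, hφψ, tensMap_id]

/-- Maps with a null-homotopy are closed under sums and under composition with maps of degree `0`,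
so the generators of the ideal suffice. -/
lemma Through.leftNull (hP : P.IsUniversalProjector) {X X' : BN n n} {t : X ⟶ X'}
    (ht : Through t) : LeftNull P t := by
  induction ht with
  | id i h b s => exact leftNull_id hP i h b s
  | zero =>
    refine ⟨fun _ _ => 0, fun _ _ d _ _ => isHomogeneous_zero d, fun _ _ _ _ _ f => ?_⟩
    simp
  | add _ _ h h' =>
    obtain ⟨H, h1, h2⟩ := h
    obtain ⟨H', h1', h2'⟩ := h'
    refine ⟨fun l l' => H l l' + H' l l', fun l l' d f hf => (h1 l l' d f hf).add (h1' l l' d f hf),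
      fun j l l' hj hl f => ?_⟩
    rw [Preadditive.add_comp, ← h2 j l l' hj hl, ← h2' j l l' hj hl, AddMonoidHom.add_apply,
      AddMonoidHom.add_apply, Preadditive.add_comp]
    abel
  | @comp A B C D f hf t _ g hg h =>
    obtain ⟨H, h1, h2⟩ := h
    refine ⟨fun l l' => (Preadditive.leftComp _ f).comp ((H l l').comp (Preadditive.leftComp _ g)),
      fun l l' d x hx => hf.comp (h1 l l' d _ (hg.comp hx (zero_add d))) (zero_add d),
      fun j l l' hj hl x => ?_⟩
    change (f ≫ H l j (g ≫ x)) ≫ _ + f ≫ H l' l (g ≫ x ≫ _) = _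
    rw [Category.assoc, ← Preadditive.comp_add, ← Category.assoc g, h2 j l l' hj hl]
    simp only [Category.assoc]

lemma Through.tensNull (hP : P.IsUniversalProjector) {X X' : BN n n} {t : X ⟶ X'}
    (ht : Through t) : TensNull P t := by
  induction ht with
  | id i h b s => exact tensNull_id hP i h b s
  | zero =>
    refine ⟨fun _ _ => 0, fun _ _ => isHomogeneous_zero 0, fun _ _ _ _ _ => ?_⟩
    simp
  | add _ _ h h' =>
    obtain ⟨H, h1, h2⟩ := h
    obtain ⟨H', h1', h2'⟩ := h'
    refine ⟨fun l l' => H l l' + H' l l', fun l l' => (h1 l l').add (h1' l l'),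
      fun j l l' hj hl => ?_⟩
    rw [map_add, AddMonoidHom.add_apply, ← h2 j l l' hj hl, ← h2' j l l' hj hl,
      Preadditive.add_comp, Preadditive.comp_add]
    abel
  | @comp A B C D f hf t _ g hg h =>
    obtain ⟨H, h1, h2⟩ := h
    refine ⟨fun l l' => tensMap f (𝟙 _) ≫ H l l' ≫ tensMap g (𝟙 _), fun l l' =>
      (tensMap_homogeneous hf (isHomogeneous_id _) (add_zero 0)).comp ((h1 l l').comp
        (tensMap_homogeneous hg (isHomogeneous_id _) (add_zero 0)) (add_zero 0)) (add_zero 0),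
      fun j l l' hj hl => ?_⟩
    have e : ∀ {A B : BN n n} (f : A ⟶ B) {U V : BN n n} (x : U ⟶ V),
        tensMap f (𝟙 U) ≫ tensMap (𝟙 B) x = tensMap (𝟙 A) x ≫ tensMap f (𝟙 V) := fun f U V x => by
      rw [← tensMap_comp, ← tensMap_comp]; simp only [Category.id_comp, Category.comp_id]
    rw [← Category.assoc (tensMap (𝟙 A) _), ← e]
    simp only [Category.assoc]
    rw [e, ← Preadditive.comp_add, ← Category.assoc (H l j), ← Category.assoc (tensMap (𝟙 B) _),
      ← Preadditive.add_comp, h2 j l l' hj hl, ← tensMap_comp, ← tensMap_comp]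
    simp only [Category.comp_id]

end BN
-- Contracting the cochains that vanish on `P^0`
namespace Ch

open CochainComplex.HomComplex BN

variable {n : ℕ} {P : Ch n n}

lemma through_of_neg (hP : P.IsUniversalProjector) {i : ℤ} (hi : i < 0) :
    Through (𝟙 (P.cpx.X i)) :=
  through_id fun ⟨s, h⟩ => hP.no_summand i hi.ne s h

lemma exists_hom_homotopy (hP : P.IsUniversalProjector) :
    ∃ H : ∀ i l l' : ℤ, (P.cpx.X i ⟶ P.cpx.X l) →+ (P.cpx.X i ⟶ P.cpx.X l'),
      (∀ i l l' d f, BN.IsHomogeneous d f → BN.IsHomogeneous d (H i l l' f)) ∧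
      ∀ i < 0, ∀ j l l' (_ : j + 1 = l) (_ : l + 1 = l') (f : P.cpx.X i ⟶ P.cpx.X l),
        H i l j f ≫ P.cpx.d j l + H i l' l (f ≫ P.cpx.d l l') = f := by
  have h : ∀ i : ℤ, ∃ H : ∀ l l' : ℤ, (P.cpx.X i ⟶ P.cpx.X l) →+ (P.cpx.X i ⟶ P.cpx.X l'),
      (∀ l l' d f, BN.IsHomogeneous d f → BN.IsHomogeneous d (H l l' f)) ∧
      (i < 0 → ∀ j l l' (_ : j + 1 = l) (_ : l + 1 = l') (f : P.cpx.X i ⟶ P.cpx.X l),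
        H l j f ≫ P.cpx.d j l + H l' l (f ≫ P.cpx.d l l') = f) := fun i => by
    by_cases hi : i < 0
    · obtain ⟨H, h1, h2⟩ := (through_of_neg hP hi).leftNull hP
      exact ⟨H, h1, fun _ j l l' hj hl f => (h2 j l l' hj hl f).trans (Category.id_comp f)⟩
    · exact ⟨fun _ _ => 0, fun _ _ d _ _ => isHomogeneous_zero d, fun h => absurd h hi⟩
  choose H h1 h2 using h
  exact ⟨H, h1, h2⟩

lemma exists_tens_homotopy (hP : P.IsUniversalProjector) :
    ∃ K : ∀ i l l' : ℤ, tens (P.cpx.X i) (P.cpx.X l) ⟶ tens (P.cpx.X i) (P.cpx.X l'),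
      (∀ i l l', BN.IsHomogeneous 0 (K i l l')) ∧
      ∀ i < 0, ∀ j l l' (_ : j + 1 = l) (_ : l + 1 = l'),
        K i l j ≫ tensMap (𝟙 (P.cpx.X i)) (P.cpx.d j l) +
          tensMap (𝟙 (P.cpx.X i)) (P.cpx.d l l') ≫ K i l' l = 𝟙 _ := by
  have h : ∀ i : ℤ, ∃ K : ∀ l l' : ℤ,
      tens (P.cpx.X i) (P.cpx.X l) ⟶ tens (P.cpx.X i) (P.cpx.X l'),
      (∀ l l', BN.IsHomogeneous 0 (K l l')) ∧
      (i < 0 → ∀ j l l' (_ : j + 1 = l) (_ : l + 1 = l'),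
        K l j ≫ tensMap (𝟙 (P.cpx.X i)) (P.cpx.d j l) +
          tensMap (𝟙 (P.cpx.X i)) (P.cpx.d l l') ≫ K l' l = 𝟙 _) := fun i => by
    by_cases hi : i < 0
    · obtain ⟨H, h1, h2⟩ := (through_of_neg hP hi).tensNull hP
      exact ⟨H, h1, fun _ j l l' hj hl => (h2 j l l' hj hl).trans (tensMap_id _ _)⟩
    · exact ⟨fun _ _ => 0, fun _ _ => isHomogeneous_zero 0, fun h => absurd h hi⟩
  choose K h1 h2 using h
  exact ⟨K, h1, h2⟩

section CochainHomotopy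

variable (H : ∀ i l l' : ℤ, (P.cpx.X i ⟶ P.cpx.X l) →+ (P.cpx.X i ⟶ P.cpx.X l'))

def vHom (k p q : ℤ) (h : p + k = q) : Cochain P.cpx P.cpx k →+ (P.cpx.X p ⟶ P.cpx.X q) :=
  AddMonoidHom.mk' (fun f => f.v p q h) fun f g => Cochain.add_v f g p q h

/-- Descending recursion from degree `0`, where the value is zero. -/
def descend (k : ℤ) : ℕ → ∀ i j : ℤ, Cochain P.cpx P.cpx k →+ (P.cpx.X i ⟶ P.cpx.X j)
  | 0, _, _ => 0
  | r + 1, i, j => (H i (i + k) j).comp (vHom k i (i + k) rfl -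
      (k.negOnePow : ℤ) • (Preadditive.leftComp _ (P.cpx.d i (i + 1))).comp
        (descend k r (i + 1) (i + k)))

lemma descend_succ (k : ℤ) (r : ℕ) (i j : ℤ) (f : Cochain P.cpx P.cpx k) :
    descend H k (r + 1) i j f = H i (i + k) j (f.v i (i + k) rfl -
      k.negOnePow • (P.cpx.d i (i + 1) ≫ descend H k r (i + 1) (i + k) f)) := rfl

lemma descend_homogeneous
    (h1 : ∀ i l l' d f, BN.IsHomogeneous d f → BN.IsHomogeneous d (H i l l' f)) {k d : ℤ}
    {f : Cochain P.cpx P.cpx k} (hf : IsHomogeneous (A := P) (B := P) d f) (r : ℕ) (i j : ℤ) :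
    BN.IsHomogeneous d (descend H k r i j f) := by
  induction r generalizing i j with
  | zero => exact isHomogeneous_zero d
  | succ r ih =>
    rw [descend_succ, sub_eq_add_neg, ← Units.neg_smul]
    exact h1 _ _ _ _ _ ((hf _ _ _).add
      (((P.homogeneous _ _).comp (ih _ _) (zero_add d)).units_smul _))

/-- Induction on `r`, the distance from degree `0`: the component of `f` on `P^i` is corrected by
the part of the homotopy already built on `P^(i + 1)`, and the homotopy of `Hom(P^i, P)` is applied
to the result. At `r = 0` the component of `f` is zero, by `P^i = 0` or by `hf`, and `r - 1`
truncates to `0`, where `descend` vanishes too. -/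
lemma descend_spec (hP : P.IsUniversalProjector)
    (h2 : ∀ i < 0, ∀ j l l' (_ : j + 1 = l) (_ : l + 1 = l') (f : P.cpx.X i ⟶ P.cpx.X l),
        H i l j f ≫ P.cpx.d j l + H i l' l (f ≫ P.cpx.d l l') = f)
    {k l : ℤ} (hl : k + 1 = l) (f : Cochain P.cpx P.cpx k) (hf : f.v 0 k (zero_add k) = 0)
    (r : ℕ) (i j₀ j : ℤ) (hr : (-i).toNat = r) (h : i + k = j) (hj : j₀ + 1 = j) :
    descend H k r i j₀ f ≫ P.cpx.d j₀ j + k.negOnePow •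
      (P.cpx.d i (i + 1) ≫ descend H k (r - 1) (i + 1) j f) + descend H l r i j (δ k l f) =
        f.v i j h := by
  induction r generalizing i j₀ j with
  | zero =>
    have h0 : f.v i j h = 0 := by
      obtain hi | rfl : 0 < i ∨ i = 0 := by omega
      · exact (hP.nonpos i hi).eq_of_src _ _
      · obtain rfl : k = j := by omega
        exact hf
    rw [h0]
    simp [descend]
  | succ r ih =>
    subst h hl
    have hi : i < 0 := by omega
    have ih' := ih (i + 1) (i + k) (i + (k + 1)) (by omega) (by omega) (by omega)
    have e := congrArg (P.cpx.d i (i + 1) ≫ ·) ih'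
    simp only [Preadditive.comp_add, Linear.comp_units_smul, ← Category.assoc, P.cpx.d_comp_d,
      Limits.zero_comp, smul_zero, add_zero] at e
    rw [descend_succ, descend_succ, Nat.add_sub_cancel, add_right_comm]
    -- The corrected component of `δ f` is the corrected component of `f` followed by the
    -- differential. The homotopy formula `h2` therefore applies to it directly.
    have e2 : (δ k (k + 1) f).v i (i + (k + 1)) rfl - (k + 1).negOnePow •
        (P.cpx.d i (i + 1) ≫ descend H (k + 1) r (i + 1) (i + (k + 1)) (δ k (k + 1) f)) =
        (f.v i (i + k) rfl - k.negOnePow • (P.cpx.d i (i + 1) ≫ descend H k r (i + 1) (i + k) f)) ≫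
          P.cpx.d (i + k) (i + (k + 1)) := by
      rw [δ_v k (k + 1) rfl f i (i + (k + 1)) rfl (i + k) (i + 1) (by omega) rfl, ← e,
        Int.negOnePow_succ, Preadditive.sub_comp, Linear.units_smul_comp]
      simp only [Units.neg_smul, smul_add, Category.assoc]
      abel
    rw [e2, h2 i hi j₀ (i + k) (i + (k + 1)) hj (by omega)]
    abel

end CochainHomotopy

/-- The cochains that vanish on `P^0` are filtered by the degree of the source, with pieces
`Hom(P^i, P)`, `i < 0`, all contractible. The recursion splices the contractions; each component
needs finitely many steps, although `P` may be unbounded below. -/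
lemma exists_cochain_homotopy (hP : P.IsUniversalProjector) :
    ∃ H : ∀ k k' : ℤ, Cochain P.cpx P.cpx k →+ Cochain P.cpx P.cpx k',
      (∀ k k' d f, IsHomogeneous (A := P) (B := P) d f →
        IsHomogeneous (A := P) (B := P) d (H k k' f)) ∧
      ∀ j k l (_ : j + 1 = k) (_ : k + 1 = l) (f : Cochain P.cpx P.cpx k),
        f.v 0 k (zero_add k) = 0 → δ j k (H k j f) + H l k (δ k l f) = f := by
  obtain ⟨H, h1, h2⟩ := exists_hom_homotopy hP
  refine ⟨fun k k' => AddMonoidHom.mk'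
    (fun f => Cochain.mk fun p q _ => descend H k (-p).toNat p q f) fun f g => ?_, ?_, ?_⟩
  · refine Cochain.ext _ _ fun p q hpq => ?_
    exact (descend H k (-p).toNat p q).map_add f g
  · intro k k' d f hf p q hpq
    exact descend_homogeneous H h1 hf _ _ _
  · intro j k l hj hl f hf
    refine Cochain.ext _ _ fun p q hpq => ?_
    rw [Cochain.add_v, δ_v j k hj _ p q hpq (q - 1) (p + 1) rfl rfl]
    have e : (-(p + 1)).toNat = (-p).toNat - 1 := by omega
    have := descend_spec H hP h2 hl f hf _ p (q - 1) q rfl hpq (sub_add_cancel q 1)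
    rw [← e] at this
    exact this

end Ch
-- A product on `P` that extends the left unitor
namespace BN

variable {m k n : ℕ}

lemma tensMap_comp_left {A A' A'' : BN m k} (B : BN k n) (f : A ⟶ A') (f' : A' ⟶ A'') :
    tensMap f (𝟙 B) ≫ tensMap f' (𝟙 B) = tensMap (f ≫ f') (𝟙 B) := by
  rw [← tensMap_comp, Category.comp_id]

lemma tensMap_comp_right (A : BN m k) {B B' B'' : BN k n} (g : B ⟶ B') (g' : B' ⟶ B'') :
    tensMap (𝟙 A) g ≫ tensMap (𝟙 A) g' = tensMap (𝟙 A) (g ≫ g') := by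
  rw [← tensMap_comp, Category.comp_id]

lemma tensMap_exchange {A A' : BN m k} {B B' : BN k n} (f : A ⟶ A') (g : B ⟶ B') :
    tensMap f (𝟙 B) ≫ tensMap (𝟙 A') g = tensMap (𝟙 A) g ≫ tensMap f (𝟙 B') := by
  rw [← tensMap_comp, ← tensMap_comp]
  simp only [Category.id_comp, Category.comp_id]

end BN

namespace Ch

open CochainComplex.HomComplex BN

variable {n : ℕ} {P : Ch n n}

section Product

variable (K : ∀ i l l' : ℤ, tens (P.cpx.X i) (P.cpx.X l) ⟶ tens (P.cpx.X i) (P.cpx.X l'))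
  (u : ∀ i j k : ℤ, tens (P.cpx.X i) (P.cpx.X j) ⟶ P.cpx.X k)

/-- The maps `P^i ⊗ P^j ⟶ P^k` for `i = -r`, by recursion from `u` in degree `i = 0`. -/
def prodAux : ℕ → ∀ i j k : ℤ, tens (P.cpx.X i) (P.cpx.X j) ⟶ P.cpx.X k
  | 0, i, j, k => u i j k
  | r + 1, i, j, k => (i + 1).negOnePow • (K i j (j - 1) ≫
      tensMap (P.cpx.d i (i + 1)) (𝟙 (P.cpx.X (j - 1))) ≫ prodAux r (i + 1) (j - 1) k)

lemma prodAux_homogeneous (hK : ∀ i l l', BN.IsHomogeneous 0 (K i l l'))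
    (hu : ∀ i j k, BN.IsHomogeneous 0 (u i j k)) (r : ℕ) (i j k : ℤ) :
    BN.IsHomogeneous 0 (prodAux K u r i j k) := by
  induction r generalizing i j with
  | zero => exact hu i j k
  | succ r ih =>
    exact ((hK _ _ _).comp ((tensMap_homogeneous (P.homogeneous _ _) (isHomogeneous_id _)
      (add_zero 0)).comp (ih _ _) (add_zero 0)) (add_zero 0)).units_smul _

/-- The maps in degree `i` are `± K (d ⊗ 1)` followed by those in degree `i + 1`. The rule in degree
`i + 1` and `d d = 0` turn a differential at the end into `1 ⊗ d`; interchange moves it next to `K`,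
and `K (1 ⊗ d) = 1 - (1 ⊗ d) K` yields the two terms. -/
lemma prodAux_spec (hP : P.IsUniversalProjector)
    (hK : ∀ i < 0, ∀ j l l' (_ : j + 1 = l) (_ : l + 1 = l'),
        K i l j ≫ tensMap (𝟙 (P.cpx.X i)) (P.cpx.d j l) +
          tensMap (𝟙 (P.cpx.X i)) (P.cpx.d l l') ≫ K i l' l = 𝟙 _)
    (hu : ∀ j k, u 0 j j ≫ P.cpx.d j k = tensMap (𝟙 (P.cpx.X 0)) (P.cpx.d j k) ≫ u 0 k k)
    (r : ℕ) (i j j' k k' : ℤ) (hr : (-i).toNat = r) (hj : j + 1 = j') (hk : k + 1 = k')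
    (h : i + j = k) :
    prodAux K u r i j k ≫ P.cpx.d k k' =
      tensMap (P.cpx.d i (i + 1)) (𝟙 (P.cpx.X j)) ≫ prodAux K u (r - 1) (i + 1) j k' +
      i.negOnePow • (tensMap (𝟙 (P.cpx.X i)) (P.cpx.d j j') ≫ prodAux K u r i j' k') := by
  induction r generalizing i j j' with
  | zero =>
    obtain hi | rfl : 0 < i ∨ i = 0 := by omega
    · have e : 𝟙 (tens (P.cpx.X i) (P.cpx.X j)) = 0 := by
        rw [← tensMap_id, (hP.nonpos i hi).eq_of_src (𝟙 (P.cpx.X i)) 0, map_zero,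
          AddMonoidHom.zero_apply]
      rw [← Category.id_comp (_ ≫ _), e, Limits.zero_comp, ← Category.id_comp (_ + _), e,
        Limits.zero_comp]
    · obtain rfl : j = k := by omega
      obtain rfl : j' = k' := by omega
      rw [(hP.nonpos (0 + 1) (by norm_num)).eq_of_tgt (P.cpx.d 0 (0 + 1)) 0, map_zero,
        AddMonoidHom.zero_apply, Limits.zero_comp, zero_add, Int.negOnePow_zero, one_smul]
      exact hu j j'
  | succ r ih =>
    have hi : i < 0 := by omega
    obtain rfl : j = j' - 1 := by omega
    have ih' := ih (i + 1) (j' - 1 - 1) (j' - 1) (by omega) (by omega) (by omega)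
    have hK' := hK i hi (j' - 1 - 1) (j' - 1) j' (by omega) (by omega)
    simp only [prodAux, Nat.add_sub_cancel, Linear.units_smul_comp, Category.assoc,
      Linear.comp_units_smul]
    rw [ih', Preadditive.comp_add, ← Category.assoc (tensMap _ _) (tensMap _ _),
      tensMap_comp_left, P.cpx.d_comp_d, map_zero, AddMonoidHom.zero_apply, Limits.zero_comp,
      zero_add, Linear.comp_units_smul, Linear.comp_units_smul, smul_smul, Int.units_mul_self,
      one_smul, ← Category.assoc (tensMap _ _) (tensMap _ _), tensMap_exchange, Category.assoc,
      ← Category.assoc (K _ _ _), eq_sub_of_add_eq hK', Preadditive.sub_comp, Category.id_comp,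
      smul_smul, ← Int.negOnePow_add, show i + (i + 1) = 2 * i + 1 by ring,
      Int.negOnePow_two_mul_add_one, Units.neg_smul, one_smul, Category.assoc]
    exact sub_eq_add_neg _ _

end Product

/-- A product `P ⊗ P ⟶ P` that extends the unitors. -/
lemma exists_product (hP : P.IsUniversalProjector) :
    ∃ (v : ∀ i j k : ℤ, tens (P.cpx.X i) (P.cpx.X j) ⟶ P.cpx.X k)
      (lam : ∀ j, P.cpx.X j ⟶ tens (P.cpx.X 0) (P.cpx.X j))
      (rho : ∀ i, P.cpx.X i ⟶ tens (P.cpx.X i) (P.cpx.X 0)),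
      (∀ i j k, BN.IsHomogeneous 0 (v i j k)) ∧ (∀ j, BN.IsHomogeneous 0 (lam j)) ∧
      (∀ i, BN.IsHomogeneous 0 (rho i)) ∧
      (∀ i i' j j' k k' (_ : i + 1 = i') (_ : j + 1 = j') (_ : k + 1 = k') (_ : i + j = k),
        v i j k ≫ P.cpx.d k k' =
          tensMap (P.cpx.d i i') (𝟙 (P.cpx.X j)) ≫ v i' j k' +
            i.negOnePow • (tensMap (𝟙 (P.cpx.X i)) (P.cpx.d j j') ≫ v i j' k')) ∧
      (∀ j l (g : P.cpx.X j ⟶ P.cpx.X l), g ≫ lam l = lam j ≫ tensMap (𝟙 _) g) ∧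
      (∀ j l (g : P.cpx.X j ⟶ P.cpx.X l), g ≫ rho l = rho j ≫ tensMap g (𝟙 _)) ∧
      (∀ j, lam j ≫ v 0 j j = 𝟙 _) ∧ lam 0 = rho 0 := by
  obtain ⟨K, hK1, hK2⟩ := exists_tens_homotopy hP
  obtain ⟨e, he, he'⟩ := hP.zero
  let L : ∀ j, tens (P.cpx.X 0) (P.cpx.X j) ⟶ P.cpx.X j := fun j =>
    tensMap e.hom (𝟙 _) ≫ (leftUnitor (P.cpx.X j)).hom
  have hL : ∀ j l (g : P.cpx.X j ⟶ P.cpx.X l), L j ≫ g = tensMap (𝟙 _) g ≫ L l := fun j l g => by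
    change (tensMap e.hom (𝟙 _) ≫ (leftUnitor _).hom) ≫ g =
      tensMap (𝟙 _) g ≫ tensMap e.hom (𝟙 _) ≫ (leftUnitor _).hom
    rw [Category.assoc, ← leftUnitor_naturality, ← Category.assoc, tensMap_exchange, Category.assoc]
  -- The three degrees are independent, to avoid transport in the recursion; `u` is the unitor for
  -- `i = 0`, `j = k` and a dummy zero otherwise.
  let u : ∀ i j k : ℤ, tens (P.cpx.X i) (P.cpx.X j) ⟶ P.cpx.X k := fun i j k =>
    if h : i = 0 ∧ j = k then eqToHom (by rw [h.1]) ≫ L j ≫ eqToHom (by rw [h.2]) else 0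
  have hu : ∀ j, u 0 j j = L j := fun j => by simp [u]
  have hu1 : ∀ i j k, BN.IsHomogeneous 0 (u i j k) := fun i j k => by
    by_cases h : i = 0 ∧ j = k
    · obtain ⟨rfl, rfl⟩ := h
      rw [hu]
      exact (tensMap_homogeneous he (isHomogeneous_id _) (add_zero 0)).comp
        (leftUnitor_homogeneous _) (add_zero 0)
    · simp only [u, dif_neg h]
      exact isHomogeneous_zero 0
  refine ⟨fun i j k => prodAux K u (-i).toNat i j k,
    fun j => (leftUnitor _).inv ≫ tensMap e.inv (𝟙 _),
    fun j => (rightUnitor _).inv ≫ tensMap (𝟙 _) e.inv,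
    fun i j k => prodAux_homogeneous K u hK1 hu1 _ _ _ _,
    fun j => (leftUnitor_inv_homogeneous _).comp
      (tensMap_homogeneous he' (isHomogeneous_id _) (add_zero 0)) (add_zero 0),
    fun j => (rightUnitor_inv_homogeneous _).comp
      (tensMap_homogeneous (isHomogeneous_id _) he' (add_zero 0)) (add_zero 0), ?_, ?_, ?_, ?_, ?_⟩
  · rintro i _ j j' k k' rfl hj hk h
    have := prodAux_spec K u hP hK2 (fun j k => by rw [hu, hu, hL]) _ i j j' k k' rfl hj hk h
    rwa [show (-i).toNat - 1 = (-(i + 1)).toNat by omega] at this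
  · intro j l g
    rw [Category.assoc, tensMap_exchange, ← Category.assoc, ← Category.assoc]
    congr 1
    rw [Iso.comp_inv_eq, Category.assoc, leftUnitor_naturality, Iso.inv_hom_id_assoc]
  · intro j l g
    rw [Category.assoc, ← tensMap_exchange, ← Category.assoc, ← Category.assoc]
    congr 1
    rw [Iso.comp_inv_eq, Category.assoc, rightUnitor_naturality, Iso.inv_hom_id_assoc]
  · intro j
    change ((leftUnitor _).inv ≫ tensMap e.inv (𝟙 _)) ≫ u 0 j j = _
    rw [hu]
    change ((leftUnitor _).inv ≫ tensMap e.inv (𝟙 _)) ≫ tensMap e.hom (𝟙 _) ≫ (leftUnitor _).hom = _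
    rw [Category.assoc, ← Category.assoc (tensMap _ _), tensMap_comp_left, e.inv_hom_id,
      tensMap_id, Category.id_comp, Iso.inv_hom_id]
  -- Naturality along `e : P^0 ≅ 1_n` reduces `lam 0 = rho 0` to the equality of the two unitors on
  -- the unit.
  · have h1 : (leftUnitor (one n)).inv = (rightUnitor (one n)).inv := by
      rw [Iso.inv_eq_inv]; exact leftUnitor_one
    have h2 : ∀ {A B : BN n n} (f : A ⟶ B), f ≫ (leftUnitor B).inv =
        (leftUnitor A).inv ≫ tensMap (𝟙 _) f := fun f => by
      rw [Iso.comp_inv_eq, Category.assoc, leftUnitor_naturality, Iso.inv_hom_id_assoc]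
    have h3 : ∀ {A B : BN n n} (f : A ⟶ B), f ≫ (rightUnitor B).inv =
        (rightUnitor A).inv ≫ tensMap f (𝟙 _) := fun f => by
      rw [Iso.comp_inv_eq, Category.assoc, rightUnitor_naturality, Iso.inv_hom_id_assoc]
    rw [← cancel_epi e.inv, ← Category.assoc, h2, ← Category.assoc, h3, h1, Category.assoc,
      Category.assoc, tensMap_exchange]

end Ch
-- The sheet maps
namespace Ch

open CochainComplex.HomComplex BN

variable {n : ℕ} {P : Ch n n}

set_option maxHeartbeats 800000 in
/-- Chain maps `S` and `S'` that send `f` to the maps `f ⊗ 1` and `1 ⊗ f` along `P ⊗ P ⟶ P`, up to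
the units: they depend on the component of `f` in degree `0` only. -/
lemma exists_sheet_maps (hP : P.IsUniversalProjector) :
    ∃ S S' : ∀ k, Cochain P.cpx P.cpx k →+ Cochain P.cpx P.cpx k,
      (∀ k d f, IsHomogeneous (A := P) (B := P) d f →
        IsHomogeneous (A := P) (B := P) d (S k f)) ∧
      (∀ k d f, IsHomogeneous (A := P) (B := P) d f →
        IsHomogeneous (A := P) (B := P) d (S' k f)) ∧
      (∀ k l (_ : k + 1 = l) f, δ k l (S k f) = S l (δ k l f)) ∧
      (∀ k l (_ : k + 1 = l) f, δ k l (S' k f) = S' l (δ k l f)) ∧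
      (∀ p q k (hpq : p + q = k) (hqp : q + p = k) (f : Cochain P.cpx P.cpx p)
          (g : Cochain P.cpx P.cpx q),
        (g.comp (S p f) hqp).v 0 k (zero_add k) =
          (p * q).negOnePow • (f.comp (S' q g) hpq).v 0 k (zero_add k)) ∧
      (∀ q (g : Cochain P.cpx P.cpx q), (S' q g).v 0 q (zero_add q) = g.v 0 q (zero_add q)) ∧
      (∀ p (f : Cochain P.cpx P.cpx p), (S p f).v 0 p (zero_add p) =
        (f.comp (S' 0 (Cochain.ofHom (𝟙 P.cpx))) (add_zero p)).v 0 p (zero_add p)) := by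
  obtain ⟨v, lam, rho, hv, hlam, hrho, hd, hlam', hrho', hunit, h0⟩ := exists_product hP
  -- Because `P^1 = 0`, restriction to `P^0` is a chain map. This lets the formulas for `S` and `S'`
  -- see `f` through `f_0` alone.
  have hz : ∀ {k l : ℤ} (_ : k + 1 = l) (f : Cochain P.cpx P.cpx k),
      (δ k l f).v 0 l (zero_add l) = f.v 0 k (zero_add k) ≫ P.cpx.d k l := fun {k l} h f => by
    rw [δ_v k l h f 0 l (zero_add l) k 1 (by omega) rfl,
      (hP.nonpos 1 (by norm_num)).eq_of_tgt (P.cpx.d 0 1) 0, Limits.zero_comp, smul_zero, add_zero]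
  -- The sign in the second map is the Koszul sign for moving a cochain of degree `k` past `P^i`.
  refine ⟨fun k => AddMonoidHom.mk' (fun f => Cochain.mk fun j q _ =>
      lam j ≫ tensMap (f.v 0 k (zero_add k)) (𝟙 _) ≫ v k j q) fun f g => ?_,
    fun k => AddMonoidHom.mk' (fun g => Cochain.mk fun i q _ => (i * k).negOnePow •
      (rho i ≫ tensMap (𝟙 _) (g.v 0 k (zero_add k)) ≫ v i k q)) fun f g => ?_,
    ?_, ?_, ?_, ?_, ?_, ?_, ?_⟩
  · refine Cochain.ext _ _ fun p q hpq => ?_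
    rw [Cochain.mk_v, Cochain.add_v, Cochain.add_v, Cochain.mk_v, Cochain.mk_v, map_add,
      AddMonoidHom.add_apply, Preadditive.add_comp, Preadditive.comp_add]
  · refine Cochain.ext _ _ fun p q hpq => ?_
    rw [Cochain.mk_v, Cochain.add_v, Cochain.add_v, Cochain.mk_v, Cochain.mk_v, map_add,
      Preadditive.add_comp, Preadditive.comp_add, smul_add]
  · intro k d f hf p q hpq
    exact (hlam p).comp ((tensMap_homogeneous (hf _ _ _) (isHomogeneous_id _) (add_zero d)).comp
      (hv _ _ _) (add_zero d)) (zero_add d)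
  · intro k d f hf p q hpq
    exact ((hrho p).comp ((tensMap_homogeneous (isHomogeneous_id _) (hf _ _ _) (zero_add d)).comp
      (hv _ _ _) (add_zero d)) (zero_add d)).units_smul _
  · intro k l h f
    refine Cochain.ext _ _ fun p q hpq => ?_
    rw [δ_v k l h _ p q hpq (q - 1) (p + 1) rfl rfl]
    simp only [AddMonoidHom.mk'_apply, Cochain.mk_v]
    rw [hz h, Category.assoc, Category.assoc,
      hd k l p (p + 1) (q - 1) q h rfl (by omega) (by omega), ← Category.assoc (P.cpx.d p (p + 1)),
      hlam', ← tensMap_comp_left, ← h, Int.negOnePow_succ]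
    simp only [Preadditive.comp_add, Linear.comp_units_smul, Category.assoc, Units.neg_smul]
    rw [← Category.assoc (tensMap (𝟙 _) _) (tensMap _ _), ← tensMap_exchange]
    simp only [Category.assoc]
    abel
  · intro k l h f
    refine Cochain.ext _ _ fun p q hpq => ?_
    rw [δ_v k l h _ p q hpq (q - 1) (p + 1) rfl rfl]
    simp only [AddMonoidHom.mk'_apply, Cochain.mk_v]
    rw [hz h, Linear.units_smul_comp, Category.assoc, Category.assoc,
      hd p (p + 1) k l (q - 1) q rfl h (by omega) (by omega), Linear.comp_units_smul,
      ← Category.assoc (P.cpx.d p (p + 1)), hrho', ← tensMap_comp_right, ← h]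
    simp only [Preadditive.comp_add, Linear.comp_units_smul, Category.assoc, smul_add, smul_smul]
    rw [← Category.assoc (tensMap (𝟙 _) _) (tensMap _ _), ← tensMap_exchange]
    simp only [Category.assoc]
    have e1 : (p * k).negOnePow * p.negOnePow = (p * (k + 1)).negOnePow := by
      rw [← Int.negOnePow_add, mul_add, mul_one]
    have e2 : (k + 1).negOnePow * ((p + 1) * k).negOnePow = -(p * k).negOnePow := by
      rw [← Int.negOnePow_add, show k + 1 + (p + 1) * k = p * k + 1 + (k + k) by ring,
        Int.negOnePow_add _ (k + k), Int.negOnePow_even (k + k) ⟨k, rfl⟩, mul_one,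
        Int.negOnePow_succ]
    rw [e1, e2, Units.neg_smul]
    abel
  -- On `P^0` both composites are `f_0 ⊗ g_0` followed by the product, by interchange and `lam 0 =
  -- rho 0`. The Koszul sign of `S' g` on `P^p` is the sign in the claim.
  · intro p q k hpq hqp f g
    rw [Cochain.comp_v _ _ hqp 0 q k (zero_add q) hqp, Cochain.comp_v _ _ hpq 0 p k (zero_add p) hpq]
    simp only [AddMonoidHom.mk'_apply, Cochain.mk_v]
    rw [Linear.comp_units_smul, smul_smul, Int.units_mul_self, one_smul, ← Category.assoc, hlam',
      ← Category.assoc (f.v 0 p _), hrho', h0]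
    simp only [Category.assoc]
    rw [← Category.assoc (tensMap _ _) (tensMap _ _), ← tensMap_exchange, Category.assoc]
  · intro q g
    simp only [AddMonoidHom.mk'_apply, Cochain.mk_v]
    rw [zero_mul, Int.negOnePow_zero, one_smul, ← h0, ← Category.assoc, ← hlam', Category.assoc,
      hunit, Category.comp_id]
  -- The product need not satisfy the right unit law: `rho` followed by it is `S'` of the identity,
  -- which is why that factor remains.
  · intro p f
    rw [Cochain.comp_v _ _ (add_zero p) 0 p p (zero_add p) (add_zero p)]
    simp only [AddMonoidHom.mk'_apply, Cochain.mk_v]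
    rw [mul_zero, Int.negOnePow_zero, one_smul, Cochain.ofHom_v, HomologicalComplex.id_f,
      tensMap_id, Category.id_comp, ← Category.assoc (f.v 0 p _), hrho', h0, Category.assoc]

end Ch
-- Assembling the homotopy
namespace Ch

section Homotopy

open HomologicalComplex

variable {R : Type} [CommRing R]

/-- The homotopy between maps on a tensor product that bilinear maps give. -/
def tensorHomotopy {K L M : CochainComplex (ModuleCat.{0} R) ℤ}
    {β β' : ∀ p q k : ℤ, p + q = k → Bilin (K.X p) (L.X q) (M.X k)} {hβ hβ'}
    (γ : ∀ p q l : ℤ, Bilin (K.X p) (L.X q) (M.X l))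
    (hγ : ∀ (p q j k l p' q' : ℤ) (h : p + q = k) (_ : p + 1 = p') (_ : q + 1 = q')
      (_ : j + 1 = k) (_ : k + 1 = l) (x : K.X p) (y : L.X q),
      β p q k h x y = γ p' q k (K.d p p' x) y + p.negOnePow • γ p q' k x (L.d q q' y) +
        M.d j k (γ p q j x y) + β' p q k h x y) :
    Homotopy (tensorDesc β hβ) (tensorDesc β' hβ') where
  hom k l := if l + 1 = k then mapBifunctorDesc fun p q _ => tensorLift (γ p q l) else 0
  zero k l h := if_neg h
  comm k := by
    have h1 : (ComplexShape.up ℤ).Rel k (k + 1) := rfl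
    have h2 : (ComplexShape.up ℤ).Rel (k - 1) k := sub_add_cancel k 1
    rw [dNext_eq _ h1, prevD_eq _ h2, if_pos rfl, if_pos (sub_add_cancel k 1)]
    apply mapBifunctor.hom_ext
    intro p q h
    have h' : p + q = k := h
    rw [Preadditive.comp_add, Preadditive.comp_add, mapBifunctor.d_eq, Preadditive.add_comp,
      Preadditive.comp_add, mapBifunctor.ι_D₁_assoc, mapBifunctor.ι_D₂_assoc,
      mapBifunctor.d₁_eq K L _ _ (i₁ := p) (i₁' := p + 1) rfl q (k + 1)
        (by change p + 1 + q = k + 1; omega),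
      mapBifunctor.d₂_eq K L _ _ p (i₂ := q) (i₂' := q + 1) rfl (k + 1)
        (by change p + (q + 1) = k + 1; omega)]
    simp only [Linear.units_smul_comp, Category.assoc, tensorDesc, ι_mapBifunctorDesc,
      ι_mapBifunctorDesc_assoc]
    refine ModuleCat.hom_ext (TensorProduct.ext' fun x y => ?_)
    change β p q k h x y = ((1 : ℤˣ) : ℤ) • γ (p + 1) q k (K.d p (p + 1) x) y +
      (p.negOnePow : ℤ) • γ p (q + 1) k x (L.d q (q + 1) y) + M.d (k - 1) k (γ p q (k - 1) x y) +
        β' p q k h x y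
    rw [Units.val_one, one_smul]
    exact hγ p q (k - 1) k (k + 1) (p + 1) (q + 1) h' rfl rfl (sub_add_cancel k 1) rfl x y

lemma ι_tensorHomotopy {K L M : CochainComplex (ModuleCat.{0} R) ℤ}
    {β β' : ∀ p q k : ℤ, p + q = k → Bilin (K.X p) (L.X q) (M.X k)} {hβ hβ'}
    (γ : ∀ p q l : ℤ, Bilin (K.X p) (L.X q) (M.X l)) (hγ) {p q k l : ℤ} (h : p + q = k)
    (hl : l + 1 = k) :
    ιTensorObj K L p q k h ≫ (tensorHomotopy (β := β) (β' := β') (hβ := hβ) (hβ' := hβ') γ hγ).hom k l =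
      tensorLift (γ p q l) := by
  change _ ≫ (if l + 1 = k then _ else _) = _
  rw [if_pos hl]
  exact ι_mapBifunctorDesc _ _ _ _

end Homotopy

open CochainComplex.HomComplex

variable {n : ℕ} {P : Ch n n}

lemma isHomogeneous_add {k d : ℤ} {f g : Cochain P.cpx P.cpx k}
    (hf : IsHomogeneous (A := P) (B := P) d f) (hg : IsHomogeneous (A := P) (B := P) d g) :
    IsHomogeneous (A := P) (B := P) d (f + g) := fun p q h => (hf p q h).add (hg p q h)

lemma isHomogeneous_units_smul {k d : ℤ} {f : Cochain P.cpx P.cpx k} (u : ℤˣ)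
    (hf : IsHomogeneous (A := P) (B := P) d f) :
    IsHomogeneous (A := P) (B := P) d (u • f) := fun p q h => (hf p q h).units_smul u

lemma isHomogeneous_sub {k d : ℤ} {f g : Cochain P.cpx P.cpx k}
    (hf : IsHomogeneous (A := P) (B := P) d f) (hg : IsHomogeneous (A := P) (B := P) d g) :
    IsHomogeneous (A := P) (B := P) d (f - g) := by
  have := isHomogeneous_add hf (isHomogeneous_units_smul (-1) hg)
  rwa [Units.neg_smul, one_smul, ← sub_eq_add_neg] at this

lemma isHomogeneous_one : IsHomogeneous (A := P) (B := P) 0 (Cochain.ofHom (𝟙 P.cpx)) :=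
  fun p q h => by
    obtain rfl : p = q := by omega
    rw [Cochain.ofHom_v]
    exact BN.isHomogeneous_id _

lemma isHomogeneous_comp {p q k d e c : ℤ} {f : Cochain P.cpx P.cpx p} {g : Cochain P.cpx P.cpx q}
    (hf : IsHomogeneous (A := P) (B := P) d f) (hg : IsHomogeneous (A := P) (B := P) e g)
    (h : p + q = k) (hc : d + e = c) : IsHomogeneous (A := P) (B := P) c (f.comp g h) :=
  hc ▸ IsHomogeneous.comp (A := P) (B := P) (C := P) hf hg h

/-- Chain maps that agree on `P^0` are homotopic through `H`. This gives `S' ≃ 1`, compares `S f`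
with `S'(1) ∘ f`, and joins `S f ∘ g` to `± S' g ∘ f`. The same argument provides `η` with `δ η =
S'(1) - 1`; composition with `η` removes the factor `S'(1)` and gives `S ≃ 1`. -/
lemma exists_sheet_homotopies (hP : P.IsUniversalProjector) :
    ∃ (S S' : ∀ k, Cochain P.cpx P.cpx k →+ Cochain P.cpx P.cpx k)
      (T T' H : ∀ k l, Cochain P.cpx P.cpx k →+ Cochain P.cpx P.cpx l),
      (∀ k d f, IsHomogeneous (A := P) (B := P) d f →
        IsHomogeneous (A := P) (B := P) d (S k f) ∧ IsHomogeneous (A := P) (B := P) d (S' k f) ∧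
        ∀ l, IsHomogeneous (A := P) (B := P) d (T k l f) ∧
          IsHomogeneous (A := P) (B := P) d (T' k l f) ∧
          IsHomogeneous (A := P) (B := P) d (H k l f)) ∧
      (∀ k l (_ : k + 1 = l) f, δ k l (S k f) = S l (δ k l f)) ∧
      (∀ k l (_ : k + 1 = l) f, δ k l (S' k f) = S' l (δ k l f)) ∧
      (∀ j k l (_ : j + 1 = k) (_ : k + 1 = l) (f : Cochain P.cpx P.cpx k),
        δ j k (T k j f) + T l k (δ k l f) = f - S k f) ∧
      (∀ j k l (_ : j + 1 = k) (_ : k + 1 = l) (f : Cochain P.cpx P.cpx k),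
        δ j k (T' k j f) + T' l k (δ k l f) = f - S' k f) ∧
      (∀ p q j k l (hpq : p + q = k) (hqp : q + p = k) (_ : j + 1 = k) (_ : k + 1 = l)
        (f : Cochain P.cpx P.cpx p) (g : Cochain P.cpx P.cpx q) (z : Cochain P.cpx P.cpx k),
        z = g.comp (S p f) hqp - (p * q).negOnePow • f.comp (S' q g) hpq →
          δ j k (H k j z) + H l k (δ k l z) = z) := by
  obtain ⟨S, S', hS, hS', dS, dS', h1, h2, h3⟩ := exists_sheet_maps hP
  obtain ⟨H, hH, dH⟩ := exists_cochain_homotopy hP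
  let o : Cochain P.cpx P.cpx 0 := Cochain.ofHom (𝟙 P.cpx)
  have ho : δ 0 1 o = 0 := δ_ofHom _
  have ho' : δ 0 1 (S' 0 o) = 0 := by rw [dS' 0 1 rfl, ho, map_zero]
  let η : Cochain P.cpx P.cpx (-1) := H 0 (-1) (S' 0 o - o)
  have hη : IsHomogeneous (A := P) (B := P) 0 η :=
    hH _ _ _ _ (isHomogeneous_sub (hS' _ _ _ isHomogeneous_one) isHomogeneous_one)
  have dη : δ (-1) 0 η = S' 0 o - o := by
    have := dH (-1) 0 1 rfl rfl (S' 0 o - o) (by rw [Cochain.sub_v, h2, sub_self])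
    rwa [δ_sub, ho, ho', sub_self, map_zero, add_zero] at this
  let R : ∀ k, Cochain P.cpx P.cpx k →+ Cochain P.cpx P.cpx k := fun k =>
    AddMonoidHom.mk' (fun f => f.comp (S' 0 o) (add_zero k) - S k f) fun f g => by
      rw [Cochain.add_comp, map_add]; abel
  have dR : ∀ k l (_ : k + 1 = l) f, δ k l (R k f) = R l (δ k l f) := fun k l h f => by
    change δ k l (f.comp (S' 0 o) (add_zero k) - S k f) =
      (δ k l f).comp (S' 0 o) (add_zero l) - S l (δ k l f)
    rw [δ_sub, δ_comp f (S' 0 o) (add_zero k) l 1 l h h rfl, ho', Cochain.comp_zero, zero_add,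
      Int.negOnePow_zero, one_smul, dS k l h]
  -- Composition with `η` lowers the degree by one; the value outside `l = k - 1` is a default zero.
  let E : ∀ k l, Cochain P.cpx P.cpx k →+ Cochain P.cpx P.cpx l := fun k l =>
    AddMonoidHom.mk' (fun f => if h : k + -1 = l then f.comp η h else 0) fun f g => by
      by_cases h : k + -1 = l
      · simp only [dif_pos h, Cochain.add_comp]
      · simp only [dif_neg h, add_zero]
  have hE : ∀ k l (h : k + -1 = l) f, E k l f = f.comp η h := fun k l h f => dif_pos h
  have dE : ∀ j k l (_ : j + 1 = k) (_ : k + 1 = l) (f : Cochain P.cpx P.cpx k),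
      δ j k (E k j f) + E l k (δ k l f) = f.comp (S' 0 o) (add_zero k) - f := fun j k l hj hl f => by
    rw [hE k j (by omega), hE l k (by omega), δ_comp f η _ l 0 k hj hl rfl, dη, Cochain.comp_sub,
      Cochain.comp_id, show (-1 : ℤ).negOnePow = -1 from Int.negOnePow_odd _ ⟨-1, rfl⟩,
      Units.neg_smul, one_smul, neg_add_cancel_right]
  refine ⟨S, S', fun k l => (H k l).comp (R k) - E k l,
    fun k l => (H k l).comp (AddMonoidHom.id _ - S' k), H,
    fun k d f hf => ⟨hS _ _ _ hf, hS' _ _ _ hf, fun l => ⟨?_, ?_, hH _ _ _ _ hf⟩⟩, dS, dS', ?_, ?_,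
    ?_⟩
  · refine isHomogeneous_sub (hH _ _ _ _ (isHomogeneous_sub (isHomogeneous_comp hf
      (hS' _ _ _ isHomogeneous_one) _ (add_zero d)) (hS _ _ _ hf))) ?_
    by_cases h : k + -1 = l
    · rw [hE k l h]
      exact isHomogeneous_comp hf hη h (add_zero d)
    · have : E k l f = 0 := dif_neg h
      rw [this]
      exact fun _ _ _ => BN.isHomogeneous_zero d
  · exact hH _ _ _ _ (isHomogeneous_sub hf (hS' _ _ _ hf))
  · intro j k l hj hl f
    have e1 := dH j k l hj hl (R k f) (by
      change (_ - _ : Cochain _ _ _).v _ _ _ = 0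
      rw [Cochain.sub_v, h3, sub_self])
    have e2 := dE j k l hj hl f
    rw [dR k l hl] at e1
    change δ j k (H k j (R k f) - E k j f) + (H l k (R l (δ k l f)) - E l k (δ k l f)) = _
    have e3 : R k f = f.comp (S' 0 o) (add_zero k) - S k f := rfl
    rw [δ_sub, sub_add_sub_comm, e1, e2, e3]
    abel
  · intro j k l hj hl f
    have e1 := dH j k l hj hl (f - S' k f) (by rw [Cochain.sub_v, h2, sub_self])
    rw [δ_sub, dS' k l hl] at e1
    exact e1
  · rintro p q j k l hpq hqp hj hl f g z rfl
    refine dH j k l hj hl _ ?_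
    rw [Cochain.sub_v, Cochain.units_smul_v, h1 p q k hpq hqp, sub_self]

/-- With `±` for `(-1)^(pq)`, the commutator is `(f - S f) ∘ g ∓ (g - S' g) ∘ f + (S f ∘ g ∓ S' g ∘
f)`. Null-homotopies of the three terms are `T f ∘ g`, `∓ T' g ∘ f` and `H` of the last term, and
`β` is their sum. Note that `g.comp f` is `f ∘ g`. -/
lemma exists_commutator_homotopy (hP : P.IsUniversalProjector) :
    ∃ β : ∀ p q l, Cochain P.cpx P.cpx p →+ Cochain P.cpx P.cpx q →+ Cochain P.cpx P.cpx l,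
      (∀ p q l d e f g, IsHomogeneous (A := P) (B := P) d f →
        IsHomogeneous (A := P) (B := P) e g →
          IsHomogeneous (A := P) (B := P) (d + e) (β p q l f g)) ∧
      ∀ p q j k l p' q' (hpq : p + q = k) (hqp : q + p = k) (_ : p + 1 = p') (_ : q + 1 = q')
        (_ : j + 1 = k) (_ : k + 1 = l) (f : Cochain P.cpx P.cpx p) (g : Cochain P.cpx P.cpx q),
        g.comp f hqp = β p' q k (δ p p' f) g + p.negOnePow • β p q' k f (δ q q' g) +
          δ j k (β p q j f g) + (p * q).negOnePow • f.comp g hpq := by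
  obtain ⟨S, S', T, T', H, hh, dS, dS', dT, dT', dH⟩ := exists_sheet_homotopies hP
  let b : ∀ p q l, Cochain P.cpx P.cpx p → Cochain P.cpx P.cpx q → Cochain P.cpx P.cpx l :=
    fun p q l f g => if h : p + q = l + 1 then
      g.comp (T p (p - 1) f) (by omega) - (p * q).negOnePow • f.comp (T' q (q - 1) g) (by omega) +
        H (l + 1) l (g.comp (S p f) (by omega) - (p * q).negOnePow • f.comp (S' q g) h) else 0
  have hb : ∀ p q l f g p₀ q₀ k (hp : p₀ + 1 = p) (hq : q₀ + 1 = q) (hk : l + 1 = k)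
      (h : p + q = k), b p q l f g =
        g.comp (T p p₀ f) (by omega) - (p * q).negOnePow • f.comp (T' q q₀ g) (by omega) +
        H k l (g.comp (S p f) (by omega) - (p * q).negOnePow • f.comp (S' q g) h) := by
    intro p q l f g p₀ q₀ k hp hq hk h
    obtain rfl : p₀ = p - 1 := by omega
    obtain rfl : q₀ = q - 1 := by omega
    subst hk
    exact dif_pos h
  let β : ∀ p q l, Cochain P.cpx P.cpx p →+ Cochain P.cpx P.cpx q →+ Cochain P.cpx P.cpx l :=
    fun p q l => AddMonoidHom.mk' (fun f => AddMonoidHom.mk' (b p q l f) fun g g' => by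
        by_cases h : p + q = l + 1
        · simp only [b, dif_pos h, map_add, map_sub, Cochain.add_comp, Cochain.comp_add, smul_add]
          abel
        · simp only [b, dif_neg h, add_zero])
      fun f f' => by
        ext1 g
        change b p q l (f + f') g = b p q l f g + b p q l f' g
        by_cases h : p + q = l + 1
        · simp only [b, dif_pos h, map_add, map_sub, Cochain.add_comp, Cochain.comp_add, smul_add]
          abel
        · simp only [b, dif_neg h, add_zero]
  refine ⟨β, ?_, ?_⟩
  · intro p q l d e f g hf hg
    change IsHomogeneous _ (b p q l f g)
    by_cases h : p + q = l + 1
    · rw [hb p q l f g (p - 1) (q - 1) (l + 1) (by omega) (by omega) rfl h]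
      obtain ⟨f1, -, f2⟩ := hh _ _ _ hf
      obtain ⟨-, g1, g2⟩ := hh _ _ _ hg
      have z := isHomogeneous_sub (isHomogeneous_comp hg f1 (by omega) (add_comm e d))
        (isHomogeneous_units_smul (p * q).negOnePow (isHomogeneous_comp hf g1 h rfl))
      exact isHomogeneous_add (isHomogeneous_sub (isHomogeneous_comp hg (f2 _).1 _ (add_comm e d))
        (isHomogeneous_units_smul _ (isHomogeneous_comp hf (g2 _).2.1 _ rfl)))
        ((hh _ _ _ z).2.2 _).2.2
    · have : b p q l f g = 0 := dif_neg h
      rw [this]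
      exact fun _ _ _ => BN.isHomogeneous_zero _
  · intro p q j k l p' q' hpq hqp hp hq hj hl f g
    change _ = b p' q k (δ p p' f) g + p.negOnePow • b p q' k f (δ q q' g) +
      δ j k (b p q j f g) + _
    obtain ⟨p₀, hp₀⟩ : ∃ p₀, p₀ + 1 = p := ⟨p - 1, by omega⟩
    obtain ⟨q₀, hq₀⟩ : ∃ q₀, q₀ + 1 = q := ⟨q - 1, by omega⟩
    have eT := dT p₀ p p' hp₀ hp f
    have eT' := dT' q₀ q q' hq₀ hq g
    have eH := dH p q j k l hpq hqp hj hl f g _ rfl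
    rw [hb p' q k _ g p q₀ l hp hq₀ hl (by omega), hb p q' k f _ p₀ q l hp₀ hq hl (by omega),
      hb p q j f g p₀ q₀ k hp₀ hq₀ hj hpq, δ_add, δ_sub, δ_units_smul,
      δ_comp g (T p p₀ f) _ q' p k hj hq hp₀, δ_comp f (T' q q₀ g) _ p' q k hj hp hq₀,
      eq_sub_of_add_eq eT, eq_sub_of_add_eq eT', eq_sub_of_add_eq eH, δ_sub, δ_units_smul,
      δ_comp g (S p f) _ q' p' l hl hq hp, δ_comp f (S' q g) _ p' q' l hl hp hq, dS p p' hp,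
      dS' q q' hq]
    have s1 : (p' * q).negOnePow = (p * q).negOnePow * q.negOnePow := by
      rw [← hp, add_mul, one_mul, Int.negOnePow_add]
    have s2 : (p * q').negOnePow = (p * q).negOnePow * p.negOnePow := by
      rw [← hq, mul_add, mul_one, Int.negOnePow_add]
    have s3 : p.negOnePow = -p₀.negOnePow := by rw [← hp₀, Int.negOnePow_succ]
    have s4 : q.negOnePow = -q₀.negOnePow := by rw [← hq₀, Int.negOnePow_succ]
    rw [s1, s2, s3, s4]
    simp only [map_sub, map_add, Cochain.comp_sub]
    -- All signs are now products of these three units; fixing their values leaves an identity in an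
    -- abelian group.
    rcases Int.units_eq_one_or p₀.negOnePow with h1 | h1 <;>
      rcases Int.units_eq_one_or q₀.negOnePow with h2 | h2 <;>
      rcases Int.units_eq_one_or (p * q).negOnePow with h3 | h3 <;>
      · simp only [h1, h2, h3, one_smul, Units.neg_smul, mul_one, mul_neg, neg_neg, map_neg,
          map_add]
        abel

/-- Cochains are arbitrary families, whereas the sheet algebra is spanned by homogeneous ones;
biadditivity restricts the homotopy to it. -/
lemma map_mem_hom {p q l : ℤ}
    (β : Cochain P.cpx P.cpx p →+ Cochain P.cpx P.cpx q →+ Cochain P.cpx P.cpx l)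
    (hβ : ∀ d e f g, IsHomogeneous (A := P) (B := P) d f → IsHomogeneous (A := P) (B := P) e g →
      IsHomogeneous (A := P) (B := P) (d + e) (β f g))
    {f : Cochain P.cpx P.cpx p} {g : Cochain P.cpx P.cpx q} (hf : f ∈ hom P P p)
    (hg : g ∈ hom P P q) : β f g ∈ hom P P l := by
  induction hf using AddSubgroup.closure_induction with
  | zero => rw [map_zero]; exact zero_mem _
  | add x x' _ _ hx hx' => rw [map_add]; exact add_mem hx hx'
  | neg x _ hx => rw [map_neg]; exact neg_mem hx
  | mem x hx =>
    induction hg using AddSubgroup.closure_induction with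
    | zero => rw [map_zero]; exact zero_mem _
    | add y y' _ _ hy hy' => rw [map_add]; exact add_mem hy hy'
    | neg y _ hy => rw [map_neg]; exact neg_mem hy
    | mem y hy =>
      obtain ⟨d, hx⟩ := hx
      obtain ⟨e, hy⟩ := hy
      exact AddSubgroup.subset_closure ⟨d + e, hβ d e x y hx hy⟩

end Ch
end BarNatan

end

theorem mainTheorem6 (n : ℕ) (P : BarNatan.Ch n n) (hP : P.IsUniversalProjector) :
    ∃ H : Homotopy P.mul P.mulOp, BarNatan.Ch.PreservesDegree H := by
  obtain ⟨β, hβ, dβ⟩ := BarNatan.Ch.exists_commutator_homotopy hP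
  let γ : ∀ p q l : ℤ, BarNatan.Ch.Bilin (P.endComplex.X p) (P.endComplex.X q)
      (P.endComplex.X l) := fun p q l =>
    LinearMap.mk₂ ℤ (fun (f : BarNatan.Ch.hom P P p) (g : BarNatan.Ch.hom P P q) =>
        (⟨β p q l f.1 g.1, BarNatan.Ch.map_mem_hom _ (hβ p q l) f.2 g.2⟩ : BarNatan.Ch.hom P P l))
      (fun f f' g => Subtype.ext (DFunLike.congr_fun (map_add (β p q l) f.1 f'.1) g.1))
      (fun c f g => Subtype.ext (DFunLike.congr_fun (map_zsmul (β p q l) c f.1) g.1))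
      (fun f g g' => Subtype.ext (map_add (β p q l f.1) g.1 g'.1))
      (fun c f g => Subtype.ext (map_zsmul (β p q l f.1) c g.1))
  obtain ⟨H, hH⟩ : ∃ H : Homotopy P.mul P.mulOp, ∀ {p q k l : ℤ} (h : p + q = k) (_ : l + 1 = k),
      HomologicalComplex.ιTensorObj P.endComplex P.endComplex p q k h ≫ H.hom k l =
        BarNatan.Ch.tensorLift (γ p q l) :=
    ⟨BarNatan.Ch.tensorHomotopy γ fun p q j k l p' q' h hp hq hj hl f g =>
      Subtype.ext (dβ p q j k l p' q' h (by omega) hp hq hj hl f.1 g.1),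
      fun h hl => BarNatan.Ch.ι_tensorHomotopy γ _ h hl⟩
  refine ⟨H, ?_⟩
  intro p q k l h d e f g hf hg
  -- Off `l + 1 = k` the component of the homotopy is zero, which has every quantum degree.
  by_cases hl : l + 1 = k
  · have e1 := LinearMap.congr_fun (congrArg ModuleCat.Hom.hom (hH h hl))
      (TensorProduct.tmul ℤ (show P.endComplex.X p from f) (show P.endComplex.X q from g))
    exact (congrArg (fun z : BarNatan.Ch.hom P P l =>
      BarNatan.Ch.IsHomogeneous (A := P) (B := P) (d + e) z.1) e1).mpr (hβ p q l d e f.1 g.1 hf hg)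
  · have e1 := congrArg (fun z => z.hom (P.tmul h f g)) (H.zero k l hl)
    exact (congrArg (fun z : BarNatan.Ch.hom P P l =>
      BarNatan.Ch.IsHomogeneous (A := P) (B := P) (d + e) z.1) e1).mpr
        fun _ _ _ => BarNatan.BN.isHomogeneous_zero _
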